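/- Let $P\subset\mathbb R^2$ be a simple polygon without holes with $n$ vertices, i.e. the closed bounded region whose boundary is a closed polygonal chain with $n$ vertices that does not meet itself. Let $\tau_q,\tau_r$ be nonempty polygonal chains (lists of vertices, joined consecutively by segments) that remain inside $P$, with $m$ vertices in total and with arbitrary real coordinates. For $x\in[0,|\tau_q|]$ let $\tau_q(x)$ be the point at distance $x$ from the beginning of $\tau_q$, measured along the chain ($|\tau_q|$ is its length), and similarly for $\tau_r$. Two points are visible to one another if the segment between them lies in $P$. If the entities $q$ and $r$ start at time $0$ at the beginnings of $\tau_q$ and $\tau_r$ and move with constant velocities $C_0,C_1\ge 0$, then they see each other at time $t\ge 0$ if $C_0t\le|\tau_q|$, $C_1t\le|\tau_r|$, and $\tau_q(C_0t)$ and $\tau_r(C_1t)$ are visible to one another. The trajectory visibility problem for all constant velocities is solvable in time and space polynomial in $n$ and $m$. Precisely, there are programs over the real numbers (exact $+,-,\cdot,/,\sqrt{\ }$ and comparison at unit cost, pairs and lists as data, passes over lists as loops), the same for all inputs, and constants $c,k\in\mathbb N$ such that on every such input each of the following runs takes at most $c(n+m)^k$ steps and allocates at most $c(n+m)^k$ memory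 cells. 1. From the coordinates of the vertices of $P,\tau_q,\tau_r$ alone, the first program computes a table that describes the visibility for all constant velocities at once: a finite list of records, each consisting of a sub-trajectory of $\tau_q$ (an interval $[a,b]$ of distances), a sub-trajectory of $\tau_r$ (an interval $[a',b']$ of distances) and finitely many bilinear inequalities $f_0+f_1x+f_2y+f_3xy\ge 0$, such that for all $C_0,C_1,t\ge 0$ the entities see each other at time $t$ if and only if $(x,y)=(C_0t,C_1t)$ satisfies $a\le x\le b$, $a'\le y\le b'$ and all the inequalities of some record. 2. From the table and any $C_0,C_1\ge 0$, not both $0$, the second program lists in increasing order all maximal time intervals during which $q$ and $r$ see each other (finitely many pairwise disjoint closed intervals, possibly single points, whose union is the set of all times at which they see each other). 3. From the table, a time $t>0$ and the velocity $C\ge 0$ of one of the entities, a program (one for each of the two entities) lists in the same way all maximal ranges of velocities $C'\ge 0$ of the other entity for which the two see each other at time $t$. -/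

import Mathlib

/-! ## Programs over the real numbers, with step counts -/

/-- Programs of a real-number machine with list memory: `RealProg α β` is the type of programs that
read a value of type `α` and produce a value of type `β`.  A value is a real number, a truth value
or a reference to an immutable memory cell (a pair or a list cell), so that every instruction
below touches a bounded number of cells.  The arithmetic is that of the real RAM: exact
`+`, `-`, `*`, `/`, `√` and comparison; there is no rounding, and `0` and `1` are the only constants.
One program serves inputs of all sizes; the only loop is a pass over a list. -/
inductive RealProg : Type → Type → Type 1
  | id {α : Type} : RealProg α α
  | comp {α β γ : Type} (g : RealProg β γ) (f : RealProg α β) : RealProg α γ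
  | pair {α β γ : Type} (f : RealProg α β) (g : RealProg α γ) : RealProg α (β × γ)
  | fst {α β : Type} : RealProg (α × β) α
  | snd {α β : Type} : RealProg (α × β) β
  | zero {α : Type} : RealProg α ℝ
  | one {α : Type} : RealProg α ℝ
  | add : RealProg (ℝ × ℝ) ℝ
  | sub : RealProg (ℝ × ℝ) ℝ
  | mul : RealProg (ℝ × ℝ) ℝ
  | div : RealProg (ℝ × ℝ) ℝ
  | sqrt : RealProg ℝ ℝ
  | le : RealProg (ℝ × ℝ) Bool
  | ite {α β : Type} (b : RealProg α Bool) (f g : RealProg α β) : RealProg α β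
  | nil {α β : Type} : RealProg α (List β)
  | cons {β : Type} : RealProg (β × List β) (List β)
  | listCase {α β γ : Type} (f : RealProg α γ) (g : RealProg (α × β × List β) γ) :
      RealProg (α × List β) γ
  | foldl {σ β : Type} (f : RealProg (σ × β) σ) : RealProg (σ × List β) σ

namespace RealProg

/-- The result of running a program. -/
noncomputable def eval {α β : Type} : RealProg α β → α → β
  | id, a => a
  | comp g f, a => g.eval (f.eval a)
  | pair f g, a => (f.eval a, g.eval a)
  | fst, a => a.1
  | snd, a => a.2
  | zero, _ => 0
  | one, _ => 1
  | add, a => a.1 + a.2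
  | sub, a => a.1 - a.2
  | mul, a => a.1 * a.2
  | div, a => a.1 / a.2
  | sqrt, a => Real.sqrt a
  | le, a => @decide (a.1 ≤ a.2) (Classical.propDecidable _)
  | ite b f g, a => bif b.eval a then f.eval a else g.eval a
  | nil, _ => []
  | cons, a => a.1 :: a.2
  | listCase f _, (a, []) => f.eval a
  | listCase _ g, (a, x :: l) => g.eval (a, x, l)
  | foldl f, a => a.2.foldl (fun s x => f.eval (s, x)) a.1

/-- The sum, over all passes of a loop with body `step` over a list, of `cost`, evaluated at the
current state and list element. -/
def loopCost {σ β : Type} (step : σ × β → σ) (cost : σ × β → ℕ) : σ → List β → ℕ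
  | _, [] => 0
  | s, x :: l => cost (s, x) + loopCost step cost (step (s, x)) l

/-- The running time: the number of instructions executed, where every instruction, every
branching and every pass of a loop costs one step (in addition to the steps of its parts). -/
noncomputable def time {α β : Type} : RealProg α β → α → ℕ
  | comp g f, a => f.time a + g.time (f.eval a) + 1
  | pair f g, a => f.time a + g.time a + 1
  | ite b f g, a => b.time a + (bif b.eval a then f.time a else g.time a) + 1
  | listCase f _, (a, []) => f.time a + 1
  | listCase _ g, (a, x :: l) => g.time (a, x, l) + 1
  | foldl f, a => loopCost f.eval (fun p => f.time p + 1) a.1 a.2 + 1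
  | _, _ => 1

/-- The space: the number of memory cells allocated during the run (besides the cells of the
input), where no cell is ever freed. -/
noncomputable def space {α β : Type} : RealProg α β → α → ℕ
  | id, _ => 0
  | fst, _ => 0
  | snd, _ => 0
  | comp g f, a => f.space a + g.space (f.eval a)
  | pair f g, a => f.space a + g.space a + 1
  | ite b f g, a => b.space a + (bif b.eval a then f.space a else g.space a)
  | listCase f _, (a, []) => f.space a
  | listCase _ g, (a, x :: l) => g.space (a, x, l) + 2
  | foldl f, a => loopCost f.eval (fun p => f.space p + 1) a.1 a.2
  | _, _ => 1

/-- On input `a`, the program `p` needs at most `N` steps and at most `N` memory cells. -/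
def RunsWithin {α β : Type} (p : RealProg α β) (a : α) (N : ℕ) : Prop :=
  p.time a ≤ N ∧ p.space a ≤ N

end RealProg

/-! ## Simple polygons, trajectories and visibility -/

/-- The Euclidean plane. -/
abbrev Plane : Type := EuclideanSpace ℝ (Fin 2)

/-- `P` is the simple polygon (without holes) with the cyclic vertex list `v`: the vertices form a
closed polygonal chain that does not meet itself, and `P` is the closed region that it bounds,
i.e. the bounded set that is the closure of its interior and whose frontier is that chain. -/
structure IsSimplePolygon {n : ℕ} (v : Polygon Plane n) (P : Set Plane) : Prop where
  three_le : 3 ≤ n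
  simple : ∀ i j : Fin n, ∀ s ∈ Set.Ico (0 : ℝ) 1, ∀ t ∈ Set.Ico (0 : ℝ) 1,
    v.edgePath ℝ i s = v.edgePath ℝ j t → i = j ∧ s = t
  bounded : Bornology.IsBounded P
  closure_interior : closure (interior P) = P
  frontier_eq : frontier P = v.boundary ℝ

/-- The length of the polygonal chain with the given list of vertices. -/
noncomputable def chainLength : List Plane → ℝ
  | [] => 0
  | [_] => 0
  | a :: b :: l => dist a b + chainLength (b :: l)

/-- The point reached after travelling the distance `s` from the beginning of a polygonal chain
(meaningful for a nonempty chain and `0 ≤ s ≤ chainLength`). -/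
noncomputable def chainPoint : List Plane → ℝ → Plane
  | [], _ => 0
  | [a], _ => a
  | a :: b :: l, s =>
    if s ≤ dist a b then AffineMap.lineMap a b (s / dist a b)
    else chainPoint (b :: l) (s - dist a b)

/-- `τ` is (the vertex list of) a trajectory that always remains in `P`. -/
def IsTrajectoryIn (τ : List Plane) (P : Set Plane) : Prop :=
  τ ≠ [] ∧ ∀ s ∈ Set.Icc 0 (chainLength τ), chainPoint τ s ∈ P

/-- Two points are visible to one another in `P` if the segment between them lies in `P`. -/
def Visible (P : Set Plane) (a b : Plane) : Prop :=
  segment ℝ a b ⊆ P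

/-- Two entities start at time `0` at the beginnings of the trajectories `τq`, `τr` and move along
them with the constant velocities `C₀`, `C₁`.  At time `t` both are still on their trajectories and
they see each other. -/
def VisibleAt (P : Set Plane) (τq τr : List Plane) (C₀ C₁ t : ℝ) : Prop :=
  0 ≤ t ∧ C₀ * t ≤ chainLength τq ∧ C₁ * t ≤ chainLength τr ∧
    Visible P (chainPoint τq (C₀ * t)) (chainPoint τr (C₁ * t))

/-! ## Inputs and outputs -/

/-- The coordinates of a point. -/
def coords (a : Plane) : ℝ × ℝ := (a 0, a 1)

/-- Inputs: the vertices of the polygon and of the two trajectories, by their coordinates. -/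
abbrev Input : Type := List (ℝ × ℝ) × List (ℝ × ℝ) × List (ℝ × ℝ)

/-- The input given by a polygon and two trajectories. -/
def encode {n : ℕ} (v : Polygon Plane n) (τq τr : List Plane) : Input :=
  (List.ofFn fun i => coords (v i), τq.map coords, τr.map coords)

/-- An output record `((a, b), (c, d), fs)`: the sub-trajectory of the first entity between the
distances `a` and `b` from the beginning of its trajectory, the sub-trajectory of the second entity
between the distances `c` and `d`, and the coefficients of finitely many bilinear functions. -/
abbrev VisRecord : Type := (ℝ × ℝ) × (ℝ × ℝ) × List (ℝ × ℝ × ℝ × ℝ)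

/-- A record covers the distances `x` and `y` travelled by the two entities if these points are on
the two sub-trajectories and satisfy all inequalities `f₀ + f₁ x + f₂ y + f₃ x y ≥ 0` of the
record. -/
def VisRecord.Covers (R : VisRecord) (x y : ℝ) : Prop :=
  R.1.1 ≤ x ∧ x ≤ R.1.2 ∧ R.2.1.1 ≤ y ∧ y ≤ R.2.1.2 ∧
    ∀ f ∈ R.2.2, 0 ≤ f.1 + f.2.1 * x + f.2.2.1 * y + f.2.2.2 * (x * y)

/-- The list `l` consists of the maximal intervals of the set `S`, in increasing order: `S` is the
disjoint union of the closed intervals `[a, b]` for the entries `(a, b)` of `l`. -/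
def ListsIntervals (l : List (ℝ × ℝ)) (S : Set ℝ) : Prop :=
  (∀ I ∈ l, I.1 ≤ I.2) ∧ l.Pairwise (fun I J => I.2 < J.1) ∧
    ∀ t : ℝ, t ∈ S ↔ ∃ I ∈ l, t ∈ Set.Icc I.1 I.2

/-! Whether `p` sees `r` is decided by the signs of a few functions per edge (`edgeFunctions`): the
orientations of `p, r` with its end points and of the edge with `p` and `r`, and coordinate
differences. Let `p', r'` have the same signs as `p, r`, let `pr` lie in the polygon, and suppose
that `p'r'` leaves the polygon at a last point `z`. If `z` is inside an edge, then `pr` meets the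
inside of that edge too and continues to the same side; if `z` is a vertex, then `pr` passes through
`z` and continues to the same side of every edge. In both cases points just beyond, one on each
segment, are joined by a segment that meets no edge, so they are both in the polygon or both
outside, a contradiction (`segment_subset_of_sign_eq`).

On one segment of each trajectory the positions are affine in the travelled distances `x`, `y`, so
these functions are bilinear, and the visible pairs form a closed union of sign cells in a
rectangle. Where its leading coefficient in `y` does not vanish, a bilinear function has the single
zero `y = zeroAt f x`. Hence the plane decomposes vertically: between consecutive roots of the
constant coefficients, leading coefficients and pairwise resultants, the order of these graphs is
fixed. All regions between two abscissae and two graphs are tried, and those whose sample points are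
all visible are kept (`exists_mem_coveringRecords_iff`). Leading coefficients vanishing on the
border of a strip do no harm: if the graph stays between two heights, the function factors and the
graph is a horizontal line, which `addHeights` supplies separately. Visibility at a sample point is
tested by cutting the line of sight at the edges and locating midpoints by crossing parity
(`segmentMem_eq_true`).

A query restricts `(x, y)` to a line, on which each record becomes a system of quadratic
inequalities in one variable. Its solution set changes only at roots, so the maximal intervals end
at roots and are found by testing midpoints (`listsIntervals_quadIntervals`).

All of this is brute force over lists. `PolyTime` is closed under composition, list operations and
loops with states of polynomial size, so the cost bounds follow from the shape of the definitions.
-/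

/-! ## Polynomial-time functions -/

/-- Data types with a notion of size: the number of entries, with an offset making it at least
two, so that the powers of the size dominate all polynomials in it. -/
class Sized (α : Type) where
  /-- The size of a value. -/
  size : α → ℕ
  two_le_size : ∀ a, 2 ≤ size a

open Sized

instance : Sized ℝ := ⟨fun _ => 2, fun _ => le_rfl⟩

instance : Sized Bool := ⟨fun _ => 2, fun _ => le_rfl⟩

instance {α β : Type} [Sized α] [Sized β] : Sized (α × β) :=
  ⟨fun p => size p.1 + size p.2, fun p => (two_le_size p.1).trans (Nat.le_add_right _ _)⟩

instance {α : Type} [Sized α] : Sized (List α) :=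
  ⟨fun l => 2 + (l.map size).sum, fun _ => Nat.le_add_right _ _⟩

/-! ### Arithmetic of sizes -/

section Size

variable {α β : Type} [Sized α] [Sized β]

theorem size_prod (p : α × β) : size p = size p.1 + size p.2 := rfl

theorem size_list (l : List α) : size l = 2 + (l.map size).sum := rfl

theorem size_real (x : ℝ) : size x = 2 := rfl

theorem size_bool (x : Bool) : size x = 2 := rfl

theorem size_pos (a : α) : 0 < size a := zero_lt_two.trans_le (two_le_size a)

theorem size_cons (x : α) (l : List α) : size (x :: l) = size x + size l := by
  simp [size_list]; omega

theorem size_append (l l' : List α) : size (l ++ l') + 2 = size l + size l' := by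
  simp [size_list]; omega

theorem size_reverse (l : List α) : size l.reverse = size l := by
  simp [size_list, List.sum_reverse]

theorem length_le_size (l : List α) : l.length ≤ size l := by
  induction l with
  | nil => simp
  | cons x l ih => rw [size_cons, List.length_cons]; have := two_le_size x; omega

theorem size_le_of_mem {x : α} {l : List α} (h : x ∈ l) : size x ≤ size l := by
  rw [size_list]
  exact (List.single_le_sum (fun _ _ => Nat.zero_le _) _ (List.mem_map_of_mem h)).trans
    (Nat.le_add_left _ _)

theorem size_le_of_sublist {l l' : List α} (h : l.Sublist l') : size l ≤ size l' := by
  induction h with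
  | slnil => exact le_rfl
  | cons a _ ih => rw [size_cons]; omega
  | cons_cons a _ ih => rw [size_cons, size_cons]; omega

theorem size_list_le {l : List α} {M : ℕ} (h : ∀ x ∈ l, size x ≤ M) :
    size l ≤ 2 + l.length * M := by
  rw [size_list]
  have := List.sum_le_card_nsmul (l.map size) M (by simpa using h)
  simpa using this

end Size

/-- A function into the natural numbers that is polynomially bounded in the size of its argument. -/
def PolyBounded {α : Type} [Sized α] (F : α → ℕ) : Prop := ∃ k, ∀ a, F a ≤ size a ^ k

/-! ### Closure of polynomial bounds -/

namespace PolyBounded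

variable {α β : Type} [Sized α] [Sized β] {F G : α → ℕ}

theorem mono (hG : PolyBounded G) (h : ∀ a, F a ≤ G a) : PolyBounded F :=
  hG.imp fun _ hk a => (h a).trans (hk a)

theorem const (n : ℕ) : PolyBounded (fun _ : α => n) :=
  ⟨n, fun a => (Nat.lt_two_pow_self).le.trans (Nat.pow_le_pow_left (two_le_size a) n)⟩

theorem size : PolyBounded (Sized.size : α → ℕ) := ⟨1, fun a => by simp⟩

theorem mul (hF : PolyBounded F) (hG : PolyBounded G) : PolyBounded (fun a => F a * G a) := by
  obtain ⟨k, hk⟩ := hF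
  obtain ⟨l, hl⟩ := hG
  exact ⟨k + l, fun a => by rw [pow_add]; exact Nat.mul_le_mul (hk a) (hl a)⟩

theorem add (hF : PolyBounded F) (hG : PolyBounded G) : PolyBounded (fun a => F a + G a) := by
  obtain ⟨k, hk⟩ := hF
  obtain ⟨l, hl⟩ := hG
  -- The additional factor `size a ≥ 2` absorbs the sum of the two powers.
  refine ⟨max k l + 1, fun a => ?_⟩
  have h1 := (hk a).trans (Nat.pow_le_pow_right (size_pos a) (le_max_left k l))
  have h2 := (hl a).trans (Nat.pow_le_pow_right (size_pos a) (le_max_right k l))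
  have h3 := Nat.mul_le_mul_left (Sized.size a ^ max k l) (two_le_size a)
  change F a + G a ≤ _
  rw [pow_succ]
  omega

theorem comp {H : β → ℕ} {f : α → β} (hH : PolyBounded H)
    (hf : PolyBounded fun a => Sized.size (f a)) : PolyBounded (fun a => H (f a)) := by
  obtain ⟨k, hk⟩ := hH
  obtain ⟨l, hl⟩ := hf
  exact ⟨l * k, fun a => (hk _).trans (by rw [pow_mul]; exact Nat.pow_le_pow_left (hl a) k)⟩

end PolyBounded

/-- A function that is computed by a program in time polynomial in the size of the input (and has
results of polynomial size). -/
@[fun_prop]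
def PolyTime {α β : Type} [Sized α] [Sized β] (f : α → β) : Prop :=
  (PolyBounded fun a => size (f a)) ∧
    ∃ p : RealProg α β, (∀ a, p.eval a = f a) ∧ PolyBounded p.time

/-! ### Space against time, and the cost of loops -/

namespace RealProg

theorem loopCost_le_of_le {σ β : Type} {step : σ × β → σ} {c d : σ × β → ℕ}
    (h : ∀ p, c p ≤ 2 * d p) (s : σ) (l : List β) :
    loopCost step c s l ≤ 2 * loopCost step d s l := by
  induction l generalizing s with
  | nil => simp [loopCost]
  | cons x l ih =>
    have h1 := h (s, x)
    have h2 := ih (step (s, x))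
    simp only [loopCost]
    omega

/-- Each step allocates at most two cells; two occur when `listCase` repacks a nonempty list. Hence
only running times need bounds later. -/
theorem space_le_two_mul_time {α β : Type} (p : RealProg α β) (a : α) :
    p.space a ≤ 2 * p.time a := by
  induction p with
  | comp g f hg hf =>
    have h1 := hf a
    have h2 := hg (f.eval a)
    simp only [space, time]
    omega
  | pair f g hf hg =>
    have h1 := hf a
    have h2 := hg a
    simp only [space, time]
    omega
  | ite b f g hb hf hg =>
    have h1 := hb a
    have h2 := hf a
    have h3 := hg a
    simp only [space, time]
    cases b.eval a <;> simp <;> omega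
  | listCase f g hf hg =>
    obtain ⟨a, _ | ⟨x, l⟩⟩ := a
    · have h1 := hf a
      simp only [space, time]
      omega
    · have h1 := hg (a, x, l)
      simp only [space, time]
      omega
  | foldl f hf =>
    simp only [space, time]
    have := loopCost_le_of_le (step := f.eval) (c := fun p => f.space p + 1)
      (d := fun p => f.time p + 1) (fun p => by have := hf p; omega) a.1 a.2
    omega
  | _ => simp [space, time]

/-- The cost of a pass need only be bounded at states actually reached, that is, after a prefix of
the list. -/
theorem loopCost_le {σ β : Type} {step : σ × β → σ} {c : σ × β → ℕ} {M : ℕ} (s : σ) (l : List β)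
    (h : ∀ l₁ x, l₁ ++ [x] <+: l → c (l₁.foldl (fun s x => step (s, x)) s, x) ≤ M) :
    loopCost step c s l ≤ l.length * M := by
  induction l generalizing s with
  | nil => simp [loopCost]
  | cons x l ih =>
    have h1 := h [] x ⟨l, rfl⟩
    have h2 := ih (step (s, x)) fun l₁ y hy => h (x :: l₁) y (by
      rw [List.cons_append]; exact (List.prefix_cons_inj x).2 hy)
    simp only [loopCost, List.length_cons, Nat.succ_mul]
    simp only [List.foldl_nil] at h1
    omega

end RealProg

/-- The order of the real numbers as a Boolean function. -/
noncomputable def leb (x y : ℝ) : Bool := @decide (x ≤ y) (Classical.propDecidable _)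

@[simp]
theorem leb_eq_true {x y : ℝ} : leb x y = true ↔ x ≤ y := by simp [leb]

@[simp]
theorem leb_eq_false {x y : ℝ} : leb x y = false ↔ y < x := by
  simp [leb]

/-! ### Closure properties of polynomial time -/

namespace PolyTime

variable {α β γ δ σ : Type} [Sized α] [Sized β] [Sized γ] [Sized δ] [Sized σ]

@[fun_prop]
theorem id : PolyTime fun a : α => a :=
  ⟨PolyBounded.size, .id, fun _ => rfl, PolyBounded.const 1⟩

-- Here the size bound in `PolyTime` is essential: the second program runs in time polynomial in the
-- size of an intermediate result.
@[fun_prop]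
theorem comp {g : β → γ} {f : α → β} (hg : PolyTime g) (hf : PolyTime f) :
    PolyTime fun a => g (f a) := by
  obtain ⟨hgs, q, hq, hqt⟩ := hg
  obtain ⟨hfs, p, hp, hpt⟩ := hf
  refine ⟨hgs.comp hfs, .comp q p, fun a => by simp [RealProg.eval, hp, hq], ?_⟩
  refine ((hpt.add (hqt.comp hfs)).add (.const 1)).mono fun a => ?_
  simp [RealProg.time, hp]

@[fun_prop]
theorem pair {f : α → β} {g : α → γ} (hf : PolyTime f) (hg : PolyTime g) :
    PolyTime fun a => (f a, g a) := by
  obtain ⟨hgs, q, hq, hqt⟩ := hg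
  obtain ⟨hfs, p, hp, hpt⟩ := hf
  refine ⟨hfs.add hgs, .pair p q, fun a => by simp [RealProg.eval, hp, hq], ?_⟩
  exact ((hpt.add hqt).add (.const 1)).mono fun a => le_rfl

@[fun_prop]
theorem fst : PolyTime (Prod.fst : α × β → α) :=
  ⟨PolyBounded.size.mono fun p => by rw [size_prod]; omega, .fst, fun _ => rfl, .const 1⟩

@[fun_prop]
theorem snd : PolyTime (Prod.snd : α × β → β) :=
  ⟨PolyBounded.size.mono fun p => by rw [size_prod]; omega, .snd, fun _ => rfl, .const 1⟩

@[fun_prop]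
theorem zero : PolyTime fun _ : α => (0 : ℝ) :=
  ⟨.const 2, .zero, fun _ => rfl, .const 1⟩

@[fun_prop]
theorem one : PolyTime fun _ : α => (1 : ℝ) :=
  ⟨.const 2, .one, fun _ => rfl, .const 1⟩

@[fun_prop]
theorem add {f g : α → ℝ} (hf : PolyTime f) (hg : PolyTime g) : PolyTime fun a => f a + g a :=
  comp (g := fun p : ℝ × ℝ => p.1 + p.2) ⟨.const 2, .add, fun _ => rfl, .const 1⟩ (hf.pair hg)

@[fun_prop]
theorem sub {f g : α → ℝ} (hf : PolyTime f) (hg : PolyTime g) : PolyTime fun a => f a - g a :=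
  comp (g := fun p : ℝ × ℝ => p.1 - p.2) ⟨.const 2, .sub, fun _ => rfl, .const 1⟩ (hf.pair hg)

@[fun_prop]
theorem mul {f g : α → ℝ} (hf : PolyTime f) (hg : PolyTime g) : PolyTime fun a => f a * g a :=
  comp (g := fun p : ℝ × ℝ => p.1 * p.2) ⟨.const 2, .mul, fun _ => rfl, .const 1⟩ (hf.pair hg)

@[fun_prop]
theorem div {f g : α → ℝ} (hf : PolyTime f) (hg : PolyTime g) : PolyTime fun a => f a / g a :=
  comp (g := fun p : ℝ × ℝ => p.1 / p.2) ⟨.const 2, .div, fun _ => rfl, .const 1⟩ (hf.pair hg)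

@[fun_prop]
theorem neg {f : α → ℝ} (hf : PolyTime f) : PolyTime fun a => -f a := by
  simpa using zero.sub hf

@[fun_prop]
theorem two : PolyTime fun _ : α => (2 : ℝ) := by
  simpa [one_add_one_eq_two] using one.add (one (α := α))

@[fun_prop]
theorem sqrt {f : α → ℝ} (hf : PolyTime f) : PolyTime fun a => Real.sqrt (f a) :=
  comp (g := fun p : ℝ => Real.sqrt p) ⟨.const 2, .sqrt, fun _ => rfl, .const 1⟩ hf

@[fun_prop]
theorem leb {f g : α → ℝ} (hf : PolyTime f) (hg : PolyTime g) :
    PolyTime fun a => leb (f a) (g a) :=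
  comp (g := fun p : ℝ × ℝ => _root_.leb p.1 p.2) ⟨.const 2, .le, fun _ => rfl, .const 1⟩
    (hf.pair hg)

@[fun_prop]
theorem cond {b : α → Bool} {f g : α → β} (hb : PolyTime b) (hf : PolyTime f)
    (hg : PolyTime g) : PolyTime fun a => bif b a then f a else g a := by
  obtain ⟨-, r, hr, hrt⟩ := hb
  obtain ⟨hgs, q, hq, hqt⟩ := hg
  obtain ⟨hfs, p, hp, hpt⟩ := hf
  refine ⟨(hfs.add hgs).mono fun a => ?_, .ite r p q, fun a => by simp [RealProg.eval, hp, hq, hr],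
    ((hrt.add (hpt.add hqt)).add (.const 1)).mono fun a => ?_⟩
  · cases h : b a <;> simp [h]
  · simp only [RealProg.time, hr]
    cases b a <;> simp

@[fun_prop]
theorem true : PolyTime fun _ : α => true := by
  -- No instruction yields a truth value except comparison, so constants come from comparing `0` and
  -- `1`.
  have h : ∀ _ : α, _root_.leb 0 0 = Bool.true := fun _ => by simp
  exact funext h ▸ (zero (α := α)).leb zero

@[fun_prop]
theorem false : PolyTime fun _ : α => false := by
  have h : ∀ _ : α, _root_.leb 1 0 = Bool.false := fun _ => by simp
  exact funext h ▸ (one (α := α)).leb zero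

@[fun_prop]
theorem not {b : α → Bool} (hb : PolyTime b) : PolyTime fun a => !b a := by
  have h : ∀ a, (!b a) = bif b a then Bool.false else Bool.true := fun a => by cases b a <;> rfl
  simpa only [h] using hb.cond false true

@[fun_prop]
theorem and {b c : α → Bool} (hb : PolyTime b) (hc : PolyTime c) :
    PolyTime fun a => b a && c a := by
  have h : ∀ a, (b a && c a) = bif b a then c a else Bool.false := fun a => by cases b a <;> rfl
  simpa only [h] using hb.cond hc false

@[fun_prop]
theorem or {b c : α → Bool} (hb : PolyTime b) (hc : PolyTime c) :
    PolyTime fun a => b a || c a := by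
  have h : ∀ a, (b a || c a) = bif b a then Bool.true else c a := fun a => by cases b a <;> rfl
  simpa only [h] using hb.cond true hc

@[fun_prop]
theorem xor {b c : α → Bool} (hb : PolyTime b) (hc : PolyTime c) :
    PolyTime fun a => b a ^^ c a := by
  have h : ∀ a, (b a ^^ c a) = bif b a then !c a else c a := fun a => by
    cases b a <;> simp
  simpa only [h] using hb.cond hc.not hc

@[fun_prop]
theorem nil : PolyTime fun _ : α => ([] : List β) :=
  ⟨.const 2, .nil, fun _ => rfl, .const 1⟩

@[fun_prop]
theorem cons {f : α → β} {g : α → List β} (hf : PolyTime f) (hg : PolyTime g) :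
    PolyTime fun a => f a :: g a :=
  comp (g := fun p : β × List β => p.1 :: p.2)
    ⟨PolyBounded.size.mono fun p => by rw [size_cons, size_prod], .cons, fun _ => rfl, .const 1⟩
    (hf.pair hg)

theorem listCase {l : α → List β} {f : α → γ} {g : α → β → List β → γ} (hl : PolyTime l)
    (hf : PolyTime f) (hg : PolyTime fun p : α × β × List β => g p.1 p.2.1 p.2.2) :
    PolyTime fun a => List.casesOn (motive := fun _ => γ) (l a) (f a) (g a) := by
  obtain ⟨hgs, q, hq, hqt⟩ := hg
  obtain ⟨hfs, p, hp, hpt⟩ := hf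
  refine comp (g := fun p : α × List β =>
    List.casesOn (motive := fun _ => γ) p.2 (f p.1) (g p.1))
    (f := fun a => (a, l a)) ⟨?_, .listCase p q, ?_, ?_⟩ (id.pair hl)
  · obtain ⟨m, hm⟩ := hfs
    obtain ⟨k, hk⟩ := hgs
    refine (PolyBounded.add ⟨m, fun _ => le_rfl⟩ ⟨k, fun _ => le_rfl⟩).mono ?_
    rintro ⟨a, _ | ⟨x, l⟩⟩
    · refine (hm a).trans ((Nat.pow_le_pow_left ?_ m).trans (Nat.le_add_right _ _))
      exact Nat.le_add_right _ _
    · refine (hk (a, x, l)).trans ((Nat.pow_le_pow_left ?_ k).trans (Nat.le_add_left _ _))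
      simp only [size_prod, size_cons]
      omega
  · rintro ⟨a, _ | ⟨x, l⟩⟩ <;> simp [RealProg.eval, hp, hq]
  · obtain ⟨m, hm⟩ := hpt
    obtain ⟨k, hk⟩ := hqt
    refine ((PolyBounded.add ⟨m, fun _ => le_rfl⟩ ⟨k, fun _ => le_rfl⟩).add (.const 1)).mono ?_
    rintro ⟨a, _ | ⟨x, l⟩⟩
    · have h1 := hm a
      have h2 : size a ^ m ≤ size (a, ([] : List β)) ^ m :=
        Nat.pow_le_pow_left (Nat.le_add_right _ _) m
      simp only [RealProg.time]
      omega
    · have h1 := hk (a, x, l)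
      have h2 : size (a, x, l) ^ k ≤ size (a, x :: l) ^ k :=
        Nat.pow_le_pow_left (by simp only [size_prod, size_cons]; omega) k
      simp only [RealProg.time]
      omega

/-- A loop runs in polynomial time if its body does and its states have polynomial size. -/
theorem foldl {f : α → List β} {i : α → σ} {g : α → σ → β → σ} (hf : PolyTime f)
    (hi : PolyTime i) (hg : PolyTime fun p : (α × σ) × β => g p.1.1 p.1.2 p.2)
    (hb : ∃ k, ∀ a l, l <+: f a → size (l.foldl (g a) (i a)) ≤ size a ^ k) :
    PolyTime fun a => (f a).foldl (g a) (i a) := by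
  -- A loop body sees only its state and the current element, so the parameter `a` is carried along
  -- in the state.
  have hbody : PolyTime fun p : (α × σ) × β => (p.1.1, g p.1.1 p.1.2 p.2) :=
    .pair (by fun_prop) hg
  obtain ⟨-, p, hp, m, hm⟩ := hbody
  have hstart : PolyTime fun a => ((a, i a), f a) := by fun_prop
  obtain ⟨-, q, hq, hqt⟩ := hstart
  obtain ⟨k, hk⟩ := hb
  have hfold : ∀ a s (l : List β), l.foldl (fun s x => p.eval (s, x)) (a, s)
      = (a, l.foldl (g a) s) := by
    intro a s l
    induction l generalizing s with
    | nil => rfl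
    | cons x l ih => rw [List.foldl_cons, hp, ih, List.foldl_cons]
  refine ⟨⟨k, fun a => hk a _ List.prefix_rfl⟩,
    .comp .snd (.comp (.foldl p) q), fun a => ?_, ?_⟩
  · simp [RealProg.eval, hq, hfold]
  · have hbound : PolyBounded fun a => size (f a) *
        ((size a + size a ^ k + size (f a)) ^ m + 1) := by
      have h : PolyBounded fun a => size (f a) := hf.1
      refine h.mul (.add ?_ (.const 1))
      obtain ⟨j, hj⟩ := (PolyBounded.size.add (⟨k, fun _ => le_rfl⟩ : PolyBounded
        fun a : α => size a ^ k)).add h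
      exact ⟨j * m, fun a => by rw [pow_mul]; exact Nat.pow_le_pow_left (hj a) m⟩
    refine ((hqt.add hbound).add (.const 4)).mono fun a => ?_
    simp only [RealProg.time, hq]
    have hloop := RealProg.loopCost_le (step := p.eval) (c := fun x => p.time x + 1)
      (M := (size a + size a ^ k + size (f a)) ^ m + 1) (a, i a) (f a) (fun l₁ x hl => by
        rw [hfold]
        refine Nat.add_le_add_right ((hm _).trans (Nat.pow_le_pow_left ?_ m)) 1
        have h1 := hk a l₁ ((List.prefix_append _ _).trans hl)
        have h2 : size x ≤ size (f a) := size_le_of_mem (hl.subset (by simp))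
        simp only [size_prod]
        omega)
    have hlen := Nat.mul_le_mul_right ((size a + size a ^ k + size (f a)) ^ m + 1)
      (length_le_size (f a))
    omega

/-- A loop that conses reverses its list; `append` and `map` therefore loop over a reversed list. -/
theorem reverse {f : α → List β} (hf : PolyTime f) : PolyTime fun a => (f a).reverse := by
  have h : ∀ l m : List β, l.foldl (fun s x => x :: s) m = l.reverse ++ m := by
    intro l
    induction l with
    | nil => simp
    | cons x l ih => simp [ih]
  have := foldl (g := fun (_ : α) (s : List β) x => x :: s) hf (nil (β := β)) (by fun_prop) (by
    obtain ⟨k, hk⟩ := hf.1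
    refine ⟨k, fun a l hl => ?_⟩
    rw [h, List.append_nil, size_reverse]
    exact (size_le_of_sublist hl.sublist).trans (hk a))
  simpa only [h, List.append_nil] using this

@[fun_prop]
theorem append {f g : α → List β} (hf : PolyTime f) (hg : PolyTime g) :
    PolyTime fun a => f a ++ g a := by
  have h : ∀ l m : List β, l.foldl (fun s x => x :: s) m = l.reverse ++ m := by
    intro l
    induction l with
    | nil => simp
    | cons x l ih => simp [ih]
  have := foldl (g := fun (_ : α) (s : List β) x => x :: s) hf.reverse hg (by fun_prop) (by
    obtain ⟨k, hk⟩ := hf.1.add hg.1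
    refine ⟨k, fun a l hl => ?_⟩
    have h1 := size_append l.reverse (g a)
    have h2 := size_le_of_sublist hl.sublist
    have h3 := hk a
    rw [size_reverse] at h1 h2
    rw [h]
    dsimp only at h3
    omega)
  simpa only [h, List.reverse_reverse] using this

@[fun_prop]
theorem map {f : α → List β} {g : α → β → γ} (hf : PolyTime f)
    (hg : PolyTime fun p : α × β => g p.1 p.2) : PolyTime fun a => (f a).map (g a) := by
  have h : ∀ a (l : List β) (m : List γ),
      l.foldl (fun s x => g a x :: s) m = (l.map (g a)).reverse ++ m := by
    intro a l
    induction l with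
    | nil => simp
    | cons x l ih => simp [ih]
  have := foldl (g := fun (a : α) (s : List γ) x => g a x :: s) hf.reverse (nil (β := γ))
    (hg.comp (f := fun p : (α × List γ) × β => (p.1.1, p.2)) (by fun_prop) |>.cons
      (by fun_prop)) (by
    obtain ⟨k, hk⟩ := hg.1
    have hb : PolyBounded fun a => 2 + size (f a) * (size a + size (f a)) ^ k := by
      refine (PolyBounded.const 2).add (hf.1.mul ?_)
      obtain ⟨j, hj⟩ := PolyBounded.size.add hf.1
      exact ⟨j * k, fun a => by rw [pow_mul]; exact Nat.pow_le_pow_left (hj a) k⟩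
    obtain ⟨j, hj⟩ := hb
    refine ⟨j, fun a l hl => le_trans ?_ (hj a)⟩
    rw [h, List.append_nil, size_reverse]
    refine (size_list_le (M := (size a + size (f a)) ^ k) ?_).trans ?_
    · simp only [List.mem_map]
      rintro _ ⟨x, hx, rfl⟩
      refine (hk (a, x)).trans (Nat.pow_le_pow_left ?_ k)
      have := size_le_of_mem (List.mem_reverse.1 (hl.subset hx))
      exact Nat.add_le_add_left this _
    · refine Nat.add_le_add_left (Nat.mul_le_mul_right _ ?_) 2
      rw [List.length_map]
      exact (length_le_size l).trans ((size_le_of_sublist hl.sublist).trans (size_reverse _).le))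
  simpa only [h, List.append_nil, List.map_reverse, List.reverse_reverse] using this

theorem flatten {f : α → List (List β)} (hf : PolyTime f) : PolyTime fun a => (f a).flatten := by
  have h : ∀ (l : List (List β)) m, l.foldl (fun s x => s ++ x) m = m ++ l.flatten := by
    intro l
    induction l with
    | nil => simp
    | cons x l ih => simp [ih]
  have hs : ∀ l : List (List β), size l.flatten ≤ size l := by
    intro l
    induction l with
    | nil => rfl
    | cons x l ih =>
      have := size_append x l.flatten
      rw [List.flatten_cons, size_cons]
      omega
  have := foldl (g := fun (_ : α) (s : List β) x => s ++ x) hf (nil (β := β)) (by fun_prop) (by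
    obtain ⟨k, hk⟩ := hf.1
    refine ⟨k, fun a l hl => ?_⟩
    rw [h, List.nil_append]
    exact (hs l).trans ((size_le_of_sublist hl.sublist).trans (hk a)))
  simpa only [h, List.nil_append] using this

@[fun_prop]
theorem flatMap {f : α → List β} {g : α → β → List γ} (hf : PolyTime f)
    (hg : PolyTime fun p : α × β => g p.1 p.2) : PolyTime fun a => (f a).flatMap (g a) := by
  simpa only [List.flatMap_def] using (hf.map hg).flatten

@[fun_prop]
theorem filter {f : α → List β} {g : α → β → Bool} (hf : PolyTime f)
    (hg : PolyTime fun p : α × β => g p.1 p.2) : PolyTime fun a => (f a).filter (g a) := by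
  have h : ∀ a (l : List β), l.flatMap (fun x => bif g a x then [x] else []) = l.filter (g a) := by
    intro a l
    induction l with
    | nil => rfl
    | cons x l ih => cases hx : g a x <;> simp [List.flatMap_cons, hx, ih]
  simpa only [h] using hf.flatMap (g := fun a x => bif g a x then [x] else [])
    (hg.cond (by fun_prop) (by fun_prop))

theorem foldl_bool {f : α → List β} {i : α → Bool} {g : α → Bool → β → Bool} (hf : PolyTime f)
    (hi : PolyTime i) (hg : PolyTime fun p : (α × Bool) × β => g p.1.1 p.1.2 p.2) :
    PolyTime fun a => (f a).foldl (g a) (i a) :=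
  hf.foldl hi hg ⟨1, fun a l _ => by simpa [size_bool] using two_le_size a⟩

@[fun_prop]
theorem any {f : α → List β} {g : α → β → Bool} (hf : PolyTime f)
    (hg : PolyTime fun p : α × β => g p.1 p.2) : PolyTime fun a => (f a).any (g a) := by
  have h : ∀ a (l : List β) b, l.foldl (fun s x => s || g a x) b = (b || l.any (g a)) := by
    intro a l
    induction l with
    | nil => simp
    | cons x l ih => simp [ih, Bool.or_assoc]
  simpa only [h, Bool.false_or] using hf.foldl_bool (g := fun a s x => s || g a x) false
    (.or (by fun_prop) (hg.comp (f := fun p : (α × Bool) × β => (p.1.1, p.2)) (by fun_prop)))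

@[fun_prop]
theorem all {f : α → List β} {g : α → β → Bool} (hf : PolyTime f)
    (hg : PolyTime fun p : α × β => g p.1 p.2) : PolyTime fun a => (f a).all (g a) := by
  simpa only [List.all_eq_not_any_not] using (hf.any (g := fun a x => !g a x) hg.not).not

/-- The pairs of consecutive elements of `a :: l`. -/
theorem zip_cons {f : α → β} {g : α → List β} (hf : PolyTime f) (hg : PolyTime g) :
    PolyTime fun a => (f a :: g a).zip (g a) := by
  have h : ∀ (l : List β) (x : β) (m : List (β × β)),
      (l.foldl (fun (s : β × List (β × β)) y => (y, (s.1, y) :: s.2)) (x, m)).2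
        = ((x :: l).zip l).reverse ++ m := by
    intro l
    induction l with
    | nil => simp
    | cons y l ih => intro x m; simp [ih]
  have h' : ∀ (l : List β) (x : β) (m : List (β × β)),
      size (l.foldl (fun (s : β × List (β × β)) y => (y, (s.1, y) :: s.2)) (x, m))
        ≤ 2 * size x + size m + 3 * size l := by
    intro l
    induction l with
    | nil => intro x m; simp only [List.foldl_nil, size_prod]; omega
    | cons y l ih =>
      intro x m
      have := ih y ((x, y) :: m)
      simp only [List.foldl_cons, size_cons, size_prod] at this ⊢
      omega
  have := hg.foldl (g := fun (_ : α) (s : β × List (β × β)) y => (y, (s.1, y) :: s.2))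
    (hf.pair nil) (by fun_prop) (by
    obtain ⟨k, hk⟩ := (((PolyBounded.const 2).mul hf.1).add (.const 2)).add
      ((PolyBounded.const 3).mul hg.1)
    refine ⟨k, fun a l hl => (h' _ _ _).trans (le_trans ?_ (hk a))⟩
    have := size_le_of_sublist hl.sublist
    have h2 : size ([] : List (β × β)) = 2 := rfl
    dsimp only
    omega)
  simpa only [h, List.append_nil, List.reverse_reverse] using
    (snd.comp this).reverse

end PolyTime

/-! ## Systems of quadratic inequalities in one variable -/

theorem List.exists_argmax {β : Type*} (K : List β) (p : β → Prop) (f : β → ℝ)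
    (h : ∃ c ∈ K, p c) : ∃ c ∈ K, p c ∧ ∀ c' ∈ K, p c' → f c' ≤ f c := by
  classical
  obtain ⟨c, hc, hmax⟩ := Set.exists_max_image {c | c ∈ K ∧ p c} f
    ((List.finite_toSet K).subset fun c hc => hc.1) h
  exact ⟨c, hc.1, hc.2, fun c' h1 h2 => hmax c' ⟨h1, h2⟩⟩

theorem List.exists_argmin {β : Type*} (K : List β) (p : β → Prop) (f : β → ℝ)
    (h : ∃ c ∈ K, p c) : ∃ c ∈ K, p c ∧ ∀ c' ∈ K, p c' → f c ≤ f c' := by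
  obtain ⟨c, h1, h2, h3⟩ := K.exists_argmax p (fun c => -f c) h
  exact ⟨c, h1, h2, fun c' h4 h5 => neg_le_neg_iff.1 (h3 c' h4 h5)⟩

/-- The value at `s` of the quadratic polynomial with coefficients `q`, constant term first. -/
def quadEval (q : ℝ × ℝ × ℝ) (s : ℝ) : ℝ := q.1 + q.2.1 * s + q.2.2 * (s * s)

/-- A list containing all roots of a nonzero polynomial of degree at most two. -/
noncomputable def quadRoots (q : ℝ × ℝ × ℝ) : List ℝ :=
  [-q.1 / q.2.1,
    (-q.2.1 + Real.sqrt (q.2.1 * q.2.1 - 2 * 2 * (q.1 * q.2.2))) / (2 * q.2.2),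
    (-q.2.1 - Real.sqrt (q.2.1 * q.2.1 - 2 * 2 * (q.1 * q.2.2))) / (2 * q.2.2)]

@[fun_prop]
theorem PolyTime.quadEval {α : Type} [Sized α] {f : α → ℝ × ℝ × ℝ} {g : α → ℝ}
    (hf : PolyTime f) (hg : PolyTime g) : PolyTime fun a => quadEval (f a) (g a) := by
  unfold _root_.quadEval; fun_prop

@[fun_prop]
theorem PolyTime.quadRoots {α : Type} [Sized α] {f : α → ℝ × ℝ × ℝ}
    (hf : PolyTime f) : PolyTime fun a => quadRoots (f a) := by
  unfold _root_.quadRoots; fun_prop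

theorem continuous_quadEval (q : ℝ × ℝ × ℝ) : Continuous (quadEval q) := by
  unfold quadEval; fun_prop

/-- At a root `s` the discriminant equals `(2as + b)²`, so its square root is `±(2as + b)`. In
degenerate cases some entries of the list come from division by zero; surplus entries do no harm. -/
theorem mem_quadRoots {q : ℝ × ℝ × ℝ} {s : ℝ} (hq : q ≠ 0) (hs : quadEval q s = 0) :
    s ∈ quadRoots q := by
  obtain ⟨c, b, a⟩ := q
  simp only [quadEval] at hs
  simp only [quadRoots, List.mem_cons, List.not_mem_nil, or_false]
  by_cases ha : a = 0
  · subst ha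
    by_cases hb : b = 0
    · subst hb
      exact absurd (by simpa using hs) (by simpa using hq)
    · left
      field_simp
      linarith
  · right
    have hd : b * b - 2 * 2 * (c * a) = (2 * a * s + b) ^ 2 := by linear_combination (-4 * a) * hs
    rw [hd, Real.sqrt_sq_eq_abs]
    rcases abs_choice (2 * a * s + b) with h | h <;> rw [h]
    · left
      field_simp
      ring
    · right
      field_simp
      ring

/-- Intermediate value theorem. The zero polynomial, whose roots are not listed, has constant sign
anyway. -/
theorem sign_quadEval_eq {q : ℝ × ℝ × ℝ} {s t : ℝ}
    (h : ∀ r ∈ quadRoots q, r ∉ Set.uIcc s t) :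
    SignType.sign (quadEval q s) = SignType.sign (quadEval q t) := by
  by_cases hq : q = 0
  · simp [hq, quadEval]
  have hne : ∀ r ∈ Set.uIcc s t, quadEval q r ≠ 0 := fun r hr h0 => h r (mem_quadRoots hq h0) hr
  have hivt := intermediate_value_uIcc (a := s) (b := t) (continuous_quadEval q).continuousOn
  have h0 : (0 : ℝ) ∉ Set.uIcc (quadEval q s) (quadEval q t) := fun h0 => by
    obtain ⟨r, hr, hr0⟩ := hivt h0
    exact hne r hr hr0
  rw [Set.mem_uIcc] at h0
  rcases lt_trichotomy (quadEval q s) 0 with hs | hs | hs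
  · rw [sign_neg hs, sign_neg]
    by_contra! ht
    exact h0 (Or.inl ⟨hs.le, ht⟩)
  · exact absurd hs (hne s Set.left_mem_uIcc)
  · rw [sign_pos hs, sign_pos]
    by_contra! ht
    exact h0 (Or.inr ⟨ht, hs.le⟩)

theorem nonneg_iff_of_sign_eq {x y : ℝ} (h : SignType.sign x = SignType.sign y) :
    0 ≤ x ↔ 0 ≤ y := by
  rw [← sign_nonneg_iff, h, sign_nonneg_iff]

/-! ### Sorting without repetitions -/

/-- Insertion into a strictly increasing list. -/
noncomputable def sortInsert (l : List ℝ) (x : ℝ) : List ℝ :=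
  l.filter (fun y => !leb x y) ++ x :: l.filter (fun y => !leb y x)

/-- The strictly increasing list of the elements of a list. -/
noncomputable def sortDedup (l : List ℝ) : List ℝ := l.foldl sortInsert []

theorem mem_sortInsert {l : List ℝ} {x y : ℝ} : y ∈ sortInsert l x ↔ y ∈ l ∨ y = x := by
  simp only [sortInsert, List.mem_append, List.mem_filter, List.mem_cons, Bool.not_eq_true',
    leb_eq_false]
  constructor
  · tauto
  · rintro (h | h)
    · rcases lt_trichotomy y x with h' | h' | h'
      · exact Or.inl ⟨h, h'⟩
      · exact Or.inr (Or.inl h')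
      · exact Or.inr (Or.inr ⟨h, h'⟩)
    · exact Or.inr (Or.inl h)

theorem pairwise_sortInsert {l : List ℝ} (hl : l.Pairwise (· < ·)) (x : ℝ) :
    (sortInsert l x).Pairwise (· < ·) := by
  simp only [sortInsert, List.pairwise_append, List.pairwise_cons, List.mem_filter, List.mem_cons,
    Bool.not_eq_true', leb_eq_false]
  refine ⟨hl.filter _, ⟨fun y hy => hy.2, hl.filter _⟩, ?_⟩
  rintro y ⟨-, hy⟩ z (rfl | ⟨-, hz⟩)
  · exact hy
  · exact hy.trans hz

theorem mem_sortDedup {l : List ℝ} {y : ℝ} : y ∈ sortDedup l ↔ y ∈ l := by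
  have h : ∀ l m : List ℝ, y ∈ l.foldl sortInsert m ↔ y ∈ l ∨ y ∈ m := by
    intro l
    induction l with
    | nil => simp
    | cons x l ih =>
      intro m
      rw [List.foldl_cons, ih, mem_sortInsert, List.mem_cons]
      tauto
  simp [sortDedup, h]

theorem pairwise_sortDedup (l : List ℝ) : (sortDedup l).Pairwise (· < ·) := by
  have h : ∀ l m : List ℝ, m.Pairwise (· < ·) → (l.foldl sortInsert m).Pairwise (· < ·) := by
    intro l
    induction l with
    | nil => exact fun m hm => hm
    | cons x l ih => exact fun m hm => ih _ (pairwise_sortInsert hm x)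
  exact h l [] List.Pairwise.nil

@[fun_prop]
theorem PolyTime.sortDedup {α : Type} [Sized α] {f : α → List ℝ} (hf : PolyTime f) :
    PolyTime fun a => sortDedup (f a) := by
  refine hf.foldl (g := fun _ => sortInsert) (σ := List ℝ) (i := fun _ => []) (by fun_prop)
    (by unfold sortInsert; fun_prop) ?_
  have hsize : ∀ l : List ℝ, size l = 2 + 2 * l.length := by
    intro l
    induction l with
    | nil => rfl
    | cons x l ih => rw [size_cons, ih, size_real, List.length_cons]; ring
  have h : ∀ l m : List ℝ, (l.foldl sortInsert m).length ≤ 2 * l.length + m.length := by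
    intro l
    induction l with
    | nil => simp
    | cons x l ih =>
      intro m
      refine (ih _).trans ?_
      have hm : (sortInsert m x).length ≤ m.length + 2 := by
        have h3 : ∀ l : List ℝ, (l.filter fun y => !_root_.leb x y).length +
            (l.filter fun y => !_root_.leb y x).length ≤ l.length := by
          intro l
          induction l with
          | nil => simp
          | cons y l ih =>
            have h5 : _root_.leb x y = Bool.true ∨ _root_.leb y x = Bool.true := by
              simpa using le_total x y
            cases h6 : _root_.leb x y <;> cases h7 : _root_.leb y x <;>
              simp [h6, h7] at h5 ⊢ <;> omega
        have := h3 m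
        simp only [sortInsert, List.length_append, List.length_cons]
        omega
      simp only [List.length_cons]
      omega
  obtain ⟨k, hk⟩ := (PolyBounded.const 2).mul hf.1
  refine ⟨k, fun a l hl => le_trans ?_ (hk a)⟩
  have h1 := h l []
  have h2 := hsize (f a)
  have h3 := hl.length_le
  dsimp only
  rw [hsize]
  simp only [List.length_nil] at h1
  omega

/-! ### Maximal intervals of a set that changes at finitely many points -/

section Intervals

variable {K : List ℝ} {S : Set ℝ}

/-- Neighbouring `c < d` test the gap between them, and `c = d` tests the critical point itself; all
other pairs are redundant. -/
theorem Icc_subset_of_midpoints_mem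
    (hgap : ∀ s ∈ S, ∀ t, (∀ c ∈ K, c ∉ Set.uIcc s t) → t ∈ S) {a b : ℝ} (ha : a ∈ K) (hb : b ∈ K)
    (h : ∀ c ∈ K, ∀ d ∈ K, a ≤ c → c ≤ d → d ≤ b → (c + d) / 2 ∈ S) : Set.Icc a b ⊆ S := by
  rintro s ⟨has, hsb⟩
  by_cases hs : s ∈ K
  · simpa using h s hs s hs has le_rfl hsb
  obtain ⟨c, hc, hcs, hcmax⟩ := K.exists_argmax (· ≤ s) id ⟨a, ha, has⟩
  obtain ⟨d, hd, hsd, hdmin⟩ := K.exists_argmin (s ≤ ·) id ⟨b, hb, hsb⟩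
  have hcs' : c < s := lt_of_le_of_ne hcs fun e => hs (e ▸ hc)
  have hsd' : s < d := lt_of_le_of_ne hsd fun e => hs (e ▸ hd)
  refine hgap _ (h c hc d hd (hcmax a ha has) (hcs.trans hsd) (hdmin b hb hsb)) s fun e he hes => ?_
  rw [Set.mem_uIcc] at hes
  rcases le_total e s with h' | h'
  · have := hcmax e he h'
    rcases hes with hes | hes <;> simp only [id] at this <;> linarith
  · have := hdmin e he h'
    rcases hes with hes | hes <;> simp only [id] at this <;> linarith

/-- The whole open gap around `s` lies in `S`, and closedness adds its ends. -/
theorem exists_Icc_subset (hS : IsClosed S) (ha : BddAbove S) (hb : BddBelow S)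
    (hgap : ∀ s ∈ S, ∀ t, (∀ c ∈ K, c ∉ Set.uIcc s t) → t ∈ S) {s : ℝ} (hs : s ∈ S) :
    ∃ a ∈ K, ∃ b ∈ K, a ≤ s ∧ s ≤ b ∧ Set.Icc a b ⊆ S := by
  by_cases hsK : s ∈ K
  · exact ⟨s, hsK, s, hsK, le_rfl, le_rfl, by simpa using hs⟩
  have h1 : ∃ c ∈ K, c ≤ s := by
    by_contra! hc
    obtain ⟨m, hm⟩ := hb
    -- Without a critical point below `s`, everything to the left of `s` would belong to `S`, even
    -- points below the lower bound `m`.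
    have hmem : min (m - 1) s ∈ S := hgap s hs _ fun c hcK hcm => by
      rw [Set.uIcc_of_ge (min_le_right _ _)] at hcm
      exact (hc c hcK).not_ge hcm.2
    linarith [hm hmem, min_le_left (m - 1) s]
  have h2 : ∃ c ∈ K, s ≤ c := by
    by_contra! hc
    obtain ⟨m, hm⟩ := ha
    have hmem : max (m + 1) s ∈ S := hgap s hs _ fun c hcK hcm => by
      rw [Set.uIcc_of_le (le_max_right _ _)] at hcm
      exact (hc c hcK).not_ge hcm.1
    linarith [hm hmem, le_max_left (m + 1) s]
  obtain ⟨c, hc, hcs, hcmax⟩ := K.exists_argmax (· ≤ s) id h1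
  obtain ⟨d, hd, hsd, hdmin⟩ := K.exists_argmin (s ≤ ·) id h2
  have hcs' : c < s := lt_of_le_of_ne hcs fun e => hsK (e ▸ hc)
  have hsd' : s < d := lt_of_le_of_ne hsd fun e => hsK (e ▸ hd)
  refine ⟨c, hc, d, hd, hcs, hsd, ?_⟩
  rw [← closure_Ioo (hcs'.trans hsd').ne]
  refine closure_minimal (fun t ht => hgap s hs t fun e he hes => ?_) hS
  rw [Set.mem_uIcc] at hes
  rcases le_total e s with h' | h'
  · have := hcmax e he h'
    rcases hes with hes | hes <;> simp only [id] at this <;> linarith [ht.1, ht.2]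
  · have := hdmin e he h'
    rcases hes with hes | hes <;> simp only [id] at this <;> linarith [ht.1, ht.2]

/-- If `K` is increasing and contains all points where the membership in the compact set `S`
changes, then the pairs `(a, b)` of elements of `K` for which `[a, b]` is a maximal interval in `S`
list the intervals of `S`. -/
theorem listsIntervals_of_maximal (hK : K.Pairwise (· < ·)) (hS : IsClosed S) (ha : BddAbove S)
    (hb : BddBelow S) (hgap : ∀ s ∈ S, ∀ t, (∀ c ∈ K, c ∉ Set.uIcc s t) → t ∈ S)
    {p : ℝ → ℝ → Bool} (hp : ∀ a ∈ K, ∀ b ∈ K, (p a b = true ↔ a ≤ b ∧ Set.Icc a b ⊆ S ∧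
      ∀ a' ∈ K, ∀ b' ∈ K, a' ≤ a → b ≤ b' → Set.Icc a' b' ⊆ S → a ≤ a' ∧ b' ≤ b)) :
    ListsIntervals (K.flatMap fun a => (K.filter fun b => p a b).map fun b => (a, b)) S := by
  have hmem : ∀ I : ℝ × ℝ, I ∈ (K.flatMap fun a => (K.filter fun b => p a b).map fun b => (a, b)) ↔
      I.1 ∈ K ∧ I.2 ∈ K ∧ p I.1 I.2 = true := by
    rintro ⟨a, b⟩
    simp only [List.mem_flatMap, List.mem_map, List.mem_filter, Prod.mk.injEq]
    constructor
    · rintro ⟨a, ha, b, hb, rfl, rfl⟩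
      exact ⟨ha, hb⟩
    · rintro ⟨ha, hb⟩
      exact ⟨a, ha, b, hb, rfl, rfl⟩
  have hdisj : ∀ a ∈ K, ∀ b ∈ K, ∀ a' ∈ K, ∀ b' ∈ K, p a b = true → p a' b' = true →
      a ≤ a' → b < a' ∨ a = a' ∧ b = b' := by
    intro a ha b hb a' ha' b' hb' h h' haa
    obtain ⟨hab, hsub, hmax⟩ := (hp a ha b hb).1 h
    obtain ⟨hab', hsub', hmax'⟩ := (hp a' ha' b' hb').1 h'
    refine or_iff_not_imp_left.2 fun hlt => ?_
    rw [not_lt] at hlt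
    -- Two maximal intervals that meet have their union in `S`, so both coincide with it.
    have hunion : Set.Icc a (max b b') ⊆ S := by
      rintro s ⟨h1, h2⟩
      by_cases hsb : s ≤ b
      · exact hsub ⟨h1, hsb⟩
      · rw [not_le] at hsb
        exact hsub' ⟨hlt.trans hsb.le, (le_max_iff.1 h2).resolve_left hsb.not_ge⟩
    have hmK : max b b' ∈ K := by rcases max_choice b b' with e | e <;> rw [e] <;> assumption
    have h1 := hmax a ha _ hmK le_rfl (le_max_left _ _) hunion
    have h2 := hmax' a ha _ hmK haa (le_max_right _ _) hunion
    exact ⟨haa.antisymm h2.1, le_antisymm ((le_max_left _ _).trans h2.2)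
      ((le_max_right _ _).trans h1.2)⟩
  refine ⟨fun I hI => ?_, ?_, fun t => ⟨fun ht => ?_, ?_⟩⟩
  · obtain ⟨h1, h2, h3⟩ := (hmem I).1 hI
    exact ((hp _ h1 _ h2).1 h3).1
  · rw [List.pairwise_flatMap]
    constructor
    · intro a ha
      rw [List.pairwise_map, List.pairwise_filter]
      refine hK.imp_of_mem fun {b b'} hb hb' hlt h h' => ?_
      rcases hdisj a ha b hb a ha b' hb' h h' le_rfl with h1 | h1
      · exact h1
      · exact absurd h1.2 hlt.ne
    · refine hK.imp_of_mem fun {a a'} ha ha' hlt => ?_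
      simp only [List.mem_map, List.mem_filter]
      rintro _ ⟨b, ⟨hb, h⟩, rfl⟩ _ ⟨b', ⟨hb', h'⟩, rfl⟩
      exact (hdisj a ha b hb a' ha' b' hb' h h' hlt.le).resolve_right fun h1 => hlt.ne h1.1
  · obtain ⟨a₀, ha₀, b₀, hb₀, h1, h2, h3⟩ := exists_Icc_subset hS ha hb hgap ht
    -- A longest interval in `S` around `t` with ends in `K` is maximal.
    obtain ⟨⟨a, b⟩, hI, ⟨h4, h5, h6⟩, hmax⟩ := (K ×ˢ K).exists_argmax
      (fun I => I.1 ≤ t ∧ t ≤ I.2 ∧ Set.Icc I.1 I.2 ⊆ S) (fun I => I.2 - I.1)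
      ⟨(a₀, b₀), List.mem_product.2 ⟨ha₀, hb₀⟩, h1, h2, h3⟩
    obtain ⟨haK, hbK⟩ := List.mem_product.1 hI
    refine ⟨(a, b), (hmem _).2 ⟨haK, hbK, (hp a haK b hbK).2 ⟨h4.trans h5, h6, ?_⟩⟩, h4, h5⟩
    intro a' ha' b' hb' h7 h8 h9
    have := hmax (a', b') (List.mem_product.2 ⟨ha', hb'⟩) ⟨h7.trans h4, h5.trans h8, h9⟩
    dsimp only at this
    constructor <;> linarith
  · rintro ⟨I, hI, hIt⟩
    obtain ⟨h1, h2, h3⟩ := (hmem I).1 hI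
    exact ((hp _ h1 _ h2).1 h3).2.1 hIt

end Intervals

/-- Whether `s` satisfies all quadratic inequalities of some member of a list of systems. -/
noncomputable def quadMem (U : List (List (ℝ × ℝ × ℝ))) (s : ℝ) : Bool :=
  U.any fun C => C.all fun q => leb 0 (quadEval q s)

/-- The critical points of a list of systems of quadratic inequalities. -/
noncomputable def quadCrit (U : List (List (ℝ × ℝ × ℝ))) : List ℝ :=
  sortDedup (U.flatMap fun C => C.flatMap quadRoots)

/-- Whether the interval `[a, b]` between two critical points consists of solutions. -/
noncomputable def quadGood (U : List (List (ℝ × ℝ × ℝ))) (a b : ℝ) : Bool :=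
  (quadCrit U).all fun c => (quadCrit U).all fun d =>
    !(leb a c && (leb c d && leb d b)) || quadMem U ((c + d) / 2)

/-- Whether `[a, b]` is a maximal interval of solutions. -/
noncomputable def quadMaximal (U : List (List (ℝ × ℝ × ℝ))) (a b : ℝ) : Bool :=
  leb a b && (quadGood U a b && (quadCrit U).all fun a' => (quadCrit U).all fun b' =>
    !(leb a' a && (leb b b' && quadGood U a' b')) || (leb a a' && leb b' b))

/-- The maximal intervals of solutions of a list of systems of quadratic inequalities. -/
noncomputable def quadIntervals (U : List (List (ℝ × ℝ × ℝ))) : List (ℝ × ℝ) :=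
  (quadCrit U).flatMap fun a =>
    ((quadCrit U).filter fun b => quadMaximal U a b).map fun b => (a, b)

section PolyTime

variable {α : Type} [Sized α] {U : α → List (List (ℝ × ℝ × ℝ))} {f g : α → ℝ}

@[fun_prop]
theorem PolyTime.quadMem (hU : PolyTime U) (hf : PolyTime f) :
    PolyTime fun a => quadMem (U a) (f a) := by
  unfold _root_.quadMem; fun_prop

@[fun_prop]
theorem PolyTime.quadCrit (hU : PolyTime U) : PolyTime fun a => quadCrit (U a) := by
  unfold _root_.quadCrit; fun_prop

@[fun_prop]
theorem PolyTime.quadGood (hU : PolyTime U) (hf : PolyTime f) (hg : PolyTime g) :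
    PolyTime fun a => quadGood (U a) (f a) (g a) := by
  unfold _root_.quadGood; fun_prop

@[fun_prop]
theorem PolyTime.quadMaximal (hU : PolyTime U) (hf : PolyTime f) (hg : PolyTime g) :
    PolyTime fun a => quadMaximal (U a) (f a) (g a) := by
  unfold _root_.quadMaximal; fun_prop

@[fun_prop]
theorem PolyTime.quadIntervals (hU : PolyTime U) : PolyTime fun a => quadIntervals (U a) := by
  unfold _root_.quadIntervals; fun_prop

end PolyTime

/-! ### Correctness of the interval lists -/

theorem quadMem_eq_true {U : List (List (ℝ × ℝ × ℝ))} {s : ℝ} :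
    quadMem U s = true ↔ ∃ C ∈ U, ∀ q ∈ C, 0 ≤ quadEval q s := by
  simp [quadMem]

theorem isClosed_quadMem (U : List (List (ℝ × ℝ × ℝ))) :
    IsClosed {s | ∃ C ∈ U, ∀ q ∈ C, 0 ≤ quadEval q s} := by
  have h : {s | ∃ C ∈ U, ∀ q ∈ C, 0 ≤ quadEval q s}
      = ⋃ C ∈ {C | C ∈ U}, ⋂ q ∈ {q | q ∈ C}, {s | 0 ≤ quadEval q s} := by
    ext s; simp
  rw [h]
  exact (List.finite_toSet U).isClosed_biUnion fun C _ => isClosed_biInter fun q _ =>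
    isClosed_le continuous_const (continuous_quadEval q)

theorem listsIntervals_quadIntervals {U : List (List (ℝ × ℝ × ℝ))} {S : Set ℝ}
    (hS : ∀ s, s ∈ S ↔ ∃ C ∈ U, ∀ q ∈ C, 0 ≤ quadEval q s) (ha : BddAbove S) (hb : BddBelow S) :
    ListsIntervals (quadIntervals U) S := by
  have hmem : ∀ s, quadMem U s = true ↔ s ∈ S := fun s => quadMem_eq_true.trans (hS s).symm
  have hgap : ∀ s ∈ S, ∀ t, (∀ c ∈ quadCrit U, c ∉ Set.uIcc s t) → t ∈ S := by
    intro s hs t hst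
    obtain ⟨C, hC, hq⟩ := (hS s).1 hs
    refine (hS t).2 ⟨C, hC, fun q hqC => ?_⟩
    refine (nonneg_iff_of_sign_eq (sign_quadEval_eq fun r hr => hst r ?_)).1 (hq q hqC)
    exact mem_sortDedup.2 (List.mem_flatMap.2 ⟨C, hC, List.mem_flatMap.2 ⟨q, hqC, hr⟩⟩)
  have hgood : ∀ a ∈ quadCrit U, ∀ b ∈ quadCrit U,
      (quadGood U a b = true ↔ Set.Icc a b ⊆ S) := by
    intro a haK b hbK
    have h1 : quadGood U a b = true ↔ ∀ c ∈ quadCrit U, ∀ d ∈ quadCrit U,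
        a ≤ c → c ≤ d → d ≤ b → (c + d) / 2 ∈ S := by
      simp only [quadGood, List.all_eq_true, Bool.or_eq_true, Bool.not_eq_true',
        Bool.and_eq_false_iff, leb_eq_false, hmem, ← not_le]
      refine forall₂_congr fun c _ => forall₂_congr fun d _ => ?_
      tauto
    rw [h1]
    refine ⟨Icc_subset_of_midpoints_mem hgap haK hbK, fun h c _ d _ h1 h2 h3 => h ?_⟩
    constructor <;> linarith
  refine listsIntervals_of_maximal (pairwise_sortDedup _) ?_ ha hb hgap fun a haK b hbK => ?_
  · convert isClosed_quadMem U using 1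
    ext s
    exact hS s
  · simp only [quadMaximal, List.all_eq_true, Bool.or_eq_true, Bool.not_eq_true', Bool.and_eq_true,
      Bool.and_eq_false_iff, leb_eq_false, leb_eq_true, hgood a haK b hbK]
    refine and_congr_right fun _ => and_congr_right fun _ =>
      forall₂_congr fun a' ha' => forall₂_congr fun b' hb' => ?_
    rw [← not_le, ← not_le, ← hgood a' ha' b' hb', ← Bool.not_eq_true]
    tauto

section PolygonalRegions

open AffineMap Filter Topology

/-! ## Polygonal regions -/

/-- The doubled signed area of the triangle `abc`. -/
def orient (a b c : ℝ × ℝ) : ℝ := (b.1 - a.1) * (c.2 - a.2) - (b.2 - a.2) * (c.1 - a.1)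

theorem lineMap_fst_eq (x y : ℝ × ℝ) (t : ℝ) : (lineMap x y t).1 = x.1 + t * (y.1 - x.1) := by
  simp [lineMap_apply]; ring

theorem lineMap_snd_eq (x y : ℝ × ℝ) (t : ℝ) : (lineMap x y t).2 = x.2 + t * (y.2 - x.2) := by
  simp [lineMap_apply]; ring

theorem orient_lineMap (a b x y : ℝ × ℝ) (t : ℝ) :
    orient a b (lineMap x y t) = (1 - t) * orient a b x + t * orient a b y := by
  simp only [orient, lineMap_fst_eq, lineMap_snd_eq]; ring

theorem mem_segment_iff {a b z : ℝ × ℝ} :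
    z ∈ segment ℝ a b ↔ ∃ t : ℝ, 0 ≤ t ∧ t ≤ 1 ∧ lineMap a b t = z := by
  rw [segment_eq_image_lineMap]
  simp [and_assoc]

theorem mem_openSegment_iff {a b z : ℝ × ℝ} :
    z ∈ openSegment ℝ a b ↔ ∃ t : ℝ, 0 < t ∧ t < 1 ∧ lineMap a b t = z := by
  rw [openSegment_eq_image_lineMap]
  simp [and_assoc]

theorem orient_eq_zero_of_mem_segment {a b z : ℝ × ℝ} (h : z ∈ segment ℝ a b) :
    orient a b z = 0 := by
  obtain ⟨t, -, -, rfl⟩ := mem_segment_iff.1 h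
  rw [orient_lineMap]
  simp only [orient]; ring

theorem exists_lineMap_of_orient_eq_zero {a b z : ℝ × ℝ} (hab : a ≠ b) (h : orient a b z = 0) :
    ∃ t : ℝ, lineMap a b t = z := by
  simp only [orient] at h
  by_cases h1 : b.1 - a.1 = 0
  · have h2 : b.2 - a.2 ≠ 0 := fun h2 => hab (Prod.ext (by linarith) (by linarith))
    refine ⟨(z.2 - a.2) / (b.2 - a.2), Prod.ext ?_ ?_⟩
    · rw [lineMap_fst_eq]
      have : (b.2 - a.2) * (z.1 - a.1) = 0 := by rw [h1] at h; linarith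
      have := (mul_eq_zero.1 this).resolve_left h2
      rw [h1]; linarith
    · rw [lineMap_snd_eq]; field_simp; ring
  · refine ⟨(z.1 - a.1) / (b.1 - a.1), Prod.ext ?_ ?_⟩
    · rw [lineMap_fst_eq]; field_simp; ring
    · rw [lineMap_snd_eq]; field_simp; linear_combination -h

theorem mem_segment_iff_orient {a b z : ℝ × ℝ} :
    z ∈ segment ℝ a b ↔ orient a b z = 0 ∧ 0 ≤ (z.1 - a.1) * (b.1 - z.1) ∧
      0 ≤ (z.2 - a.2) * (b.2 - z.2) := by
  constructor
  · intro h
    refine ⟨orient_eq_zero_of_mem_segment h, ?_⟩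
    obtain ⟨t, h0, h1, rfl⟩ := mem_segment_iff.1 h
    have : 0 ≤ t * (1 - t) := mul_nonneg h0 (by linarith)
    rw [lineMap_fst_eq, lineMap_snd_eq]
    constructor
    · have := mul_nonneg this (sq_nonneg (b.1 - a.1)); linarith
    · have := mul_nonneg this (sq_nonneg (b.2 - a.2)); linarith
  · rintro ⟨h, h1, h2⟩
    by_cases hab : a = b
    · subst hab
      have e1 : z.1 = a.1 := by nlinarith [sq_nonneg (z.1 - a.1)]
      have e2 : z.2 = a.2 := by nlinarith [sq_nonneg (z.2 - a.2)]
      rw [Prod.ext e1 e2]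
      exact left_mem_segment ℝ _ _
    · obtain ⟨t, rfl⟩ := exists_lineMap_of_orient_eq_zero hab h
      refine mem_segment_iff.2 ⟨t, ?_⟩
      rw [lineMap_fst_eq] at h1
      rw [lineMap_snd_eq] at h2
      have h3 : 0 < (b.1 - a.1) ^ 2 + (b.2 - a.2) ^ 2 := by
        by_contra! h3
        refine hab (Prod.ext ?_ ?_) <;> nlinarith [sq_nonneg (b.1 - a.1), sq_nonneg (b.2 - a.2)]
      have h4 : 0 ≤ (t * (1 - t)) * ((b.1 - a.1) ^ 2 + (b.2 - a.2) ^ 2) := by linarith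
      have h5 : 0 ≤ t * (1 - t) := nonneg_of_mul_nonneg_left h4 h3
      refine ⟨?_, ?_, rfl⟩ <;> nlinarith

theorem isClosed_segment_plane (a b : ℝ × ℝ) : IsClosed (segment ℝ a b) := by
  rw [segment_eq_image_lineMap]
  exact (isCompact_Icc.image lineMap_continuous).isClosed

/-- `Q` is a bounded region, the closure of its interior, whose frontier is formed by the
nondegenerate segments in the list `E`; these meet at most in common endpoints. -/
structure IsPolygonalRegion (E : List ((ℝ × ℝ) × (ℝ × ℝ))) (Q : Set (ℝ × ℝ)) : Prop where
  closure_interior : closure (interior Q) = Q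
  bounded : Bornology.IsBounded Q
  mem_frontier : ∀ z, z ∈ frontier Q ↔ ∃ e ∈ E, z ∈ segment ℝ e.1 e.2
  eq_of_mem : ∀ e ∈ E, ∀ e' ∈ E, ∀ z ∈ openSegment ℝ e.1 e.2, z ∈ segment ℝ e'.1 e'.2 → e = e'
  ne : ∀ e ∈ E, e.1 ≠ e.2
  nodup : E.Nodup

/-! ### Paths leaving a polygonal region -/

namespace IsPolygonalRegion

variable {E : List ((ℝ × ℝ) × (ℝ × ℝ))} {Q : Set (ℝ × ℝ)} (h : IsPolygonalRegion E Q)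
include h

theorem isClosed : IsClosed Q := h.closure_interior ▸ isClosed_closure

theorem mem_of_mem_segment {e z} (he : e ∈ E) (hz : z ∈ segment ℝ e.1 e.2) : z ∈ Q :=
  h.isClosed.frontier_subset ((h.mem_frontier z).2 ⟨e, he, hz⟩)

/-- A connected set that avoids the frontier is covered by the disjoint open sets `interior Q` and
`Qᶜ`, so it lies in one of them. -/
theorem subset_of_isPreconnected {C : Set (ℝ × ℝ)} (hC : IsPreconnected C)
    (hE : ∀ z ∈ C, ∀ e ∈ E, z ∉ segment ℝ e.1 e.2) {z : ℝ × ℝ} (hz : z ∈ C) (hzQ : z ∈ Q) :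
    C ⊆ Q := by
  have hf : ∀ z ∈ C, z ∉ frontier Q := fun z hz hzf => by
    obtain ⟨e, he, hze⟩ := (h.mem_frontier z).1 hzf
    exact hE z hz e he hze
  have hint : ∀ z ∈ C, z ∈ Q → z ∈ interior Q := fun z hz hzQ => by
    by_contra hzi
    exact hf z hz ⟨subset_closure hzQ, hzi⟩
  refine (hC.subset_left_of_subset_union isOpen_interior h.isClosed.isOpen_compl ?_ ?_
    ⟨z, hz, hint z hz hzQ⟩).trans interior_subset
  · exact Set.disjoint_compl_right_iff_subset.2 interior_subset
  · intro w hw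
    by_cases hwQ : w ∈ Q
    · exact Or.inl (hint w hw hwQ)
    · exact Or.inr hwQ

theorem mem_of_lineMap {x y : ℝ × ℝ} (hx : x ∈ Q)
    (hE : ∀ e ∈ E, ∀ s ∈ Set.Icc (0 : ℝ) 1, lineMap x y s ∉ segment ℝ e.1 e.2) : y ∈ Q := by
  have hC : IsPreconnected (segment ℝ x y) := (convex_segment x y).isPreconnected
  refine h.subset_of_isPreconnected hC (fun z hz e he => ?_) (left_mem_segment ℝ x y) hx
    (right_mem_segment ℝ x y)
  obtain ⟨t, h0, h1, rfl⟩ := mem_segment_iff.1 hz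
  exact hE e he t ⟨h0, h1⟩

/-- A path leaving the region at `z'` is separated from a path that starts at `z` and stays in the
region by an edge that meets all small connecting segments. -/
theorem false_of_eventually_disjoint {z z' r r' : ℝ × ℝ}
    (hz : ∀ t ∈ Set.Icc (0 : ℝ) 1, lineMap z r t ∈ Q)
    (hz' : ∀ᶠ t : ℝ in 𝓝[>] 0, lineMap z' r' t ∉ Q)
    (hE : ∀ e ∈ E, ∀ᶠ t : ℝ in 𝓝[>] 0, ∀ s ∈ Set.Icc (0 : ℝ) 1,
      lineMap (lineMap z r t) (lineMap z' r' t) s ∉ segment ℝ e.1 e.2) : False := by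
  have h1 : ∀ᶠ t : ℝ in 𝓝[>] 0, t ∈ Set.Ioo (0 : ℝ) 1 := Ioo_mem_nhdsGT one_pos
  have h2 := ((List.finite_toSet E).eventually_all (l := 𝓝[>] (0 : ℝ))).2 hE
  obtain ⟨t, ht, hz't, hEt⟩ := (h1.and (hz'.and h2)).exists
  exact hz't (h.mem_of_lineMap (hz t ⟨ht.1.le, ht.2.le⟩) hEt)

-- The segments joining the two moving points depend continuously on `t`; a tube argument on the
-- compact interval `[0, 1]` keeps them off the closed set `ab`.
omit h in
theorem eventually_disjoint {z z' r r' a b : ℝ × ℝ}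
    (hd : ∀ s ∈ Set.Icc (0 : ℝ) 1, lineMap z z' s ∉ segment ℝ a b) :
    ∀ᶠ t : ℝ in 𝓝[>] 0, ∀ s ∈ Set.Icc (0 : ℝ) 1,
      lineMap (lineMap z r t) (lineMap z' r' t) s ∉ segment ℝ a b := by
  refine Filter.Eventually.filter_mono nhdsWithin_le_nhds ?_
  refine isCompact_Icc.eventually_forall_of_forall_eventually fun s hs => ?_
  have hcont : Continuous fun p : ℝ × ℝ =>
      lineMap (lineMap z r p.1 : ℝ × ℝ) (lineMap z' r' p.1) p.2 := by
    simp only [lineMap_apply_module]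
    fun_prop
  refine hcont.continuousAt.eventually_mem ((isClosed_segment_plane a b).isOpen_compl.mem_nhds ?_)
  simpa using hd s hs

-- Both points start on the line `ab` and move strictly to the same side, so the segment joining
-- them stays strictly on that side.
omit h in
theorem eventually_disjoint_of_orient {z z' r r' a b : ℝ × ℝ} (hz : orient a b z = 0)
    (hz' : orient a b z' = 0) (hr : orient a b r ≠ 0)
    (hs : SignType.sign (orient a b r) = SignType.sign (orient a b r')) :
    ∀ᶠ t : ℝ in 𝓝[>] 0, ∀ s ∈ Set.Icc (0 : ℝ) 1,
      lineMap (lineMap z r t) (lineMap z' r' t) s ∉ segment ℝ a b := by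
  filter_upwards [self_mem_nhdsWithin] with t ht s hs' hmem
  have h0 := orient_eq_zero_of_mem_segment hmem
  simp only [orient_lineMap, hz, hz', mul_zero, zero_add] at h0
  have h1 : (1 - s) * orient a b r + s * orient a b r' = 0 := by
    have ht' : (t : ℝ) ≠ 0 := ne_of_gt ht
    apply mul_left_cancel₀ ht'
    linarith
  obtain ⟨hs0, hs1⟩ := hs'
  rcases hr.lt_or_gt with hr | hr
  · have hr' : orient a b r' < 0 := sign_eq_neg_one_iff.1 (hs ▸ sign_neg hr)
    rcases hs0.eq_or_lt with rfl | hs0 <;> nlinarith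
  · have hr' : 0 < orient a b r' := sign_eq_one_iff.1 (hs ▸ sign_pos hr)
    rcases hs0.eq_or_lt with rfl | hs0 <;> nlinarith

/-- The case of a path leaving the region at an interior point of an edge. -/
theorem false_of_openSegment {e} (he : e ∈ E) {z z' r r' : ℝ × ℝ} (hze : z ∈ openSegment ℝ e.1 e.2)
    (hze' : z' ∈ openSegment ℝ e.1 e.2) (hr : orient e.1 e.2 r ≠ 0)
    (hs : SignType.sign (orient e.1 e.2 r) = SignType.sign (orient e.1 e.2 r'))
    (hz : ∀ t ∈ Set.Icc (0 : ℝ) 1, lineMap z r t ∈ Q)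
    (hz' : ∀ᶠ t : ℝ in 𝓝[>] 0, lineMap z' r' t ∉ Q) : False := by
  refine h.false_of_eventually_disjoint hz hz' fun e' he' => ?_
  by_cases hee : e = e'
  · subst hee
    exact eventually_disjoint_of_orient
      (orient_eq_zero_of_mem_segment (openSegment_subset_segment _ _ _ hze))
      (orient_eq_zero_of_mem_segment (openSegment_subset_segment _ _ _ hze')) hr hs
  -- The segment `zz'` lies inside the edge `e`, where no other edge passes.
  · refine eventually_disjoint fun s hs hmem => hee (h.eq_of_mem e he e' he' _ ?_ hmem)
    exact (convex_openSegment _ _).segment_subset hze hze' (mem_segment_iff.2 ⟨s, hs.1, hs.2, rfl⟩)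

omit h in
theorem sign_eq_of_mul {x y c : ℝ} (hc : c ≠ 0)
    (hs : SignType.sign (x * c) = SignType.sign (y * c)) : SignType.sign x = SignType.sign y := by
  rw [sign_mul, sign_mul] at hs
  have : SignType.sign c ≠ 0 := by simpa using hc
  generalize SignType.sign x = x at *
  generalize SignType.sign y = y at *
  generalize SignType.sign c = c at *
  revert x y c
  decide

omit h in
/-- The case of a path leaving the region along an edge. -/
theorem eventually_disjoint_of_collinear {v b r r' : ℝ × ℝ} (hvb : v ≠ b)
    (hz' : ∀ᶠ t : ℝ in 𝓝[>] 0, lineMap v r' t ∉ Q) (hQ : segment ℝ v b ⊆ Q)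
    (hr : orient v b r = 0) (hr' : orient v b r' = 0)
    (h1 : SignType.sign (r.1 - v.1) = SignType.sign (r'.1 - v.1))
    (h2 : SignType.sign (r.2 - v.2) = SignType.sign (r'.2 - v.2)) :
    ∀ᶠ t : ℝ in 𝓝[>] 0, ∀ s ∈ Set.Icc (0 : ℝ) 1,
      lineMap (lineMap v r t) (lineMap v r' t) s ∉ segment ℝ v b := by
  obtain ⟨ρ, rfl⟩ := exists_lineMap_of_orient_eq_zero hvb hr
  obtain ⟨ρ', rfl⟩ := exists_lineMap_of_orient_eq_zero hvb hr'
  have hsign : SignType.sign ρ = SignType.sign ρ' := by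
    simp only [lineMap_fst_eq, lineMap_snd_eq, add_sub_cancel_left] at h1 h2
    by_cases hc : b.1 - v.1 = 0
    · refine sign_eq_of_mul (c := b.2 - v.2) (fun hc' => hvb ?_) h2
      exact Prod.ext (by linarith) (by linarith)
    · exact sign_eq_of_mul hc h1
  -- If `r'` were not behind `v`, the path would run along the edge and remain in `Q`. So both paths
  -- move away from `b` and leave the edge at once.
  have hneg : ρ' < 0 := by
    by_contra! h0
    have h3 : ∀ᶠ t : ℝ in 𝓝[>] 0, t * ρ' < 1 := by
      refine Filter.Eventually.filter_mono nhdsWithin_le_nhds ?_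
      have : Continuous fun t : ℝ => t * ρ' := by fun_prop
      exact this.continuousAt.eventually_lt_const (by simp)
    obtain ⟨t, ht, ht1, ht2⟩ := (hz'.and (h3.and self_mem_nhdsWithin)).exists
    refine ht (hQ (mem_segment_iff.2 ⟨t * ρ', mul_nonneg (le_of_lt ht2) h0, ht1.le, ?_⟩))
    apply Prod.ext <;> simp only [lineMap_fst_eq, lineMap_snd_eq] <;> ring
  have hneg' : ρ < 0 := sign_eq_neg_one_iff.1 (hsign ▸ sign_neg hneg)
  filter_upwards [self_mem_nhdsWithin] with t (ht : 0 < t) s hs hmem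
  obtain ⟨τ, h0, -, hτ⟩ := mem_segment_iff.1 hmem
  have e : lineMap v b (t * ((1 - s) * ρ + s * ρ')) =
      lineMap (lineMap v (lineMap v b ρ) t) (lineMap v (lineMap v b ρ') t) s := by
    apply Prod.ext <;> simp only [lineMap_fst_eq, lineMap_snd_eq] <;> ring
  have hτ' := lineMap_injective ℝ hvb (hτ.trans e.symm)
  have : (1 - s) * ρ + s * ρ' < 0 := by
    obtain ⟨hs0, hs1⟩ := hs
    rcases hs0.eq_or_lt with rfl | hs0 <;> nlinarith
  nlinarith

omit h in
theorem orient_swap (a b c : ℝ × ℝ) : orient b a c = -orient a b c := by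
  simp only [orient]; ring

/-- The case of a path leaving the region at a vertex. -/
theorem false_of_vertex {v r r' : ℝ × ℝ}
    (hv : ∃ e ∈ E, v = e.1 ∨ v = e.2)
    (h1 : SignType.sign (r.1 - v.1) = SignType.sign (r'.1 - v.1))
    (h2 : SignType.sign (r.2 - v.2) = SignType.sign (r'.2 - v.2))
    (hs : ∀ e ∈ E, SignType.sign (orient e.1 e.2 r) = SignType.sign (orient e.1 e.2 r'))
    (hz : ∀ t ∈ Set.Icc (0 : ℝ) 1, lineMap v r t ∈ Q)
    (hz' : ∀ᶠ t : ℝ in 𝓝[>] 0, lineMap v r' t ∉ Q) : False := by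
  refine h.false_of_eventually_disjoint hz hz' fun e he => ?_
  -- Edges away from `v` are avoided by compactness. At an edge through `v`, either both paths move
  -- to the same strict side of it or both run along its line.
  by_cases hve : v ∈ segment ℝ e.1 e.2
  swap
  · exact eventually_disjoint fun s _ => by simpa using hve
  have hv0 := orient_eq_zero_of_mem_segment hve
  by_cases hr : orient e.1 e.2 r = 0
  swap
  · exact eventually_disjoint_of_orient hv0 hv0 hr (hs e he)
  have hr' : orient e.1 e.2 r' = 0 := by
    have := hs e he
    rwa [hr, sign_zero, eq_comm, sign_eq_zero_iff] at this
  have hQ : segment ℝ e.1 e.2 ⊆ Q := fun z hz => h.mem_of_mem_segment he hz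
  have hne := h.ne e he
  rw [← insert_endpoints_openSegment] at hve
  rcases hve with rfl | rfl | hve
  · exact eventually_disjoint_of_collinear hne hz' hQ hr hr' h1 h2
  · rw [segment_symm] at hQ ⊢
    refine eventually_disjoint_of_collinear hne.symm hz' hQ ?_ ?_ h1 h2 <;>
      rw [orient_swap, neg_eq_zero] <;> assumption
  · exfalso
    -- An end point of an edge cannot lie inside an edge.
    obtain ⟨e', he', hv⟩ := hv
    obtain rfl := h.eq_of_mem e he e' he' v hve (by
      rcases hv with rfl | rfl
      exacts [left_mem_segment _ _ _, right_mem_segment _ _ _])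
    rcases hv with rfl | rfl
    · exact hne (left_mem_openSegment_iff.1 hve)
    · exact hne (right_mem_openSegment_iff.1 hve)

end IsPolygonalRegion

/-- The functions of two points `p` and `r` whose signs determine the position of the segment `pr`
relative to the edge `e`. -/
def edgeFunctions (e : (ℝ × ℝ) × (ℝ × ℝ)) (p r : ℝ × ℝ) : List ℝ :=
  [orient p r e.1, orient p r e.2, orient e.1 e.2 p, orient e.1 e.2 r,
    e.1.1 - p.1, e.1.2 - p.2, e.2.1 - p.1, e.2.2 - p.2,
    r.1 - e.1.1, r.2 - e.1.2, r.1 - e.2.1, r.2 - e.2.2]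

/-! ### Sign invariance of visibility -/

namespace IsPolygonalRegion

variable {E : List ((ℝ × ℝ) × (ℝ × ℝ))} {Q : Set (ℝ × ℝ)} (h : IsPolygonalRegion E Q)
include h

theorem mem_frontier_of_eventually_notMem {z r : ℝ × ℝ} (hz : z ∈ Q)
    (hr : ∀ᶠ t : ℝ in 𝓝[>] 0, lineMap z r t ∉ Q) : ∃ e ∈ E, z ∈ segment ℝ e.1 e.2 := by
  refine (h.mem_frontier z).1 ⟨subset_closure hz, fun hint => ?_⟩
  have h1 : ∀ᶠ t : ℝ in 𝓝[>] 0, lineMap z r t ∈ interior Q := by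
    refine Filter.Eventually.filter_mono nhdsWithin_le_nhds ?_
    have hc : Continuous fun t : ℝ => (lineMap z r t : ℝ × ℝ) := lineMap_continuous
    exact hc.continuousAt.eventually_mem (isOpen_interior.mem_nhds (by simpa using hint))
  obtain ⟨t, h2, h3⟩ := (h1.and hr).exists
  exact h3 (interior_subset h2)

-- Take some `s₁` whose point is outside `Q` and the largest `s ≤ s₁` whose point is in `Q`, by
-- compactness. The path may re-enter `Q` after `s₁`; only the points just beyond `s` matter.
omit h in
theorem exists_last_mem (hQ : IsClosed Q) {p r : ℝ × ℝ} (hp : p ∈ Q) (hr : ¬segment ℝ p r ⊆ Q) :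
    ∃ s : ℝ, 0 ≤ s ∧ s < 1 ∧ lineMap p r s ∈ Q ∧
      ∀ᶠ t : ℝ in 𝓝[>] 0, lineMap (lineMap p r s : ℝ × ℝ) r t ∉ Q := by
  obtain ⟨y, hy, hyQ⟩ := Set.not_subset.1 hr
  obtain ⟨s₁, h0, h1, rfl⟩ := mem_segment_iff.1 hy
  have hc : Continuous fun t : ℝ => (lineMap p r t : ℝ × ℝ) := lineMap_continuous
  have hK : IsCompact (Set.Icc 0 s₁ ∩ {s : ℝ | lineMap p r s ∈ Q}) :=
    isCompact_Icc.inter_right (hQ.preimage hc)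
  obtain ⟨s, ⟨⟨hs0, hs1⟩, hsQ⟩, hmax⟩ := hK.exists_isGreatest ⟨0, ⟨le_rfl, h0⟩, by simpa using hp⟩
  have hlt : s < s₁ := lt_of_le_of_ne hs1 fun e => hyQ (e ▸ hsQ)
  refine ⟨s, hs0, hlt.trans_le h1, hsQ, ?_⟩
  have h2 : ∀ᶠ t : ℝ in 𝓝[>] 0, s + t * (1 - s) < s₁ := by
    refine Filter.Eventually.filter_mono nhdsWithin_le_nhds ?_
    have : Continuous fun t : ℝ => s + t * (1 - s) := by fun_prop
    exact this.continuousAt.eventually_lt_const (by simpa using hlt)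
  filter_upwards [h2, self_mem_nhdsWithin] with t ht (ht0 : 0 < t) hmem
  have e : (lineMap (lineMap p r s : ℝ × ℝ) r t : ℝ × ℝ) = lineMap p r (s + t * (1 - s)) := by
    apply Prod.ext <;> simp only [lineMap_fst_eq, lineMap_snd_eq] <;> ring
  have hpos : 0 < t * (1 - s) := mul_pos ht0 (by linarith)
  have := hmax ⟨⟨by linarith, ht.le⟩, (by simpa only [e] using hmem :
    lineMap p r (s + t * (1 - s)) ∈ Q)⟩
  linarith

/-- Visibility depends only on the signs of finitely many functions. -/
theorem segment_subset_of_sign_eq {p r p' r' : ℝ × ℝ} (hp' : p' ∈ Q)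
    (hsign : ∀ e ∈ E, (edgeFunctions e p r).map SignType.sign =
      (edgeFunctions e p' r').map SignType.sign)
    (hpr : segment ℝ p r ⊆ Q) : segment ℝ p' r' ⊆ Q := by
  by_contra hsub
  -- The point where `p'r'` leaves the region lies on some edge; it is a vertex or inside the edge.
  obtain ⟨s, hs0, hs1, hzQ, hout⟩ := exists_last_mem h.isClosed hp' hsub
  obtain ⟨e, he, hze⟩ := h.mem_frontier_of_eventually_notMem hzQ hout
  have hsr : ∀ e ∈ E, SignType.sign (orient e.1 e.2 r) = SignType.sign (orient e.1 e.2 r') :=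
    fun e he => by
      have := hsign e he
      simp only [edgeFunctions, List.map_cons, List.cons.injEq] at this
      exact this.2.2.2.1
  have hvertex : ∀ v, (∃ e ∈ E, v = e.1 ∨ v = e.2) →
      SignType.sign (orient p r v) = SignType.sign (orient p' r' v) ∧
      (SignType.sign (v.1 - p.1) = SignType.sign (v.1 - p'.1) ∧
        SignType.sign (v.2 - p.2) = SignType.sign (v.2 - p'.2)) ∧
      SignType.sign (r.1 - v.1) = SignType.sign (r'.1 - v.1) ∧
      SignType.sign (r.2 - v.2) = SignType.sign (r'.2 - v.2) := by
    rintro v ⟨e, he, rfl | rfl⟩ <;>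
    · have := hsign e he
      simp only [edgeFunctions, List.map_cons, List.cons.injEq] at this
      tauto
  set z := (lineMap p' r' s : ℝ × ℝ) with hz
  have hcase : (∃ e ∈ E, z = e.1 ∨ z = e.2) ∨ z ∈ openSegment ℝ e.1 e.2 := by
    rw [← insert_endpoints_openSegment] at hze
    rcases hze with hze | hze | hze
    · exact Or.inl ⟨e, he, Or.inl hze⟩
    · exact Or.inl ⟨e, he, Or.inr hze⟩
    · exact Or.inr hze
  rcases hcase with hv | hopen
  · obtain ⟨hv0, ⟨hv1, hv2⟩, hv3, hv4⟩ := hvertex z hv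
    refine h.false_of_vertex hv hv3 hv4 hsr (fun t ht => hpr ?_) hout
    have hzseg : z ∈ segment ℝ p' r' := mem_segment_iff.2 ⟨s, hs0, hs1.le, rfl⟩
    -- Lying on a segment is a sign condition on an orientation and coordinate differences, so the
    -- vertex `z` lies on `pr` as well.
    have hzpr : z ∈ segment ℝ p r := by
      rw [mem_segment_iff_orient] at hzseg ⊢
      refine ⟨?_, ?_, ?_⟩
      · rwa [hzseg.1, sign_zero, sign_eq_zero_iff] at hv0
      · exact (nonneg_iff_of_sign_eq (by rw [sign_mul, sign_mul, hv1, hv3])).2 hzseg.2.1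
      · exact (nonneg_iff_of_sign_eq (by rw [sign_mul, sign_mul, hv2, hv4])).2 hzseg.2.2
    exact (convex_segment p r).segment_subset hzpr (right_mem_segment _ _ _)
      (mem_segment_iff.2 ⟨t, ht.1, ht.2, rfl⟩)
  · have hne := h.ne e he
    obtain ⟨l, hl0, hl1, hl⟩ := mem_openSegment_iff.1 hopen
    have hz0 : orient e.1 e.2 z = 0 :=
      orient_eq_zero_of_mem_segment (openSegment_subset_segment _ _ _ hopen)
    -- Otherwise `p'r'` would continue along the edge, and hence in `Q`, for a while after `z`.
    have hr0' : orient e.1 e.2 r' ≠ 0 := by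
      intro hr0
      obtain ⟨ρ, hρ⟩ := exists_lineMap_of_orient_eq_zero hne hr0
      have h2 : ∀ᶠ t : ℝ in 𝓝[>] 0, l + t * (ρ - l) ∈ Set.Ioo (0 : ℝ) 1 := by
        refine Filter.Eventually.filter_mono nhdsWithin_le_nhds ?_
        have : Continuous fun t : ℝ => l + t * (ρ - l) := by fun_prop
        exact this.continuousAt.eventually_mem (isOpen_Ioo.mem_nhds (by simpa using ⟨hl0, hl1⟩))
      obtain ⟨t, ht, ht'⟩ := (hout.and h2).exists
      refine ht (h.mem_of_mem_segment he (mem_segment_iff.2 ⟨_, ht'.1.le, ht'.2.le, ?_⟩))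
      rw [← hl, ← hρ]
      apply Prod.ext <;> simp only [lineMap_fst_eq, lineMap_snd_eq] <;> ring
    have hr0 : orient e.1 e.2 r ≠ 0 := by
      rw [← sign_ne_zero, hsr e he, sign_ne_zero]
      exact hr0'
    have hp0 : (1 - s) * orient e.1 e.2 p' + s * orient e.1 e.2 r' = 0 := by
      rw [← orient_lineMap]; exact hz0
    have hprod' : 0 ≤ -(orient e.1 e.2 p') * orient e.1 e.2 r' := by
      have : (1 - s) * (-(orient e.1 e.2 p') * orient e.1 e.2 r') =
          s * (orient e.1 e.2 r') ^ 2 := by linear_combination (-orient e.1 e.2 r') * hp0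
      exact nonneg_of_mul_nonneg_right (this ▸ mul_nonneg hs0 (sq_nonneg _)) (by linarith)
    have hprod : 0 ≤ -(orient e.1 e.2 p) * orient e.1 e.2 r := by
      refine (nonneg_iff_of_sign_eq ?_).2 hprod'
      have := hsign e he
      simp only [edgeFunctions, List.map_cons, List.cons.injEq] at this
      rw [sign_mul, sign_mul, Left.sign_neg, Left.sign_neg, this.2.2.1, hsr e he]
    -- Comparing the two descriptions of `z`, on `p'r'` and on `e`, shows that the ends of `e` are
    -- strictly on opposite sides of the line `p'r'`. By the signs, the same holds for `pr`.
    have hO1 : (1 - s) * orient p' r' e.1 = l * orient e.1 e.2 r' := by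
      have h1 := congrArg Prod.fst hl
      have h2 := congrArg Prod.snd hl
      simp only [hz, lineMap_fst_eq, lineMap_snd_eq] at h1 h2
      simp only [orient]
      linear_combination (e.1.2 - r'.2) * h1 - (e.1.1 - r'.1) * h2
    have hO2 : (1 - s) * orient p' r' e.2 = -((1 - l) * orient e.1 e.2 r') := by
      have h1 := congrArg Prod.fst hl
      have h2 := congrArg Prod.snd hl
      simp only [hz, lineMap_fst_eq, lineMap_snd_eq] at h1 h2
      simp only [orient]
      linear_combination (e.2.2 - r'.2) * h1 - (e.2.1 - r'.1) * h2
    have hO' : 0 < -(orient p' r' e.1 * orient p' r' e.2) := by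
      have e1 : (1 - s) ^ 2 * -(orient p' r' e.1 * orient p' r' e.2) =
          (l * (1 - l)) * (orient e.1 e.2 r') ^ 2 := by
        linear_combination (-(1 - s) * orient p' r' e.2) * hO1 - (l * orient e.1 e.2 r') * hO2
      have e2 : 0 < (l * (1 - l)) * (orient e.1 e.2 r') ^ 2 :=
        mul_pos (mul_pos hl0 (by linarith)) (by positivity)
      exact pos_of_mul_pos_right (e1 ▸ e2) (sq_nonneg _)
    have hO : 0 < -(orient p r e.1 * orient p r e.2) := by
      rw [← sign_eq_one_iff] at hO' ⊢
      rw [← hO', Left.sign_neg, Left.sign_neg, sign_mul, sign_mul,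
        (hvertex _ ⟨e, he, Or.inl rfl⟩).1, (hvertex _ ⟨e, he, Or.inr rfl⟩).1]
    have hD1 : orient p r e.1 - orient p r e.2 = orient e.1 e.2 r - orient e.1 e.2 p := by
      simp only [orient]; ring
    set D := orient e.1 e.2 r - orient e.1 e.2 p with hD
    have hD0 : D ≠ 0 := by
      intro h0
      have : orient p r e.1 = orient p r e.2 := by linarith
      rw [this] at hO
      nlinarith [sq_nonneg (orient p r e.2)]
    have hDD : 0 < D ^ 2 := by positivity
    -- Cramer's rule: `D` is the determinant of the directions of `e` and `pr`, and these quotients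
    -- are the parameters of the crossing point on the two segments.
    have hs₁ : 0 ≤ -(orient e.1 e.2 p) / D ∧ -(orient e.1 e.2 p) / D ≤ 1 := by
      constructor
      · have : -(orient e.1 e.2 p) / D = (-(orient e.1 e.2 p) * D) / D ^ 2 := by field_simp
        rw [this]
        refine div_nonneg ?_ hDD.le
        rw [hD]; nlinarith [sq_nonneg (orient e.1 e.2 p)]
      · have : 1 - -(orient e.1 e.2 p) / D = (orient e.1 e.2 r * D) / D ^ 2 := by
          field_simp; rw [hD]; ring
        rw [← sub_nonneg, this]
        refine div_nonneg ?_ hDD.le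
        rw [hD]; nlinarith [sq_nonneg (orient e.1 e.2 r)]
    have hl₁ : 0 < orient p r e.1 / D ∧ orient p r e.1 / D < 1 := by
      constructor
      · have : orient p r e.1 / D = (orient p r e.1 * D) / D ^ 2 := by field_simp
        rw [this]
        refine div_pos ?_ hDD
        rw [← hD1]; nlinarith [sq_nonneg (orient p r e.1)]
      · have : 1 - orient p r e.1 / D = (-orient p r e.2 * D) / D ^ 2 := by
          field_simp; rw [← hD1]; ring
        rw [← sub_pos, this]
        refine div_pos ?_ hDD
        rw [← hD1]; nlinarith [sq_nonneg (orient p r e.2)]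
    have hzz : (lineMap p r (-(orient e.1 e.2 p) / D) : ℝ × ℝ) =
        lineMap e.1 e.2 (orient p r e.1 / D) := by
      apply Prod.ext <;> simp only [lineMap_fst_eq, lineMap_snd_eq] <;> field_simp <;> rw [hD] <;>
        simp only [orient] <;> ring
    refine h.false_of_openSegment he (mem_openSegment_iff.2 ⟨_, hl₁.1, hl₁.2, hzz.symm⟩) hopen hr0
      (hsr e he) (fun t ht => hpr ?_) hout
    exact (convex_segment p r).segment_subset (mem_segment_iff.2 ⟨_, hs₁.1, hs₁.2, rfl⟩)
      (right_mem_segment _ _ _) (mem_segment_iff.2 ⟨t, ht.1, ht.2, rfl⟩)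

end IsPolygonalRegion

/-! ### Deciding visibility -/

/-- The parameters at which the line through `p` and `r` can enter or leave an edge. -/
noncomputable def segmentCrit (E : List ((ℝ × ℝ) × (ℝ × ℝ))) (p r : ℝ × ℝ) : List ℝ :=
  0 :: 1 :: E.flatMap fun e =>
    [orient e.1 e.2 p / (orient e.1 e.2 p - orient e.1 e.2 r),
      (e.1.1 - p.1) / (r.1 - p.1), (e.1.2 - p.2) / (r.2 - p.2),
      (e.2.1 - p.1) / (r.1 - p.1), (e.2.2 - p.2) / (r.2 - p.2)]

theorem lineMap_eq_imp {p r v : ℝ × ℝ} (hpr : p ≠ r) {t : ℝ} (h : lineMap p r t = v) :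
    t = (v.1 - p.1) / (r.1 - p.1) ∨ t = (v.2 - p.2) / (r.2 - p.2) := by
  subst h
  rw [lineMap_fst_eq, lineMap_snd_eq]
  by_cases h1 : r.1 - p.1 = 0
  · have h2 : r.2 - p.2 ≠ 0 := fun h2 => hpr (Prod.ext (by linarith) (by linarith))
    right; field_simp; ring
  · left; field_simp; ring

/-- If membership changed between `s` and `t`, an edge would be met in between. An edge transversal
to the line is met at the first listed parameter. An edge on the line has its ends at listed
parameters, hence outside `[s, t]`, so it would contain the whole stretch. -/
theorem IsPolygonalRegion.mem_of_segmentCrit {E : List ((ℝ × ℝ) × (ℝ × ℝ))} {Q : Set (ℝ × ℝ)}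
    (h : IsPolygonalRegion E Q) {p r : ℝ × ℝ} {s t : ℝ} (hs : lineMap p r s ∈ Q)
    (hst : ∀ c ∈ segmentCrit E p r, c ∉ Set.uIcc s t) : lineMap p r t ∈ Q := by
  by_contra ht
  have hpr : p ≠ r := by
    rintro rfl
    simp only [lineMap_same, const_apply] at hs ht
    exact ht hs
  obtain ⟨e, he, w, hw, hmem⟩ : ∃ e ∈ E, ∃ w ∈ Set.Icc (0 : ℝ) 1,
      lineMap (lineMap p r s : ℝ × ℝ) (lineMap p r t) w ∈ segment ℝ e.1 e.2 := by
    by_contra! hno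
    exact ht (h.mem_of_lineMap hs hno)
  have hcrit : ∀ c ∈ [orient e.1 e.2 p / (orient e.1 e.2 p - orient e.1 e.2 r),
      (e.1.1 - p.1) / (r.1 - p.1), (e.1.2 - p.2) / (r.2 - p.2),
      (e.2.1 - p.1) / (r.1 - p.1), (e.2.2 - p.2) / (r.2 - p.2)], c ∉ Set.uIcc s t :=
    fun c hc => hst c (List.mem_cons_of_mem _ (List.mem_cons_of_mem _
      (List.mem_flatMap.2 ⟨e, he, hc⟩)))
  simp only [List.mem_cons, List.not_mem_nil, or_false, forall_eq_or_imp, forall_eq] at hcrit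
  obtain ⟨hc1, hc2, hc3, hc4, hc5⟩ := hcrit
  set u := (lineMap s t w : ℝ) with hu
  have hust : u ∈ Set.uIcc s t := by
    rw [← segment_eq_uIcc, segment_eq_image_lineMap]
    exact ⟨w, hw, rfl⟩
  have hzu : (lineMap (lineMap p r s : ℝ × ℝ) (lineMap p r t) w : ℝ × ℝ) = lineMap p r u := by
    rw [hu, lineMap_apply_ring']
    apply Prod.ext <;> simp only [lineMap_fst_eq, lineMap_snd_eq] <;> ring
  rw [hzu] at hmem
  have h0 := orient_eq_zero_of_mem_segment hmem
  rw [orient_lineMap] at h0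
  by_cases hoo : orient e.1 e.2 p - orient e.1 e.2 r = 0
  swap
  · refine hc1 ?_
    convert hust using 1
    field_simp
    linarith
  have hp0 : orient e.1 e.2 p = 0 := by linear_combination h0 + u * hoo
  have hr0 : orient e.1 e.2 r = 0 := by linarith
  obtain ⟨π, rfl⟩ := exists_lineMap_of_orient_eq_zero (h.ne e he) hp0
  obtain ⟨ρ, rfl⟩ := exists_lineMap_of_orient_eq_zero (h.ne e he) hr0
  obtain ⟨α, hα⟩ := exists_lineMap_of_orient_eq_zero (z := e.1) hpr (by
    simp only [orient, lineMap_fst_eq, lineMap_snd_eq]; ring)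
  obtain ⟨β, hβ⟩ := exists_lineMap_of_orient_eq_zero (z := e.2) hpr (by
    simp only [orient, lineMap_fst_eq, lineMap_snd_eq]; ring)
  have hα' : α ∉ Set.uIcc s t := by
    rcases lineMap_eq_imp hpr hα with e | e <;> rw [e] <;> assumption
  have hβ' : β ∉ Set.uIcc s t := by
    rcases lineMap_eq_imp hpr hβ with e | e <;> rw [e] <;> assumption
  have hseg := image_segment ℝ (lineMap (lineMap e.1 e.2 π : ℝ × ℝ) (lineMap e.1 e.2 ρ) :
    ℝ →ᵃ[ℝ] ℝ × ℝ) α β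
  rw [hα, hβ, segment_eq_uIcc] at hseg
  rw [← hseg] at hmem
  obtain ⟨u', hu', huu⟩ := hmem
  obtain rfl := lineMap_injective ℝ hpr huu
  -- The parameters `α`, `β` of the ends are not between `s` and `t`, but a point between `s` and
  -- `t` is between them; hence so is `t`.
  refine ht (h.mem_of_mem_segment he (hseg ▸ ⟨t, ?_, rfl⟩))
  rw [Set.mem_uIcc] at *
  grind

/-- The abscissa of the point of the line through the edge `e` at height `y`. -/
noncomputable def edgeAbscissa (e : (ℝ × ℝ) × (ℝ × ℝ)) (y : ℝ) : ℝ :=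
  e.1.1 + (y - e.1.2) / (e.2.2 - e.1.2) * (e.2.1 - e.1.1)

/-- Whether the horizontal ray from `z` to the right crosses the edge `e`. -/
noncomputable def rayCrosses (z : ℝ × ℝ) (e : (ℝ × ℝ) × (ℝ × ℝ)) : Bool :=
  (leb e.1.2 z.2 ^^ leb e.2.2 z.2) && !leb (edgeAbscissa e z.2) z.1

theorem mem_segment_of_edgeAbscissa {e : (ℝ × ℝ) × (ℝ × ℝ)} {y : ℝ}
    (hy : (leb e.1.2 y ^^ leb e.2.2 y) = true) :
    (edgeAbscissa e y, y) ∈ segment ℝ e.1 e.2 := by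
  have hy' : e.1.2 ≤ y ∧ y < e.2.2 ∨ e.2.2 ≤ y ∧ y < e.1.2 := by
    cases h1 : leb e.1.2 y <;> cases h2 : leb e.2.2 y <;> rw [h1, h2] at hy
    · simp at hy
    · exact Or.inr ⟨leb_eq_true.1 h2, leb_eq_false.1 h1⟩
    · exact Or.inl ⟨leb_eq_true.1 h1, leb_eq_false.1 h2⟩
    · simp at hy
  refine mem_segment_iff.2 ⟨(y - e.1.2) / (e.2.2 - e.1.2), ?_, ?_, ?_⟩
  · rcases hy' with hy' | hy'
    · exact div_nonneg (by linarith) (by linarith)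
    · exact div_nonneg_of_nonpos (by linarith) (by linarith)
  · rcases hy' with hy' | hy'
    · rw [div_le_one (by linarith)]; linarith
    · rw [div_le_one_of_neg (by linarith)]; linarith
  · have hne : e.2.2 - e.1.2 ≠ 0 := by
      rcases hy' with hy' | hy'
      · exact ne_of_gt (by linarith)
      · exact ne_of_lt (by linarith)
    apply Prod.ext
    · rw [lineMap_fst_eq]; rfl
    · rw [lineMap_snd_eq]; field_simp; ring

theorem edgeAbscissa_eq {e : (ℝ × ℝ) × (ℝ × ℝ)} {z : ℝ × ℝ} (hz : z ∈ segment ℝ e.1 e.2)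
    (h1 : e.1.2 ≠ z.2) (h2 : e.2.2 ≠ z.2) :
    (leb e.1.2 z.2 ^^ leb e.2.2 z.2) = true ∧ edgeAbscissa e z.2 = z.1 ∧
      z ∈ openSegment ℝ e.1 e.2 ∧ e.1.2 ≠ e.2.2 := by
  have hopen : z ∈ openSegment ℝ e.1 e.2 := by
    rw [← insert_endpoints_openSegment] at hz
    rcases hz with rfl | rfl | hz
    · exact absurd rfl h1
    · exact absurd rfl h2
    · exact hz
  obtain ⟨t, h0, ht1, rfl⟩ := mem_openSegment_iff.1 hopen
  rw [lineMap_snd_eq] at *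
  rw [lineMap_fst_eq]
  have hne : e.1.2 ≠ e.2.2 := fun hne => h1 (by rw [hne]; ring)
  refine ⟨?_, ?_, hopen, hne⟩
  · rcases hne.lt_or_gt with hlt | hlt
    · have h3 : leb e.1.2 (e.1.2 + t * (e.2.2 - e.1.2)) = true := leb_eq_true.2 (by nlinarith)
      have h4 : leb e.2.2 (e.1.2 + t * (e.2.2 - e.1.2)) = false := leb_eq_false.2 (by nlinarith)
      rw [h3, h4]; rfl
    · have h3 : leb e.1.2 (e.1.2 + t * (e.2.2 - e.1.2)) = false := leb_eq_false.2 (by nlinarith)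
      have h4 : leb e.2.2 (e.1.2 + t * (e.2.2 - e.1.2)) = true := leb_eq_true.2 (by nlinarith)
      rw [h3, h4]; rfl
  · have : e.2.2 - e.1.2 ≠ 0 := sub_ne_zero.2 hne.symm
    rw [edgeAbscissa]
    field_simp
    ring

theorem eventually_lt_of_continuous {f : ℝ → ℝ} (hf : Continuous f) {a : ℝ} (h : f 0 < a) :
    ∀ᶠ t : ℝ in 𝓝[>] 0, f t < a :=
  (hf.continuousAt.eventually_lt_const h).filter_mono nhdsWithin_le_nhds

theorem eventually_gt_of_continuous {f : ℝ → ℝ} (hf : Continuous f) {a : ℝ} (h : a < f 0) :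
    ∀ᶠ t : ℝ in 𝓝[>] 0, a < f t :=
  (hf.continuousAt.eventually_const_lt h).filter_mono nhdsWithin_le_nhds

theorem eventually_add_mem_of_isOpen {U : Set (ℝ × ℝ)} (hU : IsOpen U) {z : ℝ × ℝ} (hz : z ∈ U) :
    ∀ᶠ t : ℝ in 𝓝[>] 0, (z.1 + t, z.2) ∈ U ∧ (z.1 - t, z.2) ∈ U := by
  refine Filter.Eventually.filter_mono nhdsWithin_le_nhds ?_
  have hc1 : Continuous fun t : ℝ => (z.1 + t, z.2) := by fun_prop
  have hc2 : Continuous fun t : ℝ => (z.1 - t, z.2) := by fun_prop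
  exact (hc1.continuousAt.eventually_mem (hU.mem_nhds (by simpa using hz))).and
    (hc2.continuousAt.eventually_mem (hU.mem_nhds (by simpa using hz)))

/-! ### The crossing parity rule -/

namespace IsPolygonalRegion

variable {E : List ((ℝ × ℝ) × (ℝ × ℝ))} {Q : Set (ℝ × ℝ)} (h : IsPolygonalRegion E Q)
include h

/-- The membership in the region changes across the interior of an edge. -/
theorem mem_iff_notMem_across {e} (he : e ∈ E) {w : ℝ × ℝ} (hw : w ∈ openSegment ℝ e.1 e.2)
    (hne : e.1.2 ≠ e.2.2) : ∀ᶠ t : ℝ in 𝓝[>] 0,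
      ((w.1 - t, w.2) ∈ Q ↔ (w.1 + t, w.2) ∉ Q) := by
  -- Near `w` there is no edge but `e`, so each open half of a small ball is convex and free of
  -- edges: it is inside or outside as a whole.
  have hU : ∃ ε > 0, ∀ z ∈ Metric.ball w ε, ∀ e' ∈ E, e' ≠ e → z ∉ segment ℝ e'.1 e'.2 := by
    have h1 : ∀ᶠ z in 𝓝 w, ∀ e' ∈ {e' | e' ∈ E}, e' ≠ e → z ∉ segment ℝ e'.1 e'.2 := by
      refine ((List.finite_toSet E).eventually_all (l := 𝓝 w)).2 fun e' he' => ?_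
      by_cases hee : e' = e
      · exact Eventually.of_forall fun z hne => absurd hee hne
      · have := (isClosed_segment_plane e'.1 e'.2).isOpen_compl.mem_nhds (x := w)
          fun hmem => hee (h.eq_of_mem e he e' he' w hw hmem).symm
        filter_upwards [this] with z hz _ using hz
    exact Metric.eventually_nhds_iff_ball.1 h1
  obtain ⟨ε, hε, hball⟩ := hU
  set c := e.2.2 - e.1.2 with hc
  have hc0 : c ≠ 0 := sub_ne_zero.2 hne.symm
  have hcc : 0 < c * c := mul_self_pos.2 hc0
  have hlin : ∀ z : ℝ × ℝ, ∀ t, orient e.1 e.2 (z.1 + t, z.2) = orient e.1 e.2 z - c * t := by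
    intro z t; simp only [orient, hc]; ring
  have hw0 := orient_eq_zero_of_mem_segment (openSegment_subset_segment _ _ _ hw)
  have hconv : ∀ σ : ℝ, Convex ℝ {z | z ∈ Metric.ball w ε ∧ 0 < σ * orient e.1 e.2 z} := by
    intro σ
    refine (convex_ball w ε).inter fun x hx y hy a b ha hb hab => ?_
    have e1 : a • x + b • y = lineMap x y b := by
      rw [lineMap_apply_module, ← hab, add_sub_cancel_right]
    replace hx : 0 < σ * orient e.1 e.2 x := hx
    replace hy : 0 < σ * orient e.1 e.2 y := hy
    change 0 < σ * orient e.1 e.2 (a • x + b • y)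
    rw [e1, orient_lineMap]
    have : 1 - b = a := by linarith
    rw [this]
    rcases ha.eq_or_lt with rfl | ha
    · have : b = 1 := by linarith
      subst this; linarith
    · have := mul_pos ha hx
      have := mul_nonneg hb hy.le
      linarith
  have hside : ∀ σ : ℝ, ∀ z₀, z₀ ∈ Metric.ball w ε → 0 < σ * orient e.1 e.2 z₀ → z₀ ∈ Q →
      ∀ z ∈ Metric.ball w ε, 0 < σ * orient e.1 e.2 z → z ∈ Q := by
    intro σ z₀ h1 h2 h3 z h4 h5
    refine h.subset_of_isPreconnected (hconv σ).isPreconnected (fun z hz e' he' hmem => ?_)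
      ⟨h1, h2⟩ h3 ⟨h4, h5⟩
    by_cases hee : e' = e
    · subst hee
      have := hz.2
      rw [orient_eq_zero_of_mem_segment hmem, mul_zero] at this
      exact lt_irrefl _ this
    · exact hball z hz.1 e' he' hee hmem
  filter_upwards [eventually_add_mem_of_isOpen (z := w) Metric.isOpen_ball
      (Metric.mem_ball_self hε),
    self_mem_nhdsWithin] with t ⟨hr, hl⟩ (ht : 0 < t)
  have hlpos : 0 < c * orient e.1 e.2 (w.1 - t, w.2) := by
    rw [sub_eq_add_neg, hlin, hw0]
    have := mul_pos hcc ht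
    linarith
  have hrpos : 0 < -c * orient e.1 e.2 (w.1 + t, w.2) := by
    rw [hlin, hw0]
    have := mul_pos hcc ht
    linarith
  have hwf : w ∈ frontier Q := (h.mem_frontier w).2 ⟨e, he, openSegment_subset_segment _ _ _ hw⟩
  have hright : ∀ z : ℝ × ℝ, orient e.1 e.2 z = 0 → ∀ t > 0,
      0 < -c * orient e.1 e.2 (z.1 + t, z.2) := by
    intro z hz t ht
    rw [hlin, hz]
    have := mul_pos hcc ht
    linarith
  constructor
  -- If both halves were inside, then by closedness so would be the line between them, and `w` would
  -- be an interior point.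
  · intro hlQ hrQ
    refine hwf.2 (mem_interior.2 ⟨Metric.ball w ε, fun z hz => ?_, Metric.isOpen_ball,
      Metric.mem_ball_self hε⟩)
    rcases lt_trichotomy 0 (c * orient e.1 e.2 z) with h1 | h1 | h1
    · exact hside c _ hl hlpos hlQ z hz h1
    · have hz0 : orient e.1 e.2 z = 0 := (mul_eq_zero.1 h1.symm).resolve_left hc0
      have hlim : Tendsto (fun t : ℝ => (z.1 + t, z.2)) (𝓝[>] 0) (𝓝 z) := by
        have hc1 : Continuous fun t : ℝ => (z.1 + t, z.2) := by fun_prop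
        have := hc1.tendsto 0
        simp only [add_zero] at this
        exact this.mono_left nhdsWithin_le_nhds
      refine h.isClosed.mem_of_tendsto hlim ?_
      filter_upwards [eventually_add_mem_of_isOpen Metric.isOpen_ball hz, self_mem_nhdsWithin]
        with t ⟨h2, _⟩ ht
      exact hside (-c) _ hr hrpos hrQ _ h2 (hright z hz0 t ht)
    · exact hside (-c) _ hr hrpos hrQ z hz (by linarith)
  -- If neither half were inside, `Q` would lie on a line near `w`, although `w` is a limit of
  -- interior points.
  · intro hrQ
    by_contra hlQ
    have hwQ : w ∈ closure (interior Q) :=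
      h.closure_interior.symm ▸ h.isClosed.frontier_subset hwf
    obtain ⟨z, hzb, hzi⟩ := mem_closure_iff.1 hwQ _ Metric.isOpen_ball (Metric.mem_ball_self hε)
    have hno : ∀ z ∈ Metric.ball w ε, z ∈ Q → orient e.1 e.2 z = 0 := by
      intro z hz hzQ
      by_contra hz0
      rcases (mul_ne_zero hc0 hz0).lt_or_gt with h1 | h1
      · exact hrQ (hside (-c) z hz (by linarith) hzQ _ hr hrpos)
      · exact hlQ (hside c z hz h1 hzQ _ hl hlpos)
    have hz0 := hno z hzb (interior_subset hzi)
    obtain ⟨t, ⟨⟨h1, h2⟩, -⟩, ht⟩ := ((eventually_add_mem_of_isOpen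
      (Metric.isOpen_ball.inter isOpen_interior) ⟨hzb, hzi⟩).and self_mem_nhdsWithin).exists
    have := hright z hz0 t ht
    rw [hno _ h1 (interior_subset h2), mul_zero] at this
    exact lt_irrefl _ this

/-- The parity rule at heights that are not the height of a vertex. -/
theorem mem_iff_odd_of_generic {y : ℝ} (hy : ∀ e ∈ E, e.1.2 ≠ y ∧ e.2.2 ≠ y) (k : ℕ) :
    ∀ x : ℝ, (∀ e ∈ E, (x, y) ∉ segment ℝ e.1 e.2) → (E.filter (rayCrosses (x, y))).length = k →
      ((x, y) ∈ Q ↔ Odd k) := by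
  induction k with
  | zero =>
    intro x hx hk
    simp only [Nat.not_odd_zero, iff_false]
    intro hQ
    have hnone : ∀ e ∈ E, rayCrosses (x, y) e = false := by
      simpa [List.filter_eq_nil_iff] using List.length_eq_zero_iff.1 hk
    obtain ⟨R, hR⟩ := h.bounded.exists_norm_le
    -- With no crossing, the ray stays in `Q` until it passes the radius `R` bounding `Q`.
    have hsub : ((max x (R + 1), y) : ℝ × ℝ) ∈ Q := by
      refine h.mem_of_lineMap hQ fun e he s hs hmem => ?_
      set z := (lineMap (x, y) (max x (R + 1), y) s : ℝ × ℝ) with hz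
      have hz2 : z.2 = y := by rw [hz, lineMap_snd_eq]; ring
      have hz1 : x ≤ z.1 := by
        rw [hz, lineMap_fst_eq]
        have := mul_nonneg hs.1 (sub_nonneg.2 (le_max_left x (R + 1)))
        linarith
      obtain ⟨h1, h2, -, -⟩ := edgeAbscissa_eq hmem (hz2 ▸ (hy e he).1) (hz2 ▸ (hy e he).2)
      have := hnone e he
      simp only [rayCrosses, hz2 ▸ h1, Bool.true_and, Bool.not_eq_false', leb_eq_true] at this
      rw [← hz2, h2] at this
      refine hx e he ?_
      have hzx : z = (x, y) := Prod.ext (le_antisymm this hz1) hz2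
      rwa [← hzx]
    have h1 := hR _ hsub
    rw [Prod.norm_def] at h1
    have h2 : R + 1 ≤ ‖max x (R + 1)‖ := (le_max_right _ _).trans (le_abs_self _)
    have := h2.trans ((le_max_left _ _).trans h1)
    linarith
  | succ k ih =>
    intro x hx hk
    obtain ⟨e, he, hcr, hmin⟩ := E.exists_argmin (fun e => rayCrosses (x, y) e = true)
      (fun e => edgeAbscissa e y) (by
        have := List.length_pos_iff_exists_mem.1 (by rw [hk]; exact Nat.succ_pos k)
        simpa using this)
    have hcr' : ∀ e, rayCrosses (x, y) e = true ↔
        (leb e.1.2 y ^^ leb e.2.2 y) = true ∧ x < edgeAbscissa e y := by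
      intro e
      simp only [rayCrosses, Bool.and_eq_true, Bool.not_eq_true', leb_eq_false]
    have hxe := ((hcr' e).1 hcr).2
    set w : ℝ × ℝ := (edgeAbscissa e y, y) with hw
    have hwe : w ∈ segment ℝ e.1 e.2 := mem_segment_of_edgeAbscissa ((hcr' e).1 hcr).1
    obtain ⟨-, -, hwo, hne⟩ := edgeAbscissa_eq hwe (hy e he).1 (hy e he).2
    -- At a generic height the first crossing is inside `e`, hence on no other edge, and the next
    -- crossing is strictly farther.
    have hnext : ∀ e' ∈ E, e' ≠ e → rayCrosses (x, y) e' = true →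
        edgeAbscissa e y < edgeAbscissa e' y := by
      intro e' he' hee hcr₁
      refine lt_of_le_of_ne (hmin e' he' hcr₁) fun heq => hee ?_
      refine (h.eq_of_mem e he e' he' w hwo ?_).symm
      rw [hw, heq]
      exact mem_segment_of_edgeAbscissa ((hcr' e').1 hcr₁).1
    have h1 : ∀ᶠ t : ℝ in 𝓝[>] 0, ∀ e' ∈ {e' | e' ∈ E}, e' ≠ e → rayCrosses (x, y) e' = true →
        edgeAbscissa e y + t < edgeAbscissa e' y := by
      refine ((List.finite_toSet E).eventually_all).2 fun e' he' => ?_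
      by_cases hee : e' ≠ e ∧ rayCrosses (x, y) e' = true
      · filter_upwards [eventually_lt_of_continuous (f := fun t => edgeAbscissa e y + t)
          (by fun_prop) (by simpa using hnext e' he' hee.1 hee.2)] with t ht _ _ using ht
      · exact Eventually.of_forall fun t h2 h3 => absurd ⟨h2, h3⟩ hee
    have h2 : ∀ᶠ t : ℝ in 𝓝[>] 0, x < edgeAbscissa e y - t :=
      eventually_gt_of_continuous (by fun_prop) (by simpa using hxe)
    obtain ⟨t, ⟨h1, h2⟩, h3, ht⟩ := ((h1.and h2).and
      ((h.mem_iff_notMem_across he hwo hne).and self_mem_nhdsWithin)).exists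
    replace ht : 0 < t := ht
    simp only [hw] at h3
    have hfree : ∀ e' ∈ E, ∀ x', x ≤ x' → x' < edgeAbscissa e y →
        (x', y) ∉ segment ℝ e'.1 e'.2 := by
      intro e' he' x' hx' hx'' hmem
      obtain ⟨h4, h5, -, -⟩ := edgeAbscissa_eq hmem (hy e' he').1 (hy e' he').2
      dsimp only at h4 h5
      rcases hx'.eq_or_lt with rfl | hx'
      · exact hx e' he' hmem
      · have := hmin e' he' ((hcr' e').2 ⟨h4, h5 ▸ hx'⟩)
        linarith
    have hleft : (x, y) ∈ Q ↔ (edgeAbscissa e y - t, y) ∈ Q := by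
      constructor <;>
      · intro hQ
        refine h.mem_of_lineMap hQ fun e' he' s hs => ?_
        have : ∀ a b : ℝ, (lineMap ((a, y) : ℝ × ℝ) (b, y) s : ℝ × ℝ) = (a + s * (b - a), y) := by
          intro a b
          exact Prod.ext (by rw [lineMap_fst_eq]) (by rw [lineMap_snd_eq]; ring)
        rw [this]
        refine hfree e' he' _ ?_ ?_ <;> nlinarith [hs.1, hs.2]
    -- Moving just past the first crossing removes exactly `e` from the crossed edges and flips
    -- membership.
    have hcount : E.filter (rayCrosses (edgeAbscissa e y + t, y)) =
        (E.filter (rayCrosses (x, y))).erase e := by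
      rw [(h.nodup.filter _).erase_eq_filter, List.filter_filter]
      refine List.filter_congr fun e' he' => ?_
      rw [Bool.eq_iff_iff, Bool.and_eq_true, bne_iff_ne]
      have hcr₂ : rayCrosses (edgeAbscissa e y + t, y) e' = true ↔
          (leb e'.1.2 y ^^ leb e'.2.2 y) = true ∧ edgeAbscissa e y + t < edgeAbscissa e' y := by
        simp only [rayCrosses, Bool.and_eq_true, Bool.not_eq_true', leb_eq_false]
      rw [hcr₂]
      constructor
      · rintro ⟨h4, h5⟩
        refine ⟨?_, (hcr' e').2 ⟨h4, by linarith⟩⟩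
        rintro rfl
        linarith
      · rintro ⟨h4, h5⟩
        exact ⟨((hcr' e').1 h5).1, h1 e' he' h4 h5⟩
    have hright := ih (edgeAbscissa e y + t) (fun e' he' hmem => by
      obtain ⟨h4, h5, -, -⟩ := edgeAbscissa_eq hmem (hy e' he').1 (hy e' he').2
      dsimp only at h4 h5
      by_cases hee : e' = e
      · subst hee; linarith
      · have := h1 e' he' hee ((hcr' e').2 ⟨h4, by linarith⟩)
        linarith) (by
      rw [hcount, List.length_erase_of_mem (List.mem_filter.2 ⟨he, hcr⟩), hk, Nat.add_sub_cancel])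
    rw [hleft, h3, hright, Nat.odd_add_one]

/-- Raising `z` slightly reaches a generic height. As a vertex at the height of `z` counts as below,
the raise changes neither the crossed edges nor membership. -/
theorem mem_iff_odd {z : ℝ × ℝ} (hz : ∀ e ∈ E, z ∉ segment ℝ e.1 e.2) :
    z ∈ Q ↔ Odd (E.filter (rayCrosses z)).length := by
  have hcont : Continuous fun t : ℝ => (z.1, z.2 + t) := by fun_prop
  have hnear : ∀ U : Set (ℝ × ℝ), IsOpen U → z ∈ U → ∀ᶠ t : ℝ in 𝓝[>] 0, (z.1, z.2 + t) ∈ U := by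
    intro U hU hzU
    exact Filter.Eventually.filter_mono nhdsWithin_le_nhds
      (hcont.continuousAt.eventually_mem (hU.mem_nhds (by simpa using hzU)))
  have hside : ∀ a : ℝ, ∀ᶠ t : ℝ in 𝓝[>] 0, a ≠ z.2 + t ∧ leb a (z.2 + t) = leb a z.2 := by
    intro a
    rcases le_or_gt a z.2 with ha | ha
    · filter_upwards [self_mem_nhdsWithin] with t (ht : 0 < t)
      exact ⟨by linarith, by rw [leb_eq_true.2 ha, leb_eq_true.2 (by linarith)]⟩
    · filter_upwards [eventually_lt_of_continuous (f := fun t => z.2 + t) (by fun_prop)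
        (by simpa using ha)] with t ht
      exact ⟨ht.ne', by rw [leb_eq_false.2 ha, leb_eq_false.2 ht]⟩
  have h1 : ∀ᶠ t : ℝ in 𝓝[>] 0, ((z.1, z.2 + t) ∈ Q ↔ z ∈ Q) := by
    by_cases hzQ : z ∈ Q
    · have hzi : z ∈ interior Q := by
        by_contra hzi
        obtain ⟨e, he, hmem⟩ := (h.mem_frontier z).1 ⟨subset_closure hzQ, hzi⟩
        exact hz e he hmem
      filter_upwards [hnear _ isOpen_interior hzi] with t ht
      exact iff_of_true (interior_subset ht) hzQ
    · filter_upwards [hnear _ h.isClosed.isOpen_compl hzQ] with t ht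
      exact iff_of_false ht hzQ
  have h2 : ∀ᶠ t : ℝ in 𝓝[>] 0, ∀ e ∈ {e | e ∈ E}, (z.1, z.2 + t) ∉ segment ℝ e.1 e.2 ∧
      (e.1.2 ≠ z.2 + t ∧ e.2.2 ≠ z.2 + t) ∧
      rayCrosses (z.1, z.2 + t) e = rayCrosses z e := by
    refine ((List.finite_toSet E).eventually_all).2 fun e he => ?_
    have h3 := hnear _ (isClosed_segment_plane e.1 e.2).isOpen_compl (hz e he)
    have h4 : ∀ᶠ t : ℝ in 𝓝[>] 0, (leb e.1.2 z.2 ^^ leb e.2.2 z.2) = true →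
        leb (edgeAbscissa e (z.2 + t)) z.1 = leb (edgeAbscissa e z.2) z.1 := by
      by_cases hx : (leb e.1.2 z.2 ^^ leb e.2.2 z.2) = true
      · have hne : edgeAbscissa e z.2 ≠ z.1 := fun hne => by
          refine hz e he ?_
          have := mem_segment_of_edgeAbscissa hx
          rwa [hne] at this
        have hc : Continuous fun t : ℝ => edgeAbscissa e (z.2 + t) := by
          unfold edgeAbscissa; fun_prop
        rcases hne.lt_or_gt with hlt | hlt
        · filter_upwards [eventually_lt_of_continuous hc (by simpa using hlt)] with t ht _
          rw [leb_eq_true.2 ht.le, leb_eq_true.2 hlt.le]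
        · filter_upwards [eventually_gt_of_continuous hc (by simpa using hlt)] with t ht _
          rw [leb_eq_false.2 ht, leb_eq_false.2 hlt]
      · exact Eventually.of_forall fun t ht => absurd ht hx
    filter_upwards [h3, h4, hside e.1.2, hside e.2.2] with t h3 h4 h5 h6
    refine ⟨h3, ⟨h5.1, h6.1⟩, ?_⟩
    simp only [rayCrosses, h5.2, h6.2]
    by_cases hx : (leb e.1.2 z.2 ^^ leb e.2.2 z.2) = true
    · rw [h4 hx]
    · rw [Bool.not_eq_true] at hx
      simp only [hx, Bool.false_and]
  obtain ⟨t, h1, h2⟩ := (h1.and h2).exists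
  rw [← h1, h.mem_iff_odd_of_generic (fun e he => (h2 e he).2.1) _ z.1
    (fun e he => (h2 e he).1) rfl,
    List.filter_congr fun e he => (h2 e he).2.2]

end IsPolygonalRegion

/-- Whether `z` lies on the segment `e`. -/
noncomputable def onEdge (z : ℝ × ℝ) (e : (ℝ × ℝ) × (ℝ × ℝ)) : Bool :=
  (leb (orient e.1 e.2 z) 0 && leb 0 (orient e.1 e.2 z)) &&
    (leb 0 ((z.1 - e.1.1) * (e.2.1 - z.1)) && leb 0 ((z.2 - e.1.2) * (e.2.2 - z.2)))

/-- Point location by the parity rule. -/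
noncomputable def pointMem (E : List ((ℝ × ℝ) × (ℝ × ℝ))) (z : ℝ × ℝ) : Bool :=
  E.any (onEdge z) || E.foldl (fun b e => b ^^ rayCrosses z e) false

/-- Whether the segment `pr` lies in the region bounded by the edges `E`. -/
noncomputable def segmentMem (E : List ((ℝ × ℝ) × (ℝ × ℝ))) (p r : ℝ × ℝ) : Bool :=
  (segmentCrit E p r).all fun c => (segmentCrit E p r).all fun d =>
    !(leb 0 c && (leb c d && leb d 1)) ||
      pointMem E (p.1 + (c + d) / 2 * (r.1 - p.1), p.2 + (c + d) / 2 * (r.2 - p.2))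

section PolyTime

variable {α : Type} [Sized α] {E : α → List ((ℝ × ℝ) × (ℝ × ℝ))} {e : α → (ℝ × ℝ) × (ℝ × ℝ)}
  {p q r : α → ℝ × ℝ}

@[fun_prop]
theorem PolyTime.orient (hp : PolyTime p) (hq : PolyTime q) (hr : PolyTime r) :
    PolyTime fun a => orient (p a) (q a) (r a) := by
  unfold _root_.orient; fun_prop

@[fun_prop]
theorem PolyTime.rayCrosses (hp : PolyTime p) (he : PolyTime e) :
    PolyTime fun a => rayCrosses (p a) (e a) := by
  unfold _root_.rayCrosses edgeAbscissa; fun_prop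

@[fun_prop]
theorem PolyTime.onEdge (hp : PolyTime p) (he : PolyTime e) :
    PolyTime fun a => onEdge (p a) (e a) := by
  unfold _root_.onEdge; fun_prop

@[fun_prop]
theorem PolyTime.pointMem (hE : PolyTime E) (hp : PolyTime p) :
    PolyTime fun a => pointMem (E a) (p a) := by
  refine .or (.any hE (by fun_prop)) (.foldl_bool (g := fun a b e => b ^^ _root_.rayCrosses (p a) e)
    hE .false ?_)
  have hp' : PolyTime fun x : (α × Bool) × ((ℝ × ℝ) × (ℝ × ℝ)) => p x.1.1 :=
    hp.comp (f := fun x : (α × Bool) × ((ℝ × ℝ) × (ℝ × ℝ)) => x.1.1) (by fun_prop)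
  fun_prop

@[fun_prop]
theorem PolyTime.segmentCrit (hE : PolyTime E) (hp : PolyTime p) (hr : PolyTime r) :
    PolyTime fun a => segmentCrit (E a) (p a) (r a) := by
  unfold _root_.segmentCrit; fun_prop

@[fun_prop]
theorem PolyTime.segmentMem (hE : PolyTime E) (hp : PolyTime p) (hr : PolyTime r) :
    PolyTime fun a => segmentMem (E a) (p a) (r a) := by
  unfold _root_.segmentMem; fun_prop

end PolyTime

theorem onEdge_eq_true {z : ℝ × ℝ} {e : (ℝ × ℝ) × (ℝ × ℝ)} :
    onEdge z e = true ↔ z ∈ segment ℝ e.1 e.2 := by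
  simp only [onEdge, Bool.and_eq_true, leb_eq_true, mem_segment_iff_orient, ← le_antisymm_iff]

theorem foldl_xor_eq_true {β : Type} (l : List β) (f : β → Bool) :
    l.foldl (fun b e => b ^^ f e) false = true ↔ Odd (l.filter f).length := by
  have h : ∀ (l : List β) b, (l.foldl (fun b e => b ^^ f e) b = true ↔
      (b = true ↔ ¬Odd (l.filter f).length)) := by
    intro l
    induction l with
    | nil => simp
    | cons x l ih =>
      intro b
      rw [List.foldl_cons, ih, List.filter_cons]
      cases hx : f x <;> cases b <;> simp [Nat.even_add_one]
  simp [h]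

/-! ### Correctness of point location and of the visibility test -/

namespace IsPolygonalRegion

variable {E : List ((ℝ × ℝ) × (ℝ × ℝ))} {Q : Set (ℝ × ℝ)} (h : IsPolygonalRegion E Q)
include h

theorem pointMem_eq_true (z : ℝ × ℝ) : pointMem E z = true ↔ z ∈ Q := by
  rw [pointMem, Bool.or_eq_true, List.any_eq_true, foldl_xor_eq_true]
  simp only [onEdge_eq_true]
  by_cases hz : ∃ e ∈ E, z ∈ segment ℝ e.1 e.2
  · obtain ⟨e, he, hmem⟩ := hz
    exact iff_of_true (Or.inl ⟨e, he, hmem⟩) (h.mem_of_mem_segment he hmem)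
  · rw [or_iff_right hz, h.mem_iff_odd (by simpa using hz)]

theorem segmentMem_eq_true (p r : ℝ × ℝ) : segmentMem E p r = true ↔ segment ℝ p r ⊆ Q := by
  have h0 : ∀ t, ((p.1 + t * (r.1 - p.1), p.2 + t * (r.2 - p.2)) : ℝ × ℝ) = lineMap p r t :=
    fun t => Prod.ext (lineMap_fst_eq p r t).symm (lineMap_snd_eq p r t).symm
  have h1 : segmentMem E p r = true ↔ ∀ c ∈ segmentCrit E p r, ∀ d ∈ segmentCrit E p r,
      0 ≤ c → c ≤ d → d ≤ 1 → lineMap p r ((c + d) / 2) ∈ Q := by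
    simp only [segmentMem, List.all_eq_true, Bool.or_eq_true, Bool.not_eq_true',
      Bool.and_eq_false_iff, leb_eq_false, ← not_le, h0, h.pointMem_eq_true]
    refine forall₂_congr fun c _ => forall₂_congr fun d _ => ?_
    tauto
  rw [h1]
  constructor
  · intro hmid z hz
    obtain ⟨t, ht0, ht1, rfl⟩ := mem_segment_iff.1 hz
    -- Parameters outside `[0, 1]` count as members of this `S`; this is why `0` and `1` are among
    -- the critical parameters.
    have := Icc_subset_of_midpoints_mem (K := segmentCrit E p r)
      (S := {s | 0 ≤ s → s ≤ 1 → lineMap p r s ∈ Q}) (a := 0) (b := 1) (fun s hs t hst h2 h3 => ?_)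
      (by simp [segmentCrit]) (by simp [segmentCrit])
      (fun c hc d hd h2 h3 h4 _ _ => hmid c hc d hd h2 h3 h4) ⟨ht0, ht1⟩ ht0 ht1
    · exact this
    · have hs0 : 0 ≤ s := by
        by_contra! hs0
        exact hst 0 (by simp [segmentCrit]) (Set.mem_uIcc.2 (Or.inl ⟨hs0.le, h2⟩))
      have hs1 : s ≤ 1 := by
        by_contra! hs1
        exact hst 1 (by simp [segmentCrit]) (Set.mem_uIcc.2 (Or.inr ⟨h3, hs1.le⟩))
      exact h.mem_of_segmentCrit (hs hs0 hs1) hst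
  · intro hsub c _ d _ h2 h3 h4
    exact hsub (mem_segment_iff.2 ⟨_, by linarith, by linarith, rfl⟩)

end IsPolygonalRegion

end PolygonalRegions

section Arrangements

open Filter Topology

/-! ## Sets described by the signs of bilinear functions -/

/-- The value of the bilinear function with coefficients `f` at `z`. -/
def bilinEval (f : ℝ × ℝ × ℝ × ℝ) (z : ℝ × ℝ) : ℝ :=
  f.1 + f.2.1 * z.1 + f.2.2.1 * z.2 + f.2.2.2 * (z.1 * z.2)

/-- The constant coefficient, a polynomial in the first variable, of a bilinear function considered
as a polynomial in the second variable. -/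
def constQuad (f : ℝ × ℝ × ℝ × ℝ) : ℝ × ℝ × ℝ := (f.1, f.2.1, 0)

/-- The leading coefficient, a polynomial in the first variable, of a bilinear function considered
as a polynomial in the second variable. -/
def leadQuad (f : ℝ × ℝ × ℝ × ℝ) : ℝ × ℝ × ℝ := (f.2.2.1, f.2.2.2, 0)

/-- The resultant of two bilinear functions with respect to the second variable. -/
def resultantQuad (f g : ℝ × ℝ × ℝ × ℝ) : ℝ × ℝ × ℝ :=
  (f.1 * g.2.2.1 - g.1 * f.2.2.1,
    f.1 * g.2.2.2 + f.2.1 * g.2.2.1 - g.1 * f.2.2.2 - g.2.1 * f.2.2.1,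
    f.2.1 * g.2.2.2 - g.2.1 * f.2.2.2)

/-- The zero of `f (x, ·)`. -/
noncomputable def zeroAt (f : ℝ × ℝ × ℝ × ℝ) (x : ℝ) : ℝ :=
  -quadEval (constQuad f) x / quadEval (leadQuad f) x

theorem bilinEval_eq (f : ℝ × ℝ × ℝ × ℝ) (z : ℝ × ℝ) :
    bilinEval f z = quadEval (constQuad f) z.1 + quadEval (leadQuad f) z.1 * z.2 := by
  simp only [bilinEval, quadEval, constQuad, leadQuad]; ring

theorem bilinEval_eq_mul {f : ℝ × ℝ × ℝ × ℝ} {z : ℝ × ℝ} (h : quadEval (leadQuad f) z.1 ≠ 0) :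
    bilinEval f z = quadEval (leadQuad f) z.1 * (z.2 - zeroAt f z.1) := by
  rw [bilinEval_eq, zeroAt]; field_simp; ring

/-- Thus the vertical order of two graphs is decided by the signs of three polynomials in `x`. -/
theorem zeroAt_sub_zeroAt {f g : ℝ × ℝ × ℝ × ℝ} {x : ℝ} (hf : quadEval (leadQuad f) x ≠ 0)
    (hg : quadEval (leadQuad g) x ≠ 0) : zeroAt f x - zeroAt g x =
      -(quadEval (resultantQuad f g) x / (quadEval (leadQuad f) x * quadEval (leadQuad g) x)) := by
  have : quadEval (resultantQuad f g) x = quadEval (constQuad f) x * quadEval (leadQuad g) x -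
      quadEval (constQuad g) x * quadEval (leadQuad f) x := by
    simp only [quadEval, constQuad, leadQuad, resultantQuad]; ring
  rw [this, zeroAt, zeroAt]; field_simp; ring

/-- The function `y - k`. -/
def heightFun (k : ℝ) : ℝ × ℝ × ℝ × ℝ := (-k, 0, 1, 0)

/-- The functions in `F`, and functions with the horizontal lines `y = c`, `y = d` and those
contained in the zero sets of functions in `F` as zero sets. -/
noncomputable def addHeights (F : List (ℝ × ℝ × ℝ × ℝ)) (c d : ℝ) : List (ℝ × ℝ × ℝ × ℝ) :=
  F ++ heightFun c :: heightFun d :: F.map fun f => heightFun (-f.2.1 / f.2.2.2)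

/-- The abscissae where the arrangement of the zero sets of `G` between `a` and `b` changes. -/
noncomputable def abscissae (G : List (ℝ × ℝ × ℝ × ℝ)) (a b : ℝ) : List ℝ :=
  a :: b :: G.flatMap fun f => quadRoots (constQuad f) ++ (quadRoots (leadQuad f) ++
    G.flatMap fun g => quadRoots (resultantQuad f g))

/-- Points in all cells of the arrangement of the zero sets of `G`. -/
noncomputable def samplePoints (G : List (ℝ × ℝ × ℝ × ℝ)) (a b : ℝ) : List (ℝ × ℝ) :=
  (abscissae G a b).flatMap fun s => (abscissae G a b).flatMap fun t => G.flatMap fun f =>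
    G.map fun g => ((s + t) / 2, (zeroAt f ((s + t) / 2) + zeroAt g ((s + t) / 2)) / 2)

/-- The negative of a bilinear function. -/
def negFun (f : ℝ × ℝ × ℝ × ℝ) : ℝ × ℝ × ℝ × ℝ := (-f.1, -f.2.1, -f.2.2.1, -f.2.2.2)

/-- The records bounded by two abscissae and two zero sets. -/
noncomputable def candidates (G : List (ℝ × ℝ × ℝ × ℝ)) (a b c d : ℝ) : List VisRecord :=
  (abscissae G a b).flatMap fun s => (abscissae G a b).flatMap fun t =>
    (G ++ G.map negFun).flatMap fun f => (G ++ G.map negFun).map fun g => ((s, t), (c, d), [f, g])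

/-- Whether a record covers a point. -/
noncomputable def coversBool (R : VisRecord) (z : ℝ × ℝ) : Bool :=
  ((leb R.1.1 z.1 && leb z.1 R.1.2) && (leb R.2.1.1 z.2 && leb z.2 R.2.1.2)) &&
    R.2.2.all fun f => leb 0 (bilinEval f z)

/-- Records covering the points of the rectangle `[a, b] × [c, d]` where `T` holds, for a property
`T` that depends only on the signs of the functions in `F`. -/
noncomputable def coveringRecords (F : List (ℝ × ℝ × ℝ × ℝ)) (a b c d : ℝ) (T : ℝ × ℝ → Bool) :
    List VisRecord :=
  (candidates (addHeights F c d) a b c d).filter fun R => (leb a R.1.1 && leb R.1.2 b) &&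
    (samplePoints (addHeights F c d) a b).all fun z => !coversBool R z || T z

section PolyTime

variable {α : Type} [Sized α] {F : α → List (ℝ × ℝ × ℝ × ℝ)} {f g : α → ℝ × ℝ × ℝ × ℝ}
  {z : α → ℝ × ℝ} {a b c d : α → ℝ} {R : α → VisRecord}

@[fun_prop]
theorem PolyTime.bilinEval (hf : PolyTime f) (hz : PolyTime z) :
    PolyTime fun a => bilinEval (f a) (z a) := by
  unfold _root_.bilinEval; fun_prop

@[fun_prop]
theorem PolyTime.constQuad (hf : PolyTime f) : PolyTime fun a => constQuad (f a) := by
  unfold _root_.constQuad; fun_prop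

@[fun_prop]
theorem PolyTime.leadQuad (hf : PolyTime f) : PolyTime fun a => leadQuad (f a) := by
  unfold _root_.leadQuad; fun_prop

@[fun_prop]
theorem PolyTime.resultantQuad (hf : PolyTime f) (hg : PolyTime g) :
    PolyTime fun a => resultantQuad (f a) (g a) := by
  unfold _root_.resultantQuad; fun_prop

@[fun_prop]
theorem PolyTime.zeroAt (hf : PolyTime f) (ha : PolyTime a) :
    PolyTime fun x => zeroAt (f x) (a x) := by
  unfold _root_.zeroAt; fun_prop

@[fun_prop]
theorem PolyTime.addHeights (hF : PolyTime F) (hc : PolyTime c) (hd : PolyTime d) :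
    PolyTime fun x => addHeights (F x) (c x) (d x) := by
  unfold _root_.addHeights heightFun; fun_prop

@[fun_prop]
theorem PolyTime.abscissae (hF : PolyTime F) (ha : PolyTime a) (hb : PolyTime b) :
    PolyTime fun x => abscissae (F x) (a x) (b x) := by
  unfold _root_.abscissae; fun_prop

@[fun_prop]
theorem PolyTime.samplePoints (hF : PolyTime F) (ha : PolyTime a) (hb : PolyTime b) :
    PolyTime fun x => samplePoints (F x) (a x) (b x) := by
  unfold _root_.samplePoints; fun_prop

@[fun_prop]
theorem PolyTime.candidates (hF : PolyTime F) (ha : PolyTime a) (hb : PolyTime b)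
    (hc : PolyTime c) (hd : PolyTime d) :
    PolyTime fun x => candidates (F x) (a x) (b x) (c x) (d x) := by
  unfold _root_.candidates negFun; fun_prop

@[fun_prop]
theorem PolyTime.coversBool (hR : PolyTime R) (hz : PolyTime z) :
    PolyTime fun a => coversBool (R a) (z a) := by
  unfold _root_.coversBool; fun_prop

theorem PolyTime.coveringRecords {T : α → ℝ × ℝ → Bool} (hF : PolyTime F) (ha : PolyTime a)
    (hb : PolyTime b) (hc : PolyTime c) (hd : PolyTime d)
    (hT : PolyTime fun p : α × (ℝ × ℝ) => T p.1 p.2) :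
    PolyTime fun x => coveringRecords (F x) (a x) (b x) (c x) (d x) (T x) := by
  unfold _root_.coveringRecords
  have hT' : PolyTime fun p : (α × VisRecord) × (ℝ × ℝ) => T p.1.1 p.2 :=
    hT.comp (f := fun p : (α × VisRecord) × (ℝ × ℝ) => (p.1.1, p.2)) (by fun_prop)
  refine .filter (by fun_prop) (.and (by fun_prop) (.all (by fun_prop) (.or (by fun_prop) hT')))

end PolyTime

/-! ### Vertical order of the zero sets -/

theorem coversBool_eq_true {R : VisRecord} {z : ℝ × ℝ} :
    coversBool R z = true ↔ R.Covers z.1 z.2 := by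
  simp only [coversBool, VisRecord.Covers, Bool.and_eq_true, leb_eq_true, List.all_eq_true,
    bilinEval, and_assoc]

theorem bilinEval_negFun (f : ℝ × ℝ × ℝ × ℝ) (z : ℝ × ℝ) :
    bilinEval (negFun f) z = -bilinEval f z := by
  simp only [bilinEval, negFun]; ring

theorem bilinEval_heightFun (k : ℝ) (z : ℝ × ℝ) : bilinEval (heightFun k) z = z.2 - k := by
  simp only [bilinEval, heightFun]; ring

theorem quadEval_leadQuad_heightFun (k x : ℝ) : quadEval (leadQuad (heightFun k)) x = 1 := by
  simp [quadEval, leadQuad, heightFun]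

theorem zeroAt_heightFun (k x : ℝ) : zeroAt (heightFun k) x = k := by
  simp [zeroAt, quadEval, leadQuad, constQuad, heightFun]

theorem le_iff_of_sign_sub_eq {x y x' y' : ℝ}
    (h : SignType.sign (x - y) = SignType.sign (x' - y')) : y ≤ x ↔ y' ≤ x' := by
  rw [← sub_nonneg, nonneg_iff_of_sign_eq h, sub_nonneg]

/-- The zero sets of `G` have the same vertical order at `x` and at `u`. -/
structure SameOrder (G : List (ℝ × ℝ × ℝ × ℝ)) (x u : ℝ) : Prop where
  const : ∀ f ∈ G, SignType.sign (quadEval (constQuad f) x) =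
    SignType.sign (quadEval (constQuad f) u)
  lead : ∀ f ∈ G, SignType.sign (quadEval (leadQuad f) x) = SignType.sign (quadEval (leadQuad f) u)
  resultant : ∀ f ∈ G, ∀ g ∈ G, SignType.sign (quadEval (resultantQuad f g) x) =
    SignType.sign (quadEval (resultantQuad f g) u)

theorem SameOrder.refl (G : List (ℝ × ℝ × ℝ × ℝ)) (x : ℝ) : SameOrder G x x :=
  ⟨fun _ _ => rfl, fun _ _ => rfl, fun _ _ _ _ => rfl⟩

theorem SameOrder.of_abscissae {G : List (ℝ × ℝ × ℝ × ℝ)} {a b x u : ℝ}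
    (h : ∀ s ∈ abscissae G a b, s ∉ Set.uIcc x u) : SameOrder G x u := by
  have hmem : ∀ f ∈ G, ∀ s ∈ quadRoots (constQuad f) ++ (quadRoots (leadQuad f) ++
      G.flatMap fun g => quadRoots (resultantQuad f g)), s ∉ Set.uIcc x u := fun f hf s hs =>
    h s (List.mem_cons_of_mem _ (List.mem_cons_of_mem _ (List.mem_flatMap.2 ⟨f, hf, hs⟩)))
  refine ⟨fun f hf => sign_quadEval_eq fun s hs => hmem f hf s ?_,
    fun f hf => sign_quadEval_eq fun s hs => hmem f hf s ?_,
    fun f hf g hg => sign_quadEval_eq fun s hs => hmem f hf s ?_⟩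
  · exact List.mem_append_left _ hs
  · exact List.mem_append_right _ (List.mem_append_left _ hs)
  · exact List.mem_append_right _ (List.mem_append_right _ (List.mem_flatMap.2 ⟨g, hg, hs⟩))

namespace SameOrder

variable {G : List (ℝ × ℝ × ℝ × ℝ)} {x u : ℝ} (h : SameOrder G x u) {f g : ℝ × ℝ × ℝ × ℝ}
include h

theorem lead_ne_zero (hf : f ∈ G) (hfx : quadEval (leadQuad f) x ≠ 0) :
    quadEval (leadQuad f) u ≠ 0 := by
  rwa [← sign_ne_zero, ← h.lead f hf, sign_ne_zero]

theorem sign_zeroAt_sub (hf : f ∈ G) (hg : g ∈ G) (hfx : quadEval (leadQuad f) x ≠ 0)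
    (hgx : quadEval (leadQuad g) x ≠ 0) :
    SignType.sign (zeroAt f x - zeroAt g x) = SignType.sign (zeroAt f u - zeroAt g u) := by
  have hinv : ∀ t : ℝ, SignType.sign t⁻¹ = SignType.sign t := fun t => by
    rcases lt_trichotomy t 0 with ht | rfl | ht
    · rw [sign_neg ht, sign_neg (inv_lt_zero.2 ht)]
    · simp
    · rw [sign_pos ht, sign_pos (inv_pos.2 ht)]
  rw [zeroAt_sub_zeroAt hfx hgx, zeroAt_sub_zeroAt (h.lead_ne_zero hf hfx) (h.lead_ne_zero hg hgx),
    Left.sign_neg, Left.sign_neg, div_eq_mul_inv, div_eq_mul_inv, sign_mul, sign_mul, hinv, hinv,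
    sign_mul, sign_mul, h.lead f hf, h.lead g hg, h.resultant f hf g hg]

theorem zeroAt_le_iff (hf : f ∈ G) (hg : g ∈ G) (hfx : quadEval (leadQuad f) x ≠ 0)
    (hgx : quadEval (leadQuad g) x ≠ 0) :
    zeroAt f x ≤ zeroAt g x ↔ zeroAt f u ≤ zeroAt g u :=
  le_iff_of_sign_sub_eq (h.sign_zeroAt_sub hg hf hgx hfx)

/-- Points in the same position between the zero sets of `G` on two vertical lines with the same
order of the zeros. -/
theorem sign_bilinEval_eq {i j : ℝ × ℝ × ℝ × ℝ} (hi : i ∈ G) (hj : j ∈ G)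
    (hix : quadEval (leadQuad i) x ≠ 0) (hjx : quadEval (leadQuad j) x ≠ 0) {y : ℝ}
    (hiy : zeroAt i x ≤ y) (hyj : y ≤ zeroAt j x)
    (himax : ∀ k ∈ G, quadEval (leadQuad k) x ≠ 0 → zeroAt k x ≤ y → zeroAt k x ≤ zeroAt i x)
    (hjmin : ∀ k ∈ G, quadEval (leadQuad k) x ≠ 0 → y ≤ zeroAt k x → zeroAt j x ≤ zeroAt k x)
    {l : ℝ} (hl0 : 0 < l) (hl1 : l < 1) (k : ℝ × ℝ × ℝ × ℝ) (hk : k ∈ G) :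
    SignType.sign (bilinEval k (x, y)) =
      SignType.sign (bilinEval k (u, zeroAt i u + l * (zeroAt j u - zeroAt i u))) := by
  -- If the leading coefficient vanishes, `k` is constant on both vertical lines, with the sign of
  -- its constant coefficient.
  by_cases hkx : quadEval (leadQuad k) x = 0
  · have hku : quadEval (leadQuad k) u = 0 := by
      have := h.lead k hk
      rwa [hkx, sign_zero, eq_comm, sign_eq_zero_iff] at this
    rw [bilinEval_eq, bilinEval_eq, hkx, hku, zero_mul, zero_mul, add_zero, add_zero]
    exact h.const k hk
  · rw [bilinEval_eq_mul hkx, bilinEval_eq_mul (z := (u, _)) (h.lead_ne_zero hk hkx), sign_mul,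
      sign_mul, h.lead k hk]
    congr 1
    dsimp only
    have hij : zeroAt i u ≤ zeroAt j u := (h.zeroAt_le_iff hi hj hix hjx).1 (hiy.trans hyj)
    have hik := h.zeroAt_le_iff hi hk hix hkx
    have hki := h.zeroAt_le_iff hk hi hkx hix
    have hjk := h.zeroAt_le_iff hj hk hjx hkx
    have hkj := h.zeroAt_le_iff hk hj hkx hjx
    -- No zero lies strictly between those of `i` and `j` except at `y`; if `y` is itself a zero,
    -- then `i`, `j` and `k` have the same zero, also at `u`.
    rcases lt_trichotomy y (zeroAt k x) with hy | hy | hy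
    · have h1 := hjk.1 (hjmin k hk hkx hy.le)
      have h2 : zeroAt i u < zeroAt k u := by
        rw [← not_le, ← hki, not_le]
        exact hiy.trans_lt hy
      rw [sign_neg (sub_neg.2 hy), sign_neg]
      nlinarith
    · have h1 := hjk.1 (hjmin k hk hkx hy.le)
      have h2 := hki.1 (himax k hk hkx hy.ge)
      have h3 : zeroAt i u = zeroAt k u := le_antisymm (hij.trans h1) h2
      have h4 : zeroAt j u = zeroAt k u := le_antisymm h1 (h2.trans hij)
      rw [h3, h4, hy]
      simp
    · have h1 := hki.1 (himax k hk hkx hy.le)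
      have h2 : zeroAt k u < zeroAt j u := by
        rw [← not_le, ← hjk, not_le]
        exact hy.trans_le hyj
      rw [sign_pos (sub_pos.2 hy), sign_pos]
      nlinarith

end SameOrder

theorem heightFun_mem_addHeights (F : List (ℝ × ℝ × ℝ × ℝ)) (c d : ℝ) :
    heightFun c ∈ addHeights F c d ∧ heightFun d ∈ addHeights F c d := by
  simp [addHeights]

/-- Zero sets directly below and above a point. -/
theorem exists_adjacent_zeroAt {F : List (ℝ × ℝ × ℝ × ℝ)} {c d x y : ℝ} (hc : c ≤ y) (hd : y ≤ d) :
    (∃ i ∈ addHeights F c d, (quadEval (leadQuad i) x ≠ 0 ∧ zeroAt i x ≤ y) ∧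
      ∀ k ∈ addHeights F c d, quadEval (leadQuad k) x ≠ 0 → zeroAt k x ≤ y →
        zeroAt k x ≤ zeroAt i x) ∧
    ∃ j ∈ addHeights F c d, (quadEval (leadQuad j) x ≠ 0 ∧ y ≤ zeroAt j x) ∧
      ∀ k ∈ addHeights F c d, quadEval (leadQuad k) x ≠ 0 → y ≤ zeroAt k x →
        zeroAt j x ≤ zeroAt k x := by
  constructor
  · obtain ⟨i, hi, h1, h2⟩ := (addHeights F c d).exists_argmax
      (fun k => quadEval (leadQuad k) x ≠ 0 ∧ zeroAt k x ≤ y) (fun k => zeroAt k x)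
      ⟨heightFun c, (heightFun_mem_addHeights F c d).1, by simp [quadEval_leadQuad_heightFun],
        by rwa [zeroAt_heightFun]⟩
    exact ⟨i, hi, h1, fun k hk h3 h4 => h2 k hk ⟨h3, h4⟩⟩
  · obtain ⟨i, hi, h1, h2⟩ := (addHeights F c d).exists_argmin
      (fun k => quadEval (leadQuad k) x ≠ 0 ∧ y ≤ zeroAt k x) (fun k => zeroAt k x)
      ⟨heightFun d, (heightFun_mem_addHeights F c d).2, by simp [quadEval_leadQuad_heightFun],
        by rwa [zeroAt_heightFun]⟩
    exact ⟨i, hi, h1, fun k hk h3 h4 => h2 k hk ⟨h3, h4⟩⟩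

/-- The cell of an abscissa. -/
theorem exists_abscissa_cell (G : List (ℝ × ℝ × ℝ × ℝ)) {a b x : ℝ} (ha : a ≤ x) (hb : x ≤ b) :
    ∃ s ∈ abscissae G a b, ∃ t ∈ abscissae G a b, ∃ I : Set ℝ, x ∈ I ∧ (s + t) / 2 ∈ I ∧
      Set.Icc s t = closure I ∧ a ≤ s ∧ t ≤ b ∧ ∀ u ∈ I, SameOrder G x u ∧
        ∀ r ∈ abscissae G a b, SignType.sign (x - r) = SignType.sign (u - r) := by
  have haG : a ∈ abscissae G a b := by simp [abscissae]
  have hbG : b ∈ abscissae G a b := by simp [abscissae]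
  -- The cell is either `{x}` or the open interval between the neighbouring abscissae; its closure
  -- is `[s, t]` in both cases.
  by_cases hx : x ∈ abscissae G a b
  · refine ⟨x, hx, x, hx, {x}, rfl, by simp, by simp, ha, hb, ?_⟩
    rintro u rfl
    exact ⟨SameOrder.refl G u, fun _ _ => rfl⟩
  obtain ⟨s, hs, hsx, hsmax⟩ := (abscissae G a b).exists_argmax (· ≤ x) id ⟨a, haG, ha⟩
  obtain ⟨t, ht, hxt, htmin⟩ := (abscissae G a b).exists_argmin (x ≤ ·) id ⟨b, hbG, hb⟩
  have hsx' : s < x := lt_of_le_of_ne hsx fun e => hx (e ▸ hs)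
  have hxt' : x < t := lt_of_le_of_ne hxt fun e => hx (e ▸ ht)
  refine ⟨s, hs, t, ht, Set.Ioo s t, ⟨hsx', hxt'⟩, ⟨by linarith, by linarith⟩,
    (closure_Ioo (hsx'.trans hxt').ne).symm, hsmax a haG ha, htmin b hbG hb, fun u hu => ?_⟩
  constructor
  · refine SameOrder.of_abscissae (a := a) (b := b) fun r hr hru => ?_
    rw [Set.mem_uIcc] at hru
    rcases le_total r x with h | h
    · have := hsmax r hr h
      rcases hru with hru | hru <;> simp only [id] at this <;> linarith [hu.1, hu.2]
    · have := htmin r hr h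
      rcases hru with hru | hru <;> simp only [id] at this <;> linarith [hu.1, hu.2]
  · intro r hr
    rcases le_total r x with h | h
    · have := hsmax r hr h
      simp only [id] at this
      rw [sign_pos (by linarith), sign_pos (by linarith [hu.1])]
    · have := htmin r hr h
      simp only [id] at this
      rw [sign_neg (by linarith), sign_neg (by linarith [hu.2])]

/-- Move `w` to the middle of its strip and then halfway between the zeros adjacent to it; no
relevant sign changes. -/
theorem exists_samplePoint {F : List (ℝ × ℝ × ℝ × ℝ)} {a b c d : ℝ} {w : ℝ × ℝ} (ha : a ≤ w.1)
    (hb : w.1 ≤ b) (hc : c ≤ w.2) (hd : w.2 ≤ d) :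
    ∃ z ∈ samplePoints (addHeights F c d) a b,
      (∀ r ∈ abscissae (addHeights F c d) a b, SignType.sign (w.1 - r) = SignType.sign (z.1 - r)) ∧
      ∀ f ∈ addHeights F c d, SignType.sign (bilinEval f w) = SignType.sign (bilinEval f z) := by
  obtain ⟨s, hs, t, ht, I, -, hst, -, -, -, hI⟩ := exists_abscissa_cell (addHeights F c d) ha hb
  obtain ⟨⟨i, hi, ⟨hi1, hi2⟩, hi3⟩, j, hj, ⟨hj1, hj2⟩, hj3⟩ :=
    exists_adjacent_zeroAt (F := F) (x := w.1) hc hd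
  obtain ⟨hu, hsign⟩ := hI _ hst
  refine ⟨((s + t) / 2, (zeroAt i ((s + t) / 2) + zeroAt j ((s + t) / 2)) / 2), ?_, hsign,
    fun f hf => ?_⟩
  · exact List.mem_flatMap.2 ⟨s, hs, List.mem_flatMap.2 ⟨t, ht, List.mem_flatMap.2 ⟨i, hi,
      List.mem_map.2 ⟨j, hj, rfl⟩⟩⟩⟩
  · rw [hu.sign_bilinEval_eq hi hj hi1 hj1 hi2 hj2 hi3 hj3 (l := 1 / 2) (by norm_num) (by norm_num)
      f hf]
    congr 3
    ring

theorem nonneg_of_mem_closure {g : ℝ → ℝ} (hg : Continuous g) {I : Set ℝ} (h : ∀ u ∈ I, 0 ≤ g u)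
    {u : ℝ} (hu : u ∈ closure I) : 0 ≤ g u :=
  closure_minimal (t := {u | 0 ≤ g u}) h (isClosed_le continuous_const hg) hu

theorem ge_iff_of_sign_sub_eq {x y x' y' : ℝ}
    (h : SignType.sign (x - y) = SignType.sign (x' - y')) : x ≤ y ↔ x' ≤ y' := by
  refine le_iff_of_sign_sub_eq ?_
  rw [← neg_sub x, ← neg_sub x', Left.sign_neg, Left.sign_neg, h]

/-- A zero set between the lines `y = c` and `y = d` above the cell `I` is the zero set of a
function whose leading coefficient does not vanish on the closure of `I`. -/
theorem exists_lead_ne_zero_on_closure {F : List (ℝ × ℝ × ℝ × ℝ)} {c d x : ℝ} {I : Set ℝ}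
    (hI : ∀ u ∈ I, SameOrder (addHeights F c d) x u) {f : ℝ × ℝ × ℝ × ℝ}
    (hf : f ∈ addHeights F c d) (hfx : quadEval (leadQuad f) x ≠ 0) (hc : c ≤ zeroAt f x)
    (hd : zeroAt f x ≤ d) :
    ∃ f' ∈ addHeights F c d, zeroAt f' x = zeroAt f x ∧
      ∀ u ∈ closure I, quadEval (leadQuad f') u ≠ 0 := by
  by_cases hall : ∀ u ∈ closure I, quadEval (leadQuad f) u ≠ 0
  · exact ⟨f, hf, rfl, hall⟩
  push Not at hall
  obtain ⟨u, hu, hfu⟩ := hall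
  have hfF : f ∈ F := by
    by_contra hfF
    have : ∃ k, f = heightFun k := by
      simp only [addHeights, List.mem_append, hfF, List.mem_cons, List.mem_map, false_or] at hf
      rcases hf with rfl | rfl | ⟨g, -, rfl⟩ <;> exact ⟨_, rfl⟩
    obtain ⟨k, rfl⟩ := this
    simp [quadEval_leadQuad_heightFun] at hfu
  have hmem := heightFun_mem_addHeights F c d
  -- Over the cell the graph stays in `[c, d]`, so the constant coefficient is at most a multiple of
  -- the leading one. In the limit, it vanishes wherever the leading one does on the closure.
  have hbound : ∀ v ∈ I, 0 ≤ |quadEval (leadQuad f) v| * max |c| |d| -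
      |quadEval (constQuad f) v| := by
    intro v hv
    have hv' := hI v hv
    have h1 := (hv'.zeroAt_le_iff hmem.1 hf (by simp [quadEval_leadQuad_heightFun]) hfx).1
      (by rwa [zeroAt_heightFun])
    have h2 := (hv'.zeroAt_le_iff hf hmem.2 hfx (by simp [quadEval_leadQuad_heightFun])).1
      (by rwa [zeroAt_heightFun])
    rw [zeroAt_heightFun] at h1 h2
    have h3 : quadEval (constQuad f) v = -(quadEval (leadQuad f) v * zeroAt f v) := by
      have := hv'.lead_ne_zero hf hfx
      rw [zeroAt]
      field_simp
    rw [h3, abs_neg, abs_mul, sub_nonneg]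
    refine mul_le_mul_of_nonneg_left ?_ (abs_nonneg _)
    exact abs_le_max_abs_abs h1 h2
  have h0 := nonneg_of_mem_closure (g := fun v => |quadEval (leadQuad f) v| * max |c| |d| -
    |quadEval (constQuad f) v|) (((continuous_quadEval _).abs.mul continuous_const).sub
    (continuous_quadEval _).abs) hbound hu
  rw [hfu, abs_zero, zero_mul, zero_sub, Left.nonneg_neg_iff] at h0
  have hcu : quadEval (constQuad f) u = 0 := abs_nonpos_iff.1 h0
  -- Both coefficients vanish at `u`, so `f = (x - u)(f₁ + f₃ y)`, and off `x = u` its zero set is a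
  -- horizontal line listed in `addHeights`.
  refine ⟨heightFun (-f.2.1 / f.2.2.2), ?_, ?_, fun v _ => by simp [quadEval_leadQuad_heightFun]⟩
  · simp only [addHeights, List.mem_append, List.mem_cons, List.mem_map]
    exact Or.inr (Or.inr (Or.inr ⟨f, hfF, rfl⟩))
  · rw [zeroAt_heightFun, zeroAt]
    simp only [quadEval, constQuad, leadQuad, zero_mul, add_zero] at hfu hcu hfx ⊢
    have h1 : f.2.2.1 + f.2.2.2 * x = f.2.2.2 * (x - u) := by linear_combination hfu
    have h2 : f.1 + f.2.1 * x = f.2.1 * (x - u) := by linear_combination hcu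
    rw [h1] at hfx
    have h3 := left_ne_zero_of_mul hfx
    have h4 := right_ne_zero_of_mul hfx
    rw [h1, h2]
    field_simp

/-- On a cell where the leading coefficient of `f` does not vanish, `f` or `-f` is positive exactly
above the zero set of `f`. -/
theorem exists_bilinEval_nonneg_iff {G : List (ℝ × ℝ × ℝ × ℝ)} {x : ℝ} {I : Set ℝ} (hxI : x ∈ I)
    (hI : ∀ u ∈ I, SameOrder G x u) {f : ℝ × ℝ × ℝ × ℝ} (hf : f ∈ G)
    (hne : ∀ u ∈ closure I, quadEval (leadQuad f) u ≠ 0) :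
    (∃ L ∈ G ++ G.map negFun, ∀ u ∈ closure I, ∀ v, 0 ≤ bilinEval L (u, v) ↔ zeroAt f u ≤ v) ∧
    ∃ U ∈ G ++ G.map negFun, ∀ u ∈ closure I, ∀ v, 0 ≤ bilinEval U (u, v) ↔ v ≤ zeroAt f u := by
  have h1 : f ∈ G ++ G.map negFun := List.mem_append_left _ hf
  have h2 : negFun f ∈ G ++ G.map negFun := List.mem_append_right _ (List.mem_map_of_mem hf)
  have hcont := continuous_quadEval (leadQuad f)
  rcases (hne x (subset_closure hxI)).lt_or_gt with hx | hx
  · have hneg : ∀ u ∈ closure I, quadEval (leadQuad f) u < 0 := fun u hu => by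
      refine lt_of_le_of_ne (neg_nonneg.1 (nonneg_of_mem_closure hcont.neg (fun v hv => ?_) hu))
        (hne u hu)
      have := (hI v hv).lead f hf
      rw [sign_neg hx, eq_comm, sign_eq_neg_one_iff] at this
      exact neg_nonneg.2 this.le
    refine ⟨⟨_, h2, fun u hu v => ?_⟩, _, h1, fun u hu v => ?_⟩
    · rw [bilinEval_negFun, bilinEval_eq_mul (z := (u, v)) (hne u hu), ← neg_mul,
        mul_nonneg_iff_of_pos_left (neg_pos.2 (hneg u hu)), sub_nonneg]
    · rw [bilinEval_eq_mul (z := (u, v)) (hne u hu), ← neg_mul_neg,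
        mul_nonneg_iff_of_pos_left (neg_pos.2 (hneg u hu)), neg_sub, sub_nonneg]
  · have hpos : ∀ u ∈ closure I, 0 < quadEval (leadQuad f) u := fun u hu => by
      refine lt_of_le_of_ne (nonneg_of_mem_closure hcont (fun v hv => ?_) hu) (hne u hu).symm
      have := (hI v hv).lead f hf
      rw [sign_pos hx, eq_comm, sign_eq_one_iff] at this
      exact this.le
    refine ⟨⟨_, h1, fun u hu v => ?_⟩, _, h2, fun u hu v => ?_⟩
    · rw [bilinEval_eq_mul (z := (u, v)) (hne u hu), mul_nonneg_iff_of_pos_left (hpos u hu),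
        sub_nonneg]
    · rw [bilinEval_negFun, bilinEval_eq_mul (z := (u, v)) (hne u hu), ← mul_neg,
        mul_nonneg_iff_of_pos_left (hpos u hu), neg_sub, sub_nonneg]

theorem continuousOn_zeroAt {f : ℝ × ℝ × ℝ × ℝ} {I : Set ℝ}
    (hne : ∀ u ∈ I, quadEval (leadQuad f) u ≠ 0) : ContinuousOn (zeroAt f) I :=
  (continuous_quadEval _).neg.continuousOn.div (continuous_quadEval _).continuousOn hne

/-- A closed set that contains all points between two zero sets above a cell contains all points
weakly between them above the closure of the cell. -/
theorem mem_of_between_zeroAt {S : Set (ℝ × ℝ)} (hS : IsClosed S) {I : Set ℝ}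
    {i j : ℝ × ℝ × ℝ × ℝ} (hi : ∀ u ∈ closure I, quadEval (leadQuad i) u ≠ 0)
    (hj : ∀ u ∈ closure I, quadEval (leadQuad j) u ≠ 0)
    (h : ∀ u ∈ I, ∀ l, 0 < l → l < 1 → (u, zeroAt i u + l * (zeroAt j u - zeroAt i u)) ∈ S)
    {u v : ℝ} (hu : u ∈ closure I) (hiv : zeroAt i u ≤ v) (hvj : v ≤ zeroAt j u) : (u, v) ∈ S := by
  -- First `u` goes to the border of the cell at a fixed ratio `l`, then `l` goes to `0` or `1`;
  -- taking the limits separately also covers cells that narrow to a point.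
  have h1 : ∀ l, 0 < l → l < 1 →
      (u, zeroAt i u + l * (zeroAt j u - zeroAt i u)) ∈ S := by
    intro l hl0 hl1
    have hc : ContinuousOn (fun u => (u, zeroAt i u + l * (zeroAt j u - zeroAt i u)))
        (closure I) := by
      have h1 := continuousOn_zeroAt hi
      have h2 := continuousOn_zeroAt hj
      fun_prop
    have hcl := hc.preimage_isClosed_of_isClosed isClosed_closure hS
    have hsub : I ⊆ closure I ∩ (fun u => (u, zeroAt i u + l * (zeroAt j u - zeroAt i u))) ⁻¹' S :=
      fun u hu => ⟨subset_closure hu, h u hu l hl0 hl1⟩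
    exact (closure_minimal hsub hcl hu).2
  have h2 : ∀ l ∈ Set.Icc (0 : ℝ) 1, (u, zeroAt i u + l * (zeroAt j u - zeroAt i u)) ∈ S := by
    intro l hl
    have hc : Continuous fun l : ℝ => (u, zeroAt i u + l * (zeroAt j u - zeroAt i u)) := by
      fun_prop
    rw [← closure_Ioo zero_ne_one] at hl
    exact closure_minimal (fun l hl => h1 l hl.1 hl.2) (hS.preimage hc) hl
  have h3 : v ∈ Set.Icc (zeroAt i u) (zeroAt j u) := ⟨hiv, hvj⟩
  rw [← segment_eq_Icc (hiv.trans hvj), segment_eq_image'] at h3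
  obtain ⟨l, hl, rfl⟩ := h3
  exact h2 l hl

/-! ### Exactness of the covering records -/

section CoveringRecords

variable {F : List (ℝ × ℝ × ℝ × ℝ)} {a b c d : ℝ} {T : ℝ × ℝ → Bool} {S : Set (ℝ × ℝ)}

/-- Every condition of a candidate is the sign of a function at hand; those bounding the height are
the signs of `heightFun c` and `heightFun d`. -/
theorem covers_iff_of_sign_eq {R : VisRecord} (hR : R ∈ candidates (addHeights F c d) a b c d)
    {w z : ℝ × ℝ} (h1 : ∀ r ∈ abscissae (addHeights F c d) a b,
      SignType.sign (w.1 - r) = SignType.sign (z.1 - r))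
    (h2 : ∀ f ∈ addHeights F c d, SignType.sign (bilinEval f w) = SignType.sign (bilinEval f z)) :
    R.Covers w.1 w.2 ↔ R.Covers z.1 z.2 := by
  simp only [candidates, List.mem_flatMap, List.mem_map] at hR
  obtain ⟨s, hs, t, ht, f, hf, g, hg, rfl⟩ := hR
  have hsign : ∀ f ∈ addHeights F c d ++ (addHeights F c d).map negFun,
      (0 ≤ bilinEval f w ↔ 0 ≤ bilinEval f z) := by
    intro f hf
    rcases List.mem_append.1 hf with hf | hf
    · exact nonneg_iff_of_sign_eq (h2 f hf)
    · obtain ⟨f', hf', rfl⟩ := List.mem_map.1 hf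
      refine nonneg_iff_of_sign_eq ?_
      rw [bilinEval_negFun, bilinEval_negFun, Left.sign_neg, Left.sign_neg, h2 f' hf']
  have hc := h2 _ (heightFun_mem_addHeights F c d).1
  have hd := h2 _ (heightFun_mem_addHeights F c d).2
  rw [bilinEval_heightFun, bilinEval_heightFun] at hc hd
  have hf' := hsign f hf
  have hg' := hsign g hg
  simp only [bilinEval] at hf' hg'
  simp only [VisRecord.Covers, List.forall_mem_cons, List.not_mem_nil, false_imp_iff, forall_const,
    and_true]
  rw [le_iff_of_sign_sub_eq (h1 s hs), ge_iff_of_sign_sub_eq (h1 t ht), le_iff_of_sign_sub_eq hc,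
    ge_iff_of_sign_sub_eq hd, hf', hg']

/-- Soundness: a kept record covering `w` also covers a sample point with the signs of `w`, which
passed the test. Completeness: the closed cell of `w` is a candidate, and it lies in `S` because its
inner points have the signs of `w` and `S` is closed; so it is kept. -/
theorem exists_mem_coveringRecords_iff (hS : IsClosed S)
    (hT : ∀ z : ℝ × ℝ, a ≤ z.1 → z.1 ≤ b → c ≤ z.2 → z.2 ≤ d → (T z = true ↔ z ∈ S))
    (hsign : ∀ z w : ℝ × ℝ, a ≤ w.1 → w.1 ≤ b → c ≤ w.2 → w.2 ≤ d →
      (∀ f ∈ F, SignType.sign (bilinEval f z) = SignType.sign (bilinEval f w)) → z ∈ S → w ∈ S)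
    (w : ℝ × ℝ) : (∃ R ∈ coveringRecords F a b c d T, R.Covers w.1 w.2) ↔
      (a ≤ w.1 ∧ w.1 ≤ b ∧ c ≤ w.2 ∧ w.2 ≤ d) ∧ w ∈ S := by
  have hFG : ∀ f ∈ F, f ∈ addHeights F c d := fun f hf => List.mem_append_left _ hf
  have hrect : ∀ R ∈ candidates (addHeights F c d) a b c d, a ≤ R.1.1 → R.1.2 ≤ b →
      ∀ w : ℝ × ℝ, R.Covers w.1 w.2 → a ≤ w.1 ∧ w.1 ≤ b ∧ c ≤ w.2 ∧ w.2 ≤ d := by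
    intro R hR h1 h2 w hw
    simp only [candidates, List.mem_flatMap, List.mem_map] at hR
    obtain ⟨s, hs, t, ht, f, hf, g, hg, rfl⟩ := hR
    exact ⟨h1.trans hw.1, hw.2.1.trans h2, hw.2.2.1, hw.2.2.2.1⟩
  simp only [coveringRecords, List.mem_filter, Bool.and_eq_true, leb_eq_true, List.all_eq_true,
    Bool.or_eq_true, Bool.not_eq_true', ← Bool.not_eq_true, coversBool_eq_true]
  constructor
  · rintro ⟨R, ⟨hR, ⟨h1, h2⟩, h3⟩, hw⟩
    have hwr := hrect R hR h1 h2 w hw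
    refine ⟨hwr, ?_⟩
    obtain ⟨z, hz, hz1, hz2⟩ := exists_samplePoint (F := F) hwr.1 hwr.2.1 hwr.2.2.1 hwr.2.2.2
    have hzR := (covers_iff_of_sign_eq hR hz1 hz2).1 hw
    obtain ⟨h4, h5, h6, h7⟩ := hrect R hR h1 h2 z hzR
    refine hsign z w hwr.1 hwr.2.1 hwr.2.2.1 hwr.2.2.2 (fun f hf => (hz2 f (hFG f hf)).symm) ?_
    exact (hT z h4 h5 h6 h7).1 ((h3 z hz).resolve_left (not_not.2 hzR))
  · rintro ⟨⟨ha, hb, hc, hd⟩, hwS⟩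
    obtain ⟨s, hs, t, ht, I, hxI, -, hst, hsa, htb, hI⟩ :=
      exists_abscissa_cell (addHeights F c d) ha hb
    obtain ⟨⟨i₀, hi₀, ⟨hi1, hi2⟩, hi3⟩, j₀, hj₀, ⟨hj1, hj2⟩, hj3⟩ :=
      exists_adjacent_zeroAt (F := F) (x := w.1) hc hd
    have hmem := heightFun_mem_addHeights F c d
    have hlead : ∀ k x, quadEval (leadQuad (heightFun k)) x ≠ 0 := fun k x => by
      simp [quadEval_leadQuad_heightFun]
    have hic : c ≤ zeroAt i₀ w.1 := by
      have := hi3 _ hmem.1 (hlead _ _) (by rwa [zeroAt_heightFun])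
      rwa [zeroAt_heightFun] at this
    have hjd : zeroAt j₀ w.1 ≤ d := by
      have := hj3 _ hmem.2 (hlead _ _) (by rwa [zeroAt_heightFun])
      rwa [zeroAt_heightFun] at this
    -- Replace both bounding functions by ones with the same zero at `w.1` whose graphs extend
    -- continuously to the closed strip.
    obtain ⟨i, hi, hieq, hine⟩ := exists_lead_ne_zero_on_closure (fun u hu => (hI u hu).1) hi₀ hi1
      hic (hi2.trans hd)
    obtain ⟨j, hj, hjeq, hjne⟩ := exists_lead_ne_zero_on_closure (fun u hu => (hI u hu).1) hj₀ hj1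
      (hc.trans hj2) hjd
    rw [← hieq] at hi2 hi3
    rw [← hjeq] at hj2 hj3
    have hwcl := subset_closure hxI
    have hinner : ∀ u ∈ I, ∀ l, 0 < l → l < 1 →
        (u, zeroAt i u + l * (zeroAt j u - zeroAt i u)) ∈ S := by
      intro u hu l hl0 hl1
      have heq := (hI u hu).1.sign_bilinEval_eq hi hj (hine _ hwcl) (hjne _ hwcl) hi2 hj2 hi3 hj3
        hl0 hl1
      have hust : u ∈ Set.Icc s t := hst ▸ subset_closure hu
      have h1 := heq _ hmem.1
      have h2 := heq _ hmem.2
      rw [bilinEval_heightFun, bilinEval_heightFun] at h1 h2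
      exact hsign w _ (hsa.trans hust.1) (hust.2.trans htb) ((le_iff_of_sign_sub_eq h1).1 hc)
        ((ge_iff_of_sign_sub_eq h2).1 hd) (fun f hf => heq f (hFG f hf)) hwS
    obtain ⟨⟨L, hL, hLiff⟩, -⟩ := exists_bilinEval_nonneg_iff hxI (fun u hu => (hI u hu).1) hi hine
    obtain ⟨-, U, hU, hUiff⟩ := exists_bilinEval_nonneg_iff hxI (fun u hu => (hI u hu).1) hj hjne
    have hcov : ∀ z : ℝ × ℝ, VisRecord.Covers ((s, t), (c, d), [L, U]) z.1 z.2 ↔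
        z.1 ∈ closure I ∧ c ≤ z.2 ∧ z.2 ≤ d ∧ 0 ≤ bilinEval L z ∧ 0 ≤ bilinEval U z := by
      intro z
      rw [← hst]
      simp only [VisRecord.Covers, List.forall_mem_cons, List.not_mem_nil, false_imp_iff,
        forall_const, and_true, bilinEval, Set.mem_Icc, and_assoc]
    have hcand : (((s, t), (c, d), [L, U]) : VisRecord) ∈ candidates (addHeights F c d) a b c d :=
      List.mem_flatMap.2 ⟨s, hs, List.mem_flatMap.2 ⟨t, ht, List.mem_flatMap.2 ⟨L, hL,
        List.mem_map.2 ⟨U, hU, rfl⟩⟩⟩⟩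
    refine ⟨((s, t), (c, d), [L, U]), ⟨hcand, ⟨hsa, htb⟩, fun z _ => ?_⟩, ?_⟩
    · rw [or_iff_not_imp_left, not_not]
      intro hz
      obtain ⟨h1, h2, h3, h4⟩ := hrect _ hcand hsa htb z hz
      obtain ⟨h5, -, -, h6, h7⟩ := (hcov z).1 hz
      exact (hT z h1 h2 h3 h4).2 (mem_of_between_zeroAt hS hine hjne hinner h5
        ((hLiff _ h5 z.2).1 h6) ((hUiff _ h5 z.2).1 h7))
    · exact (hcov w).2 ⟨hwcl, hc, hd, (hLiff _ hwcl w.2).2 hi2, (hUiff _ hwcl w.2).2 hj2⟩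

end CoveringRecords

end Arrangements

/-! ## Trajectories -/

/-- The Euclidean distance of two points given by their coordinates. -/
noncomputable def euclideanDist (a b : ℝ × ℝ) : ℝ :=
  Real.sqrt ((a.1 - b.1) * (a.1 - b.1) + (a.2 - b.2) * (a.2 - b.2))

/-- A segment of a trajectory: the distances of its end points from the beginning of the trajectory,
and the coefficients of the affine function that gives the point at a given distance. -/
abbrev Piece : Type := (ℝ × ℝ) × ((ℝ × ℝ) × (ℝ × ℝ))

/-- The point at distance `x` on a segment of a trajectory. -/
def pieceAt (A : Piece) (x : ℝ) : ℝ × ℝ :=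
  (A.2.1.1 + A.2.2.1 * x, A.2.1.2 + A.2.2.2 * x)

/-- The segment `ab` of a trajectory, where `a` is at distance `s` from the beginning. -/
noncomputable def mkPiece (s : ℝ) (e : (ℝ × ℝ) × (ℝ × ℝ)) : Piece :=
  ((s, s + euclideanDist e.1 e.2),
    (e.1.1 - (e.2.1 - e.1.1) / euclideanDist e.1 e.2 * s,
      e.1.2 - (e.2.2 - e.1.2) / euclideanDist e.1 e.2 * s),
    ((e.2.1 - e.1.1) / euclideanDist e.1 e.2, (e.2.2 - e.1.2) / euclideanDist e.1 e.2))

/-- The segments of a trajectory, where the beginning is counted as a segment. -/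
noncomputable def pieces (l : List (ℝ × ℝ)) : List Piece :=
  List.casesOn (motive := fun _ => List Piece) l [] fun a l =>
    (((a :: a :: l).zip (a :: l)).foldl
      (fun (s : ℝ × List Piece) e => (s.1 + euclideanDist e.1 e.2, mkPiece s.1 e :: s.2)) (0, [])).2

/-- The edges of the polygon with the given list of vertices. -/
def polygonEdges (l : List (ℝ × ℝ)) : List ((ℝ × ℝ) × (ℝ × ℝ)) :=
  List.casesOn (motive := fun _ => List ((ℝ × ℝ) × (ℝ × ℝ))) l [] fun a l =>
    (a :: (l ++ [a])).zip (l ++ [a])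

/-- The coefficients of `orient p r v`, where `p` and `r` are the points at distances `x` and `y` on
two segments of trajectories. -/
def orientFun (A B : Piece) (v : ℝ × ℝ) : ℝ × ℝ × ℝ × ℝ :=
  (B.2.1.1 * v.2 - B.2.1.1 * A.2.1.2 - A.2.1.1 * v.2 - B.2.1.2 * v.1 + B.2.1.2 * A.2.1.1 +
      A.2.1.2 * v.1,
    A.2.2.2 * v.1 - A.2.2.1 * v.2 - B.2.1.1 * A.2.2.2 + B.2.1.2 * A.2.2.1,
    B.2.2.1 * v.2 - B.2.2.2 * v.1 - B.2.2.1 * A.2.1.2 + B.2.2.2 * A.2.1.1,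
    B.2.2.2 * A.2.2.1 - B.2.2.1 * A.2.2.2)

/-- The coefficients of the functions of the distances on two segments of trajectories whose signs
determine the position of the line of sight relative to an edge. -/
def edgeBilinear (A B : Piece) (e : (ℝ × ℝ) × (ℝ × ℝ)) : List (ℝ × ℝ × ℝ × ℝ) :=
  [orientFun A B e.1, orientFun A B e.2,
    (orient e.1 e.2 A.2.1, (e.2.1 - e.1.1) * A.2.2.2 - (e.2.2 - e.1.2) * A.2.2.1, 0, 0),
    (orient e.1 e.2 B.2.1, 0, (e.2.1 - e.1.1) * B.2.2.2 - (e.2.2 - e.1.2) * B.2.2.1, 0),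
    (e.1.1 - A.2.1.1, -A.2.2.1, 0, 0), (e.1.2 - A.2.1.2, -A.2.2.2, 0, 0),
    (e.2.1 - A.2.1.1, -A.2.2.1, 0, 0), (e.2.2 - A.2.1.2, -A.2.2.2, 0, 0),
    (B.2.1.1 - e.1.1, 0, B.2.2.1, 0), (B.2.1.2 - e.1.2, 0, B.2.2.2, 0),
    (B.2.1.1 - e.2.1, 0, B.2.2.1, 0), (B.2.1.2 - e.2.2, 0, B.2.2.2, 0)]

/-- The table that describes the visibility between two trajectories for all velocities. -/
noncomputable def visibilityTable (I : Input) : List VisRecord :=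
  (pieces I.2.1).flatMap fun A => (pieces I.2.2).flatMap fun B =>
    coveringRecords ((polygonEdges I.1).flatMap fun e => edgeBilinear A B e)
      A.1.1 A.1.2 B.1.1 B.1.2
      fun z => segmentMem (polygonEdges I.1) (pieceAt A z.1) (pieceAt B z.2)

section PolyTime

variable {α : Type} [Sized α] {A B : α → Piece} {e : α → (ℝ × ℝ) × (ℝ × ℝ)}
  {p q : α → ℝ × ℝ} {x : α → ℝ} {l : α → List (ℝ × ℝ)}

@[fun_prop]
theorem PolyTime.pieceAt (hA : PolyTime A) (hx : PolyTime x) :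
    PolyTime fun a => pieceAt (A a) (x a) := by
  unfold _root_.pieceAt; fun_prop

@[fun_prop]
theorem PolyTime.euclideanDist (hp : PolyTime p) (hq : PolyTime q) :
    PolyTime fun a => euclideanDist (p a) (q a) := by
  unfold _root_.euclideanDist; fun_prop

@[fun_prop]
theorem PolyTime.mkPiece (hx : PolyTime x) (he : PolyTime e) :
    PolyTime fun a => mkPiece (x a) (e a) := by
  unfold _root_.mkPiece; fun_prop

@[fun_prop]
theorem PolyTime.orientFun (hA : PolyTime A) (hB : PolyTime B) (hp : PolyTime p) :
    PolyTime fun a => orientFun (A a) (B a) (p a) := by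
  unfold _root_.orientFun; fun_prop

@[fun_prop]
theorem PolyTime.edgeBilinear (hA : PolyTime A) (hB : PolyTime B) (he : PolyTime e) :
    PolyTime fun a => edgeBilinear (A a) (B a) (e a) := by
  unfold _root_.edgeBilinear; fun_prop

@[fun_prop]
theorem PolyTime.polygonEdges (hl : PolyTime l) : PolyTime fun a => polygonEdges (l a) :=
  hl.listCase .nil (.zip_cons (by fun_prop) (by fun_prop))

@[fun_prop]
theorem PolyTime.pieces (hl : PolyTime l) : PolyTime fun a => pieces (l a) := by
  refine hl.listCase .nil (.comp .snd (.foldl (.zip_cons (by fun_prop) (by fun_prop))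
    (by fun_prop) (by fun_prop) ?_))
  -- A piece consists of six real numbers of size `2`, hence the `12`.
  have h : ∀ (l : List ((ℝ × ℝ) × (ℝ × ℝ))) (s : ℝ × List Piece),
      size (l.foldl (fun (s : ℝ × List Piece) e =>
        (s.1 + _root_.euclideanDist e.1 e.2, _root_.mkPiece s.1 e :: s.2)) s) =
      12 * l.length + size s := by
    intro l
    induction l with
    | nil => simp
    | cons e l ih =>
      intro s
      rw [List.foldl_cons, ih]
      simp only [size_prod, size_cons, size_real, List.length_cons]
      ring
  obtain ⟨k, hk⟩ := ((PolyBounded.const 12).mul (PolyBounded.size (α := α × (ℝ × ℝ) ×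
    List (ℝ × ℝ)))).add (.const 4)
  refine ⟨k, fun a l hl => le_trans ?_ (hk a)⟩
  have h1 := hl.length_le
  have h2 := length_le_size a.2.2
  have h3 : size a = size a.1 + (size a.2.1 + size a.2.2) := rfl
  have h4 := two_le_size a.1
  have h5 : size ((0 : ℝ), ([] : List Piece)) = 4 := rfl
  rw [h, h5]
  simp only [List.length_zip, List.length_cons] at h1
  dsimp only
  omega

theorem PolyTime.visibilityTable : PolyTime visibilityTable := by
  unfold _root_.visibilityTable
  refine .flatMap (by fun_prop) (.flatMap (by fun_prop) (.coveringRecords (by fun_prop)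
    (by fun_prop) (by fun_prop) (by fun_prop) (by fun_prop) (by fun_prop)))

end PolyTime

/-- Orientation is affine in each of its points separately, so substituting affine motions yields
bilinear functions. -/
theorem map_bilinEval_edgeBilinear (A B : Piece) (e : (ℝ × ℝ) × (ℝ × ℝ)) (z : ℝ × ℝ) :
    (edgeBilinear A B e).map (fun f => bilinEval f z) =
      edgeFunctions e (pieceAt A z.1) (pieceAt B z.2) := by
  simp only [edgeBilinear, edgeFunctions, List.map_cons, List.map_nil, bilinEval, orientFun, orient,
    pieceAt, List.cons.injEq, and_true]
  refine ⟨?_, ?_, ?_, ?_, ?_, ?_, ?_, ?_, ?_, ?_, ?_, ?_⟩ <;> ring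

/-! ### Pieces and arc length -/

/-- The segments of a trajectory, by recursion along the trajectory. -/
noncomputable def piecesFrom (s : ℝ) (a : ℝ × ℝ) : List (ℝ × ℝ) → List Piece
  | [] => []
  | b :: l => mkPiece s (a, b) :: piecesFrom (s + euclideanDist a b) b l

/-- The loop lists the pieces in reverse, but only membership matters. -/
theorem mem_pieces_cons {a : ℝ × ℝ} {l : List (ℝ × ℝ)} {A : Piece} :
    A ∈ pieces (a :: l) ↔ A ∈ piecesFrom 0 a (a :: l) := by
  have h : ∀ (l : List (ℝ × ℝ)) (a : ℝ × ℝ) (s : ℝ × List Piece),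
      A ∈ (((a :: l).zip l).foldl (fun (s : ℝ × List Piece) e =>
        (s.1 + euclideanDist e.1 e.2, mkPiece s.1 e :: s.2)) s).2 ↔
      A ∈ piecesFrom s.1 a l ∨ A ∈ s.2 := by
    intro l
    induction l with
    | nil => simp [piecesFrom]
    | cons b l ih =>
      intro a s
      rw [List.zip_cons_cons, List.foldl_cons, ih, piecesFrom, List.mem_cons, List.mem_cons]
      tauto
  rw [pieces, h]
  simp

theorem euclideanDist_coords (a b : Plane) : euclideanDist (coords a) (coords b) = dist a b := by
  rw [EuclideanSpace.dist_eq, Fin.sum_univ_two, Real.dist_eq, Real.dist_eq, sq_abs, sq_abs,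
    euclideanDist, coords, coords, sq, sq]

theorem chainLength_nonneg : ∀ τ : List Plane, 0 ≤ chainLength τ
  | [] => le_rfl
  | [_] => le_rfl
  | _ :: b :: l => add_nonneg dist_nonneg (chainLength_nonneg (b :: l))

theorem chainPoint_zero (a : Plane) (l : List Plane) : chainPoint (a :: l) 0 = a := by
  cases l with
  | nil => rfl
  | cons b l => simp [chainPoint, dist_nonneg]

theorem coords_lineMap (a b : Plane) (t : ℝ) :
    coords (AffineMap.lineMap a b t) = AffineMap.lineMap (coords a) (coords b) t := by
  simp [coords, AffineMap.lineMap_apply]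

theorem chainPoint_of_mem_piecesFrom {A : Piece} {x : ℝ} (h0 : A.1.1 ≤ x) (h1 : x ≤ A.1.2) :
    ∀ (l : List Plane) (a : Plane) (s : ℝ), A ∈ piecesFrom s (coords a) (l.map coords) →
      (s ≤ x ∧ x ≤ s + chainLength (a :: l)) ∧
        coords (chainPoint (a :: l) (x - s)) = pieceAt A x
  | [], a, s, hA => by simp [piecesFrom] at hA
  | b :: l, a, s, hA => by
    rw [List.map_cons, piecesFrom, List.mem_cons, euclideanDist_coords] at hA
    have hlen := chainLength_nonneg (b :: l)
    rcases hA with rfl | hA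
    · simp only [mkPiece, euclideanDist_coords] at h0 h1
      refine ⟨⟨h0, by rw [chainLength]; linarith⟩, ?_⟩
      rw [chainPoint, if_pos (by linarith), coords_lineMap]
      -- If `a = b`, division by zero gives slope `0`, and both sides equal `a`.
      simp only [pieceAt, mkPiece, euclideanDist_coords]
      apply Prod.ext
      · rw [lineMap_fst_eq]; ring
      · rw [lineMap_snd_eq]; ring
    · obtain ⟨⟨h2, h3⟩, h4⟩ := chainPoint_of_mem_piecesFrom h0 h1 l b _ hA
      have hd := dist_nonneg (x := a) (y := b)
      refine ⟨⟨by linarith, by rw [chainLength]; linarith⟩, ?_⟩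
      rw [← h4, chainPoint]
      -- At the common end of two segments `chainPoint` uses the earlier one and the piece belongs
      -- to a later one; both give `b`.
      split_ifs with h5
      · have h6 : x - s = dist a b := by linarith
        have h7 : x - (s + dist a b) = 0 := by linarith
        rw [h6, h7, chainPoint_zero]
        by_cases hab : a = b
        · subst hab; simp
        · rw [div_self (dist_ne_zero.2 hab), AffineMap.lineMap_apply_one]
      · rw [sub_add_eq_sub_sub]

theorem exists_mem_piecesFrom {x : ℝ} : ∀ (l : List Plane) (a : Plane) (s : ℝ), l ≠ [] → s ≤ x →
    x ≤ s + chainLength (a :: l) →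
      ∃ A ∈ piecesFrom s (coords a) (l.map coords), A.1.1 ≤ x ∧ x ≤ A.1.2
  | [], _, _, h, _, _ => absurd rfl h
  | b :: l, a, s, _, h0, h1 => by
    rw [List.map_cons, piecesFrom, euclideanDist_coords]
    rw [chainLength] at h1
    by_cases hx : x ≤ s + dist a b
    · refine ⟨_, List.mem_cons_self, h0, ?_⟩
      rwa [mkPiece, euclideanDist_coords]
    · rw [not_le] at hx
      have hl : l ≠ [] := by
        rintro rfl
        simp only [chainLength] at h1
        linarith
      obtain ⟨A, hA, h2⟩ := exists_mem_piecesFrom l b (s + dist a b) hl hx.le (by linarith)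
      exact ⟨A, List.mem_cons_of_mem _ hA, h2⟩

/-- The segments of a trajectory cover it. -/
theorem exists_mem_pieces_iff {τ : List Plane} (hτ : τ ≠ []) (x : ℝ) (p : ℝ × ℝ → Prop) :
    (∃ A ∈ pieces (τ.map coords), (A.1.1 ≤ x ∧ x ≤ A.1.2) ∧ p (pieceAt A x)) ↔
      (0 ≤ x ∧ x ≤ chainLength τ) ∧ p (coords (chainPoint τ x)) := by
  obtain ⟨a, l, rfl⟩ := List.exists_cons_of_ne_nil hτ
  -- Repeating the first vertex gives even a one-vertex trajectory a piece, and changes neither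
  -- lengths nor points.
  have hlen : chainLength (a :: a :: l) = chainLength (a :: l) := by simp [chainLength]
  have hpoint : ∀ x, 0 ≤ x → chainPoint (a :: a :: l) x = chainPoint (a :: l) x := by
    intro x hx
    rw [chainPoint, dist_self]
    split_ifs with h
    · rw [le_antisymm h hx, chainPoint_zero]; simp
    · rw [sub_zero]
  simp only [List.map_cons, mem_pieces_cons]
  constructor
  · rintro ⟨A, hA, ⟨h0, h1⟩, hp⟩
    obtain ⟨⟨h2, h3⟩, h4⟩ := chainPoint_of_mem_piecesFrom h0 h1 (a :: l) a 0 (by simpa using hA)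
    rw [hlen, zero_add] at h3
    rw [sub_zero, hpoint x h2] at h4
    exact ⟨⟨h2, h3⟩, h4 ▸ hp⟩
  · rintro ⟨⟨h2, h3⟩, hp⟩
    obtain ⟨A, hA, h0, h1⟩ := exists_mem_piecesFrom (a :: l) a 0 (by simp) h2
      (by rwa [hlen, zero_add])
    obtain ⟨-, h4⟩ := chainPoint_of_mem_piecesFrom h0 h1 (a :: l) a 0 hA
    rw [sub_zero, hpoint x h2] at h4
    exact ⟨A, by simpa using hA, ⟨h0, h1⟩, h4 ▸ hp⟩

/-! ## Simple polygons in coordinates -/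

/-- The coordinates as a linear homeomorphism. -/
noncomputable def coordsEquiv : Plane ≃L[ℝ] ℝ × ℝ :=
  (EuclideanSpace.equiv (Fin 2) ℝ).trans (ContinuousLinearEquiv.finTwoArrow ℝ ℝ)

theorem coords_injective : Function.Injective coords := coordsEquiv.injective

theorem image_coords_segment (a b : Plane) :
    coords '' segment ℝ a b = segment ℝ (coords a) (coords b) :=
  image_segment ℝ (coordsEquiv.toLinearEquiv.toLinearMap.toAffineMap) a b

theorem segment_coords_subset_iff {P : Set Plane} {a b : Plane} :
    segment ℝ (coords a) (coords b) ⊆ coords '' P ↔ Visible P a b := by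
  rw [← image_coords_segment, Set.image_subset_image_iff coords_injective, Visible]

theorem polygonEdges_ofFn {n : ℕ} (f : Fin n → ℝ × ℝ) :
    polygonEdges (List.ofFn f) = List.ofFn fun i => (f i, f (finRotate n i)) := by
  cases n with
  | zero => simp [polygonEdges]
  | succ n =>
    rw [List.ofFn_succ (f := f)]
    refine List.ext_getElem (by simp [polygonEdges]) fun i h1 h2 => ?_
    have hi : i < n + 1 := by simpa using h2
    simp only [polygonEdges, List.getElem_zip, List.getElem_ofFn]
    refine Prod.ext ?_ ?_
    · cases i with
      | zero => rfl
      | succ i =>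
        have hi' : i < n := by omega
        simp [hi']
    · rcases Nat.lt_succ_iff_lt_or_eq.1 hi with hi' | rfl
      · have : finRotate (n + 1) ⟨i, hi⟩ = Fin.succ ⟨i, hi'⟩ := finRotate_of_lt hi'
        simp [hi', this]
      · have : finRotate (i + 1) ⟨i, hi⟩ = 0 := finRotate_last'
        rw [this]
        simp

/-- The topological conditions transfer along the homeomorphism; those on the edges come from
injectivity of the closed chain. -/
theorem IsSimplePolygon.isPolygonalRegion {n : ℕ} {v : Polygon Plane n} {P : Set Plane}
    (h : IsSimplePolygon v P) :
    IsPolygonalRegion (polygonEdges (List.ofFn fun i => coords (v i))) (coords '' P) := by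
  rw [polygonEdges_ofFn]
  have hpath : ∀ (i : Fin n) (t : ℝ), AffineMap.lineMap (coords (v i)) (coords (v (finRotate n i)))
      t = coords (v.edgePath ℝ i t) := fun i t => (coords_lineMap _ _ _).symm
  have hzero : ∀ i : Fin n, v.edgePath ℝ i 0 = v i := fun i => AffineMap.lineMap_apply_zero _ _
  have hone : ∀ i : Fin n, v.edgePath ℝ i 1 = v (finRotate n i) :=
    fun i => AffineMap.lineMap_apply_one _ _
  have hinj : ∀ i j : Fin n, v i = v j → i = j := fun i j hij =>
    (h.simple i j 0 ⟨le_rfl, one_pos⟩ 0 ⟨le_rfl, one_pos⟩ (by rw [hzero, hzero, hij])).1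
  have hcl : ∀ s : Set Plane, coords '' closure s = closure (coords '' s) :=
    coordsEquiv.toHomeomorph.image_closure
  have hint : ∀ s : Set Plane, coords '' interior s = interior (coords '' s) :=
    coordsEquiv.toHomeomorph.image_interior
  have hfr : ∀ s : Set Plane, coords '' frontier s = frontier (coords '' s) :=
    coordsEquiv.toHomeomorph.image_frontier
  refine ⟨?_, ?_, fun z => ?_, ?_, ?_, ?_⟩
  · rw [← hint, ← hcl, h.closure_interior]
  · exact (coordsEquiv : Plane →L[ℝ] ℝ × ℝ).lipschitz.isBounded_image h.bounded
  · rw [← hfr, h.frontier_eq]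
    simp only [Polygon.boundary, Set.image_iUnion, Set.mem_iUnion, Polygon.edgeSet,
      affineSegment_eq_segment, image_coords_segment, List.mem_ofFn, exists_exists_eq_and]
  · simp only [List.mem_ofFn]
    rintro _ ⟨i, rfl⟩ _ ⟨j, rfl⟩ z hz hz'
    obtain ⟨s, hs0, hs1, rfl⟩ := mem_openSegment_iff.1 hz
    obtain ⟨t, ht0, ht1, hst⟩ := mem_segment_iff.1 hz'
    rw [hpath, hpath] at hst
    have hst' := coords_injective hst
    rcases ht1.eq_or_lt with rfl | ht1
    -- The end of an edge is the start of the next one, so simplicity would make the parameter `s >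
    -- 0` equal to `0`.
    · rw [hone, ← hzero] at hst'
      exact absurd (h.simple _ _ 0 ⟨le_rfl, one_pos⟩ s ⟨hs0.le, hs1⟩ hst').2 hs0.ne
    · rw [(h.simple _ _ t ⟨ht0, ht1⟩ s ⟨hs0.le, hs1⟩ hst').1]
  · simp only [List.mem_ofFn]
    rintro _ ⟨i, rfl⟩ hi
    have hi' : v i = v (finRotate n i) := coords_injective hi
    -- A degenerate edge takes the same value at the distinct parameters `0` and `1 / 2`.
    have := (h.simple i i 0 ⟨le_rfl, one_pos⟩ (1 / 2) ⟨by norm_num, by norm_num⟩ (by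
      simp only [Polygon.edgePath, ← hi', AffineMap.lineMap_same, AffineMap.const_apply])).2
    norm_num at this
  · refine List.nodup_ofFn.2 fun i j hij => hinj i j ?_
    exact coords_injective (congrArg Prod.fst hij)

/-! ## The table -/

/-- For each pair of pieces visibility is a closed condition on the distances that depends only on
the signs of bilinear functions; the rectangles of the pairs cover all distances. -/
theorem exists_covers_visibilityTable_iff {n : ℕ} {v : Polygon Plane n} {P : Set Plane}
    {τq τr : List Plane} (h : IsSimplePolygon v P) (hq : IsTrajectoryIn τq P)
    (hr : IsTrajectoryIn τr P) (x y : ℝ) :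
    (∃ R ∈ visibilityTable (encode v τq τr), R.Covers x y) ↔
      (0 ≤ x ∧ x ≤ chainLength τq) ∧ (0 ≤ y ∧ y ≤ chainLength τr) ∧
        Visible P (chainPoint τq x) (chainPoint τr y) := by
  have hreg := h.isPolygonalRegion
  set E := polygonEdges (List.ofFn fun i => coords (v i)) with hE
  have hmemQ : ∀ A ∈ pieces (τq.map coords), ∀ x, A.1.1 ≤ x → x ≤ A.1.2 →
      pieceAt A x ∈ coords '' P := by
    intro A hA x h0 h1
    obtain ⟨h2, h3⟩ := (exists_mem_pieces_iff hq.1 x (fun p => p = pieceAt A x)).1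
      ⟨A, hA, ⟨h0, h1⟩, rfl⟩
    exact h3 ▸ Set.mem_image_of_mem _ (hq.2 x h2)
  have hpair : ∀ A ∈ pieces (τq.map coords), ∀ B ∈ pieces (τr.map coords),
      ((∃ R ∈ coveringRecords (E.flatMap fun e => edgeBilinear A B e) A.1.1 A.1.2 B.1.1 B.1.2
        fun z => segmentMem E (pieceAt A z.1) (pieceAt B z.2), R.Covers x y) ↔
      (A.1.1 ≤ x ∧ x ≤ A.1.2) ∧ (B.1.1 ≤ y ∧ y ≤ B.1.2) ∧
        segment ℝ (pieceAt A x) (pieceAt B y) ⊆ coords '' P) := by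
    intro A hA B hB
    have := exists_mem_coveringRecords_iff (F := E.flatMap fun e => edgeBilinear A B e)
      (a := A.1.1) (b := A.1.2) (c := B.1.1) (d := B.1.2)
      (T := fun z => segmentMem E (pieceAt A z.1) (pieceAt B z.2))
      (S := {z | segment ℝ (pieceAt A z.1) (pieceAt B z.2) ⊆ coords '' P}) ?_ ?_ ?_ (x, y)
    · rw [this]
      simp only [and_assoc]
      rfl
    -- Closedness: at each fixed ratio, the point of the line of sight depends continuously on the
    -- distances and must lie in a closed set.
    · have : {z : ℝ × ℝ | segment ℝ (pieceAt A z.1) (pieceAt B z.2) ⊆ coords '' P} =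
          ⋂ t ∈ Set.Icc (0 : ℝ) 1, {z | AffineMap.lineMap (pieceAt A z.1) (pieceAt B z.2) t ∈
            coords '' P} := by
        ext z
        simp only [segment_eq_image_lineMap, Set.image_subset_iff, Set.mem_iInter]
        rfl
      rw [this]
      refine isClosed_biInter fun t _ => hreg.isClosed.preimage ?_
      simp only [AffineMap.lineMap_apply_module, pieceAt]
      fun_prop
    · intro z _ _ _ _
      exact hreg.segmentMem_eq_true _ _
    · intro z w h0 h1 _ _ hsign hz
      -- The starting point of the line of sight is in the region because the trajectory stays
      -- there.
      refine hreg.segment_subset_of_sign_eq (hmemQ A hA _ h0 h1) (fun e he => ?_) hz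
      rw [← map_bilinEval_edgeBilinear, ← map_bilinEval_edgeBilinear, List.map_map, List.map_map]
      exact List.map_congr_left fun f hf => hsign f (List.mem_flatMap.2 ⟨e, he, hf⟩)
  have htable : (∃ R ∈ visibilityTable (encode v τq τr), R.Covers x y) ↔
      ∃ A ∈ pieces (τq.map coords), (A.1.1 ≤ x ∧ x ≤ A.1.2) ∧
        ∃ B ∈ pieces (τr.map coords), (B.1.1 ≤ y ∧ y ≤ B.1.2) ∧
          segment ℝ (pieceAt A x) (pieceAt B y) ⊆ coords '' P := by
    simp only [visibilityTable, encode, List.mem_flatMap]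
    constructor
    · rintro ⟨R, ⟨A, hA, B, hB, hR⟩, hc⟩
      obtain ⟨h1, h2, h3⟩ := (hpair A hA B hB).1 ⟨R, hR, hc⟩
      exact ⟨A, hA, h1, B, hB, h2, h3⟩
    · rintro ⟨A, hA, h1, B, hB, h2, h3⟩
      obtain ⟨R, hR, hc⟩ := (hpair A hA B hB).2 ⟨h1, h2, h3⟩
      exact ⟨R, ⟨A, hA, B, hB, hR⟩, hc⟩
  rw [htable, exists_mem_pieces_iff hq.1 x (fun p => ∃ B ∈ pieces (τr.map coords),
    (B.1.1 ≤ y ∧ y ≤ B.1.2) ∧ segment ℝ p (pieceAt B y) ⊆ coords '' P),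
    exists_mem_pieces_iff hr.1 y (fun r => segment ℝ (coords (chainPoint τq x)) r ⊆ coords '' P),
    segment_coords_subset_iff]

/-! ## Queries -/

/-- The conditions on `s ≥ 0` under which a record covers the point at parameter `s` on the line
`(x₀ + x₁ s, y₀ + y₁ s)`, where `L = ((x₀, x₁), (y₀, y₁))`. -/
def recordQuads (L : (ℝ × ℝ) × (ℝ × ℝ)) (R : VisRecord) : List (ℝ × ℝ × ℝ) :=
  [(0, 1, 0), (L.1.1 - R.1.1, L.1.2, 0), (R.1.2 - L.1.1, -L.1.2, 0),
    (L.2.1 - R.2.1.1, L.2.2, 0), (R.2.1.2 - L.2.1, -L.2.2, 0)] ++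
  R.2.2.map fun f => (f.1 + f.2.1 * L.1.1 + f.2.2.1 * L.2.1 + f.2.2.2 * (L.1.1 * L.2.1),
    f.2.1 * L.1.2 + f.2.2.1 * L.2.2 + f.2.2.2 * (L.1.1 * L.2.2 + L.1.2 * L.2.1),
    f.2.2.2 * (L.1.2 * L.2.2))

/-- The maximal intervals of parameters `s ≥ 0` of points of the line
`(x₀ + x₁ s, y₀ + y₁ s)` that are covered by a table. -/
noncomputable def lineQuery (W : List VisRecord) (L : (ℝ × ℝ) × (ℝ × ℝ)) : List (ℝ × ℝ) :=
  quadIntervals (W.map fun R => recordQuads L R)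

@[fun_prop]
theorem PolyTime.lineQuery {α : Type} [Sized α] {W : α → List VisRecord}
    {L : α → (ℝ × ℝ) × (ℝ × ℝ)} (hW : PolyTime W) (hL : PolyTime L) :
    PolyTime fun a => lineQuery (W a) (L a) := by
  unfold _root_.lineQuery recordQuads; fun_prop

theorem forall_recordQuads_iff (L : (ℝ × ℝ) × (ℝ × ℝ)) (R : VisRecord) (s : ℝ) :
    (∀ q ∈ recordQuads L R, 0 ≤ quadEval q s) ↔
      0 ≤ s ∧ R.Covers (L.1.1 + L.1.2 * s) (L.2.1 + L.2.2 * s) := by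
  simp only [recordQuads, List.forall_mem_append, List.forall_mem_cons, List.not_mem_nil,
    false_imp_iff, forall_const, and_true, List.forall_mem_map, quadEval, VisRecord.Covers]
  constructor
  · rintro ⟨⟨h1, h2, h3, h4, h5⟩, h6⟩
    refine ⟨by linarith, by linarith, by linarith, by linarith, by linarith, fun f hf => ?_⟩
    have := h6 f hf
    linarith
  · rintro ⟨h1, h2, h3, h4, h5, h6⟩
    refine ⟨⟨by linarith, by linarith, by linarith, by linarith, by linarith⟩, fun f hf => ?_⟩
    have := h6 f hf
    linarith

theorem listsIntervals_lineQuery {W : List VisRecord} {L : (ℝ × ℝ) × (ℝ × ℝ)} {S : Set ℝ}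
    (hS : ∀ s, s ∈ S ↔ 0 ≤ s ∧ ∃ R ∈ W, R.Covers (L.1.1 + L.1.2 * s) (L.2.1 + L.2.2 * s))
    (hb : BddAbove S) : ListsIntervals (lineQuery W L) S := by
  refine listsIntervals_quadIntervals (fun s => ?_) hb ⟨0, fun s hs => ((hS s).1 hs).1⟩
  simp only [hS, List.mem_map, exists_exists_and_eq_and, forall_recordQuads_iff]
  constructor
  · rintro ⟨h0, R, hR, h⟩
    exact ⟨R, hR, h0, h⟩
  · rintro ⟨R, hR, h0, h⟩
    exact ⟨h0, R, hR, h⟩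

theorem bddAbove_of_mul_le {S : Set ℝ} {C M : ℝ} (hC : 0 < C) (h : ∀ s ∈ S, C * s ≤ M) :
    BddAbove S :=
  ⟨M / C, fun s hs => by rw [le_div_iff₀ hC, mul_comm]; exact h s hs⟩

/-! ### Input size and the final bounds -/

theorem size_coords_list (l : List (ℝ × ℝ)) : size l = 2 + 4 * l.length := by
  induction l with
  | nil => rfl
  | cons x l ih => rw [size_cons, ih, size_prod, size_real, size_real, List.length_cons]; ring

theorem size_encode {n : ℕ} (v : Polygon Plane n) (τq τr : List Plane) :
    size (encode v τq τr) = 6 + 4 * (n + (τq.length + τr.length)) := by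
  simp only [encode, size_prod, size_coords_list, List.length_ofFn, List.length_map]
  ring

/-- The factor `2` pays for space; the common exponent `K` serves all programs at once. -/
theorem RealProg.runsWithin_of_time_le {α β : Type} {p : RealProg α β} {a : α} {N s k K : ℕ}
    (h : p.time a ≤ s ^ k) (hs : s ≤ 8 * N) (hN : 0 < N) (hk : k ≤ K) :
    p.RunsWithin a (2 * 8 ^ K * N ^ K) := by
  have h1 : p.time a ≤ 8 ^ K * N ^ K := by
    rw [← mul_pow]
    exact h.trans ((Nat.pow_le_pow_left hs k).trans (Nat.pow_le_pow_right (by omega) hk))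
  have h2 := p.space_le_two_mul_time a
  rw [mul_assoc]
  constructor <;> omega

theorem mainTheorem6 :
    ∃ (solve : RealProg Input (List VisRecord))
      (times velocitiesQ velocitiesR : RealProg (List VisRecord × ℝ × ℝ) (List (ℝ × ℝ)))
      (c k : ℕ),
    ∀ (n m : ℕ) (v : Polygon Plane n) (P : Set Plane) (τq τr : List Plane),
      IsSimplePolygon v P → IsTrajectoryIn τq P → IsTrajectoryIn τr P →
      m = τq.length + τr.length →
      -- the table of all solutions, for all velocities, is computed in polynomial time and space
      solve.RunsWithin (encode v τq τr) (c * (n + m) ^ k) ∧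
      (∀ C₀ C₁ t : ℝ, 0 ≤ C₀ → 0 ≤ C₁ → 0 ≤ t →
        (VisibleAt P τq τr C₀ C₁ t ↔
          ∃ R ∈ solve.eval (encode v τq τr), R.Covers (C₀ * t) (C₁ * t))) ∧
      -- from the table, the time intervals of visibility for given velocities
      (∀ C₀ C₁ : ℝ, 0 ≤ C₀ → 0 ≤ C₁ → 0 < C₀ + C₁ →
        times.RunsWithin (solve.eval (encode v τq τr), C₀, C₁) (c * (n + m) ^ k) ∧
        ListsIntervals (times.eval (solve.eval (encode v τq τr), C₀, C₁))
          {t | VisibleAt P τq τr C₀ C₁ t}) ∧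
      -- from the table, the velocity ranges of one entity for a given velocity of the other one
      (∀ C₁ t : ℝ, 0 ≤ C₁ → 0 < t →
        velocitiesQ.RunsWithin (solve.eval (encode v τq τr), C₁, t) (c * (n + m) ^ k) ∧
        ListsIntervals (velocitiesQ.eval (solve.eval (encode v τq τr), C₁, t))
          {C₀ | 0 ≤ C₀ ∧ VisibleAt P τq τr C₀ C₁ t}) ∧
      (∀ C₀ t : ℝ, 0 ≤ C₀ → 0 < t →
        velocitiesR.RunsWithin (solve.eval (encode v τq τr), C₀, t) (c * (n + m) ^ k) ∧
        ListsIntervals (velocitiesR.eval (solve.eval (encode v τq τr), C₀, t))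
          {C₁ | 0 ≤ C₁ ∧ VisibleAt P τq τr C₀ C₁ t}) := by
  obtain ⟨-, solve, hsolve, ks, hks⟩ := PolyTime.visibilityTable
  -- The table has polynomial size, so the time of a query on it is polynomial in the original
  -- input.
  have hinput : PolyTime fun a : Input × ℝ × ℝ => (visibilityTable a.1, a.2) :=
    (PolyTime.visibilityTable.comp (by fun_prop)).pair (by fun_prop)
  -- The three lines: with time as parameter, `(C₀ s, C₁ s)`; with an unknown velocity `s` at fixed
  -- time `t`, `(s t, C₁ t)` and `(C₀ t, s t)`.
  have h1 : PolyTime fun a : List VisRecord × ℝ × ℝ =>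
      lineQuery a.1 ((0, a.2.1), (0, a.2.2)) := by fun_prop
  have h2 : PolyTime fun a : List VisRecord × ℝ × ℝ =>
      lineQuery a.1 ((0, a.2.2), (a.2.1 * a.2.2, 0)) := by fun_prop
  have h3 : PolyTime fun a : List VisRecord × ℝ × ℝ =>
      lineQuery a.1 ((a.2.1 * a.2.2, 0), (0, a.2.2)) := by fun_prop
  obtain ⟨-, times, htimes, ht⟩ := h1
  obtain ⟨-, velQ, hvelQ, hq⟩ := h2
  obtain ⟨-, velR, hvelR, hr⟩ := h3
  obtain ⟨kt, hkt⟩ := ht.comp hinput.1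
  obtain ⟨kq, hkq⟩ := hq.comp hinput.1
  obtain ⟨kr, hkr⟩ := hr.comp hinput.1
  refine ⟨solve, times, velQ, velR, 2 * 8 ^ (ks + kt + kq + kr), ks + kt + kq + kr, ?_⟩
  intro n m v P τq τr hP hτq hτr hm
  have hn := hP.three_le
  have htable := exists_covers_visibilityTable_iff hP hτq hτr
  have hvis : ∀ C₀ C₁ t : ℝ, 0 ≤ C₀ → 0 ≤ C₁ → 0 ≤ t → (VisibleAt P τq τr C₀ C₁ t ↔
      ∃ R ∈ visibilityTable (encode v τq τr), R.Covers (C₀ * t) (C₁ * t)) := by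
    intro C₀ C₁ t h0 h1 ht
    rw [htable, VisibleAt]
    have h2 := mul_nonneg h0 ht
    have h3 := mul_nonneg h1 ht
    tauto
  -- The sizes are `6 + 4(n + m)` and, with two more numbers, `10 + 4(n + m)`; `n ≥ 3` gives the
  -- factor `8`.
  have hsize : size (encode v τq τr) ≤ 8 * (n + m) := by
    rw [size_encode, hm]; omega
  have hsize' : ∀ x y : ℝ, size (encode v τq τr, x, y) ≤ 8 * (n + m) := by
    intro x y
    have : size (encode v τq τr, x, y) = size (encode v τq τr) + 4 := rfl
    rw [this, size_encode, hm]
    omega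
  have hpos : 0 < n + m := by omega
  simp only [hsolve]
  refine ⟨RealProg.runsWithin_of_time_le (hks _) hsize hpos (by omega), hvis, ?_, ?_, ?_⟩
  · intro C₀ C₁ h0 h1 h01
    refine ⟨RealProg.runsWithin_of_time_le (hkt (_, C₀, C₁)) (hsize' _ _) hpos (by omega), ?_⟩
    rw [htimes]
    refine listsIntervals_lineQuery (fun t => ?_) ?_
    · simp only [zero_add]
      constructor
      · intro ht
        exact ⟨ht.1, (hvis C₀ C₁ t h0 h1 ht.1).1 ht⟩
      · rintro ⟨ht, hR⟩
        exact (hvis C₀ C₁ t h0 h1 ht).2 hR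
    -- Adding the two length conditions bounds the time even if one of the velocities is `0`.
    · refine bddAbove_of_mul_le (M := chainLength τq + chainLength τr) h01 fun t ht => ?_
      have h2 := ht.2.1
      have h3 := ht.2.2.1
      linarith
  · intro C₁ t h1 ht
    refine ⟨RealProg.runsWithin_of_time_le (hkq (_, C₁, t)) (hsize' _ _) hpos (by omega), ?_⟩
    rw [hvelQ]
    refine listsIntervals_lineQuery (fun C₀ => ?_) ?_
    · simp only [zero_add, zero_mul, add_zero]
      refine and_congr_right fun h0 => ?_
      rw [hvis C₀ C₁ t h0 h1 ht.le, mul_comm C₀]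
    · exact bddAbove_of_mul_le ht fun C₀ hC => by
        rw [mul_comm]; exact hC.2.2.1
  · intro C₀ t h0 ht
    refine ⟨RealProg.runsWithin_of_time_le (hkr (_, C₀, t)) (hsize' _ _) hpos (by omega), ?_⟩
    rw [hvelR]
    refine listsIntervals_lineQuery (fun C₁ => ?_) ?_
    · simp only [zero_add, zero_mul, add_zero]
      refine and_congr_right fun h1 => ?_
      rw [hvis C₀ C₁ t h0 h1 ht.le, mul_comm C₁]
    · exact bddAbove_of_mul_le ht fun C₁ hC => by
        rw [mul_comm]; exact hC.2.2.2.1
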